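/- Let $k$ be a field. A *quantum groupoid* (weak Hopf algebra) over $k$ is a $k$-algebra $H$ that is also a $k$-coalgebra $(H,\Delta,\varepsilon)$, $\Delta(h)=h_1\otimes h_2$, with $$\Delta(hg)=\Delta(h)\Delta(g),\qquad (\Delta\otimes\mathrm{id})\Delta(1)=(\Delta(1)\otimes 1)(1\otimes\Delta(1))=(1\otimes\Delta(1))(\Delta(1)\otimes 1),$$ $$\varepsilon(hgl)=\varepsilon(hg_1)\varepsilon(g_2l)=\varepsilon(hg_2)\varepsilon(g_1l)\qquad(h,g,l\in H),$$ together with a bijective linear map $S:H\to H$ (the antipode) such that $h_1S(h_2)=\varepsilon_t(h)$, $S(h_1)h_2=\varepsilon_s(h)$ and $S(h_1)h_2S(h_3)=S(h)$, where, with $\Delta(1)=1_1\otimes 1_2$, $\varepsilon_t(h)=\varepsilon(1_1h)1_2$ and $\varepsilon_s(h)=1_1\varepsilon(h1_2)$. Put $H_t=\varepsilon_t(H)$ and $H_s=\varepsilon_s(H)$. $H$ is *cocommutative* if $h_1\otimes h_2=h_2\otimes h_1$ for all $h\in H$. A *weak invertible unit 2-cocycle* is an element $F=F^{(1)}\otimes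 F^{(2)}\in\Delta(1)(H\otimes H)\Delta^{cop}(1)$ such that 1. there is $F^{-1}=F^{-(1)}\otimes F^{-(2)}\in\Delta^{cop}(1)(H\otimes H)\Delta(1)$ with $FF^{-1}=\Delta(1)$ and $F^{-1}F=\Delta^{cop}(1)$; 2. $\big((\Delta\otimes\mathrm{id})F\big)(F\otimes 1)=\big((\mathrm{id}\otimes\Delta)F\big)(1\otimes F)$; 3. for all $y\in H_s$ and $z\in H_t$, $$(1\otimes y)F=F(y\otimes 1),\quad (z\otimes 1)F=F(1\otimes z),\quad F^{-1}(1\otimes y)=(y\otimes 1)F^{-1},\quad F^{-1}(z\otimes 1)=(1\otimes z)F^{-1},$$ $$(1\otimes y)F^{-1}=(S^{-1}(y)\otimes 1)F^{-1},\quad F(z\otimes 1)=F(1\otimes S^{-1}(z));$$ 4. $(\varepsilon\otimes\mathrm{id})F=1=(\mathrm{id}\otimes\varepsilon)F$. Let $H$ be a cocommutative quantum groupoid and $F$ a weak invertible unit 2-cocycle. Let ${}_H\mathcal{M}_F$ be the braided monoidal category whose objects and morphisms are the left $H$-modules and $H$-linear maps, with the following structure. The tensor product is $M\otimes_tN=\{w\in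 M\otimes_kN:\Delta(1)w=w\}$, and we write $m\otimes_t n=\Delta(1)(m\otimes n)$; here $h\in H$ acts by $$h\cdot(m\otimes_tn)=F^{-(1)}h_1F^{(1)}m\otimes_tF^{-(2)}h_2F^{(2)}n .$$ The unit object is $H_t$ with action $h\cdot z=\varepsilon_t(hz)$. The associativity constraint is the restriction of $(u\otimes v)\otimes w\mapsto u\otimes(v\otimes w)$, the unit constraints are $H_t\otimes_tM\to M$, $z\otimes v\mapsto zv$, and $M\otimes_tH_t\to M$, $v\otimes z\mapsto S^{-1}(z)v$, and the braiding is $$\Phi(m\otimes_tn)=F^{-(1)}F^{(2)}n\otimes_tF^{-(2)}F^{(1)}m .$$ Let $C_H(H_s)=\{a\in H: ay=ya\text{ for all }y\in H_s\}$, an object of ${}_H\mathcal{M}_F$ under the adjoint action $\mathrm{Ad}_h(a)=h_1aS(h_2)$. **Theorem.** $C_H(H_s)$ is a Hopf algebra in the braided monoidal category ${}_H\mathcal{M}_F$ with, for $a,b\in C_H(H_s)$ and $z\in H_t$, - product $a\cdot_Fb=\mathrm{Ad}_{F^{(1)}}(a)\,\mathrm{Ad}_{F^{(2)}}(b)$ and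 unit $\eta_F:H_t\to C_H(H_s)$, $\eta_F(z)=z$; - coproduct $\Delta_F(a)=\mathrm{Ad}_{F^{-(1)}}(a_1)\otimes_t\mathrm{Ad}_{F^{-(2)}}(a_2)$ and counit $\varepsilon_F:C_H(H_s)\to H_t$, $\varepsilon_F(a)=\varepsilon_t(a)$; - antipode $S_F(a)=S(a)$. -/

import Mathlib

/-!
Quantum groupoids (weak Hopf algebras), weak invertible unit 2-cocycles, and the braided monoidal
category of modules over a cocommutative quantum groupoid twisted by such a cocycle.
-/

universe u v

noncomputable section

namespace WeakHopf

open scoped TensorProduct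
open Coalgebra

set_option linter.unusedSectionVars false
set_option linter.unusedSimpArgs false

section Basic

variable (k : Type v) (H : Type u) [Field k] [Ring H] [Algebra k H]

/-- The associativity isomorphism of algebras `(H ⊗ H) ⊗ H ≃ H ⊗ (H ⊗ H)`. -/
abbrev asc : (H ⊗[k] H) ⊗[k] H ≃ₐ[k] H ⊗[k] (H ⊗[k] H) :=
  Algebra.TensorProduct.assoc k k k H H H

/-- The flip `a ⊗ b ↦ b ⊗ a` of `H ⊗ H`. -/
abbrev flip : (H ⊗[k] H) ≃ₐ[k] (H ⊗[k] H) := Algebra.TensorProduct.comm k H H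

variable [Coalgebra k H]

variable {H} in
/-- The map `ε ⊗ id : H ⊗ H → H`. -/
def counitL : H ⊗[k] H →ₗ[k] H :=
  (TensorProduct.lid k H).toLinearMap ∘ₗ (counit (R := k) (A := H)).rTensor H

variable {H} in
/-- The map `id ⊗ ε : H ⊗ H → H`. -/
def counitR : H ⊗[k] H →ₗ[k] H :=
  (TensorProduct.rid k H).toLinearMap ∘ₗ (counit (R := k) (A := H)).lTensor H

/-- The target map `ε_t(h) = ε(1₁ h) 1₂`. -/
def targetMap : H →ₗ[k] H :=
  counitL k ∘ₗ LinearMap.mulLeft k (comul (R := k) (1 : H)) ∘ₗ (TensorProduct.mk k H H).flip 1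

/-- The source map `ε_s(h) = 1₁ ε(h 1₂)`. -/
def sourceMap : H →ₗ[k] H :=
  counitR k ∘ₗ LinearMap.mulRight k (comul (R := k) (1 : H)) ∘ₗ TensorProduct.mk k H H 1

/-- A weak bialgebra: an algebra which is also a coalgebra, with multiplicative
comultiplication, such that
`(Δ ⊗ id)Δ(1) = (Δ(1) ⊗ 1)(1 ⊗ Δ(1)) = (1 ⊗ Δ(1))(Δ(1) ⊗ 1)` and
`ε(hgl) = ε(h g₁) ε(g₂ l) = ε(h g₂) ε(g₁ l)`. -/
class WeakBialgebra : Prop where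
  comul_mul : ∀ h l : H, comul (R := k) (h * l) = comul h * comul l
  comul_one_left :
    (comul (R := k) (A := H)).rTensor H (comul 1) =
      (comul 1 ⊗ₜ[k] (1 : H)) * (asc k H).symm ((1 : H) ⊗ₜ[k] comul 1)
  comul_one_right :
    (comul (R := k) (A := H)).rTensor H (comul 1) =
      (asc k H).symm ((1 : H) ⊗ₜ[k] comul 1) * (comul 1 ⊗ₜ[k] (1 : H))
  counit_mul_mul_left : ∀ h g l : H, counit (R := k) (h * g * l) =
    LinearMap.mul' k k (TensorProduct.map (counit ∘ₗ LinearMap.mulLeft k h)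
      (counit ∘ₗ LinearMap.mulRight k l) (comul g))
  counit_mul_mul_right : ∀ h g l : H, counit (R := k) (h * g * l) =
    LinearMap.mul' k k (TensorProduct.map (counit ∘ₗ LinearMap.mulLeft k h)
      (counit ∘ₗ LinearMap.mulRight k l) (flip k H (comul g)))

/-- A quantum groupoid (weak Hopf algebra) with bijective antipode `S`:
`S * id = ε_s`, `id * S = ε_t`, `S * id * S = S` for the convolution product. -/
class QuantumGroupoid extends WeakBialgebra k H where
  /-- The antipode, a bijective linear map. -/
  antipode : H ≃ₗ[k] H
  antipode_conv_id : ∀ h : H,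
    LinearMap.mul' k H (TensorProduct.map antipode.toLinearMap LinearMap.id (comul h)) =
      sourceMap k H h
  id_conv_antipode : ∀ h : H,
    LinearMap.mul' k H (TensorProduct.map LinearMap.id antipode.toLinearMap (comul h)) =
      targetMap k H h
  antipode_conv_id_conv_antipode : ∀ h : H,
    LinearMap.mul' k H (TensorProduct.map
      (LinearMap.mul' k H ∘ₗ TensorProduct.map antipode.toLinearMap LinearMap.id)
      antipode.toLinearMap ((comul (R := k) (A := H)).rTensor H (comul h))) = antipode h

end Basic

section Base

variable {k : Type v} {H : Type u} [Field k] [Ring H] [Algebra k H] [Coalgebra k H]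

@[simp] lemma counitL_tmul (a b : H) : counitL k (a ⊗ₜ[k] b) = counit (R := k) a • b := by
  simp [counitL]

@[simp] lemma counitR_tmul (a b : H) : counitR k (a ⊗ₜ[k] b) = counit (R := k) b • a := by
  simp [counitR]

lemma counitL_comul (h : H) : counitL k (comul (R := k) h) = h := by
  simp [counitL]

lemma counitR_comul (h : H) : counitR k (comul (R := k) h) = h := by
  simp [counitR]

lemma targetMap_apply (h : H) :
    targetMap k H h = counitL k (comul (R := k) (1 : H) * (h ⊗ₜ[k] 1)) := rfl

lemma sourceMap_apply (h : H) :
    sourceMap k H h = counitR k (((1 : H) ⊗ₜ[k] h) * comul (R := k) (1 : H)) := rfl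

lemma counitL_mul_left (z : H) (x : H ⊗[k] H) :
    counitL k (((1 : H) ⊗ₜ[k] z) * x) = z * counitL k x := by
  induction x with
  | zero => simp
  | tmul a b => simp
  | add x y hx hy => simp [mul_add, hx, hy]

lemma counitL_mul_right (z : H) (x : H ⊗[k] H) :
    counitL k (x * ((1 : H) ⊗ₜ[k] z)) = counitL k x * z := by
  induction x with
  | zero => simp
  | tmul a b => simp
  | add x y hx hy => simp [add_mul, hx, hy]

lemma counitR_mul_left (z : H) (x : H ⊗[k] H) :
    counitR k ((z ⊗ₜ[k] (1 : H)) * x) = z * counitR k x := by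
  induction x with
  | zero => simp
  | tmul a b => simp
  | add x y hx hy => simp [mul_add, hx, hy]

lemma counitR_mul_right (z : H) (x : H ⊗[k] H) :
    counitR k (x * (z ⊗ₜ[k] (1 : H))) = counitR k x * z := by
  induction x with
  | zero => simp
  | tmul a b => simp
  | add x y hx hy => simp [add_mul, hx, hy]

lemma flip_comul [IsCocomm k H] (h : H) :
    flip k H (comul (R := k) h) = comul (R := k) h := comm_comul k h

variable [WeakBialgebra k H]

lemma comul_mul (h l : H) : comul (R := k) (h * l) = comul h * comul l :=
  WeakBialgebra.comul_mul h l

@[simp] lemma one_mul_comul (h : H) : comul (R := k) (1 : H) * comul h = comul (R := k) h := by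
  rw [← comul_mul, one_mul]

@[simp] lemma comul_mul_one (h : H) : comul (R := k) h * comul (1 : H) = comul (R := k) h := by
  rw [← comul_mul, mul_one]

lemma targetMap_one : targetMap k H 1 = 1 := by
  rw [targetMap_apply, ← Algebra.TensorProduct.one_def, mul_one, counitL_comul]

lemma sourceMap_one : sourceMap k H 1 = 1 := by
  rw [sourceMap_apply, ← Algebra.TensorProduct.one_def, one_mul, counitR_comul]


lemma counit_mul_targetMap (b g : H) :
    counit (R := k) (b * targetMap k H g) = counit (R := k) (b * g) := by
  have key : ∀ y : H ⊗[k] H, counit (R := k) (b * counitL k (y * (g ⊗ₜ[k] 1))) =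
      LinearMap.mul' k k (TensorProduct.map (counit ∘ₗ LinearMap.mulLeft k b)
      (counit ∘ₗ LinearMap.mulRight k g) (flip k H y)) := by
    intro y
    induction y with
    | zero => simp
    | tmul a c => simp [mul_comm]
    | add x y hx hy => simp only [add_mul, mul_add, map_add, hx, hy]
  rw [targetMap_apply, key, ← WeakBialgebra.counit_mul_mul_right, mul_one]

lemma counit_sourceMap_mul (b g : H) :
    counit (R := k) (sourceMap k H g * b) = counit (R := k) (g * b) := by
  have key : ∀ y : H ⊗[k] H, counit (R := k) (counitR k ((1 ⊗ₜ[k] g) * y) * b) =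
      LinearMap.mul' k k (TensorProduct.map (counit ∘ₗ LinearMap.mulLeft k g)
      (counit ∘ₗ LinearMap.mulRight k b) (flip k H y)) := by
    intro y
    induction y with
    | zero => simp
    | tmul a c => simp
    | add x y hx hy => simp only [add_mul, mul_add, map_add, hx, hy]
  rw [sourceMap_apply, key, ← WeakBialgebra.counit_mul_mul_right, mul_one]

lemma targetMap_mul_targetMap (h g : H) :
    targetMap k H (h * targetMap k H g) = targetMap k H (h * g) := by
  have key : ∀ x : H ⊗[k] H, counitL k (x * ((h * targetMap k H g) ⊗ₜ[k] 1)) =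
      counitL k (x * ((h * g) ⊗ₜ[k] 1)) := by
    intro x
    induction x with
    | zero => simp
    | tmul a c => simp [← mul_assoc, counit_mul_targetMap]
    | add x y hx hy => simp only [add_mul, map_add, hx, hy]
  exact key _

lemma sourceMap_sourceMap_mul (h g : H) :
    sourceMap k H (sourceMap k H h * g) = sourceMap k H (h * g) := by
  have key : ∀ x : H ⊗[k] H, counitR k ((1 ⊗ₜ[k] (sourceMap k H h * g)) * x) =
      counitR k ((1 ⊗ₜ[k] (h * g)) * x) := by
    intro x
    induction x with
    | zero => simp
    | tmul a c => simp [mul_assoc, counit_sourceMap_mul]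
    | add x y hx hy => simp only [mul_add, map_add, hx, hy]
  exact key _

lemma targetMap_targetMap (h : H) : targetMap k H (targetMap k H h) = targetMap k H h := by
  simpa using targetMap_mul_targetMap (k := k) 1 h

lemma comul_targetMap (g : H) : comul (R := k) (targetMap k H g) =
    (targetMap k H g ⊗ₜ[k] 1) * comul (1 : H) := by
  let c : (H ⊗[k] H) ⊗[k] H →ₗ[k] H ⊗[k] H :=
    TensorProduct.map (counitL k ∘ₗ LinearMap.mulRight k (g ⊗ₜ[k] 1)) LinearMap.id
  have h1 : ∀ x : H ⊗[k] H, comul (R := k) (counitL k (x * (g ⊗ₜ[k] 1))) =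
      c ((asc k H).symm ((comul (R := k) (A := H)).lTensor H x)) := by
    intro x
    induction x with
    | zero => simp
    | tmul a b =>
      have : ∀ y : H ⊗[k] H, counit (R := k) (a * g) • y = c ((asc k H).symm (a ⊗ₜ y)) := by
        intro y
        induction y with
        | zero => simp
        | tmul p q => simp [c, TensorProduct.smul_tmul']
        | add x y hx hy => simp only [smul_add, TensorProduct.tmul_add, map_add, hx, hy]
      simp [this]
    | add x y hx hy => simp only [add_mul, map_add, hx, hy]
  have h2 : ∀ p q : H ⊗[k] H, c ((p ⊗ₜ[k] 1) * (asc k H).symm (1 ⊗ₜ q)) =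
      (counitL k (p * (g ⊗ₜ[k] 1)) ⊗ₜ[k] 1) * q := by
    intro p q
    induction p with
    | zero => simp
    | tmul a b =>
      induction q with
      | zero => simp
      | tmul c' d => simp [c]
      | add x y hx hy => simp only [TensorProduct.tmul_add, map_add, mul_add, hx, hy]
    | add x y hx hy => simp only [add_mul, TensorProduct.add_tmul, map_add, hx, hy]
  have h3 : (asc k H).symm ((comul (R := k) (A := H)).lTensor H (comul 1)) =
      (comul (R := k) (A := H)).rTensor H (comul 1) := by
    rw [AlgEquiv.symm_apply_eq]
    exact (Coalgebra.coassoc_apply 1).symm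
  rw [targetMap_apply, h1, h3, WeakBialgebra.comul_one_left, h2]

lemma comul_sourceMap (g : H) : comul (R := k) (sourceMap k H g) =
    comul (1 : H) * (1 ⊗ₜ[k] sourceMap k H g) := by
  let c : (H ⊗[k] H) ⊗[k] H →ₗ[k] H ⊗[k] H :=
    (TensorProduct.rid k (H ⊗[k] H)).toLinearMap ∘ₗ
      TensorProduct.map LinearMap.id (counit ∘ₗ LinearMap.mulLeft k g)
  have h1 : ∀ x : H ⊗[k] H, comul (R := k) (counitR k ((1 ⊗ₜ[k] g) * x)) =
      c ((comul (R := k) (A := H)).rTensor H x) := by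
    intro x
    induction x with
    | zero => simp
    | tmul a b => simp [c]
    | add x y hx hy => simp only [mul_add, map_add, hx, hy]
  have h2 : ∀ p q : H ⊗[k] H, c ((p ⊗ₜ[k] 1) * (asc k H).symm (1 ⊗ₜ q)) =
      p * (1 ⊗ₜ[k] counitR k ((1 ⊗ₜ[k] g) * q)) := by
    intro p q
    induction p with
    | zero => simp
    | tmul a b =>
      induction q with
      | zero => simp
      | tmul c' d => simp [c]
      | add x y hx hy => simp only [TensorProduct.tmul_add, map_add, mul_add, hx, hy]
    | add x y hx hy => simp only [add_mul, TensorProduct.add_tmul, map_add, hx, hy]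
  rw [sourceMap_apply, h1, WeakBialgebra.comul_one_left, h2]

/-- `ε_s(1₁) ⊗ 1₂ = 1₁ ⊗ 1₂`. -/
lemma rTensor_sourceMap_comul_one :
    (sourceMap k H).rTensor H (comul (R := k) (1 : H)) = comul (R := k) (1 : H) := by
  have h1 : ∀ x : H ⊗[k] H, (counitR k).rTensor H ((comul (R := k) (A := H)).rTensor H x) = x := by
    intro x
    induction x with
    | zero => simp
    | tmul a b => simp [counitR_comul]
    | add x y hx hy => simp only [map_add, hx, hy]
  have h2 : ∀ p q : H ⊗[k] H, (counitR k).rTensor H ((asc k H).symm (1 ⊗ₜ q) * (p ⊗ₜ[k] 1)) =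
      (counitR k ∘ₗ LinearMap.mulRight k p ∘ₗ TensorProduct.mk k H H 1).rTensor H q := by
    intro p q
    induction p with
    | zero => simp
    | tmul a b =>
      induction q with
      | zero => simp
      | tmul c d => simp
      | add x y hx hy => simp only [TensorProduct.tmul_add, map_add, mul_add, add_mul, hx, hy]
    | add x y hx hy =>
      rw [TensorProduct.add_tmul, mul_add, map_add, hx, hy, ← LinearMap.add_apply,
        ← LinearMap.rTensor_add]
      congr 2
      ext
      simp [mul_add]
  have := h1 (comul (R := k) (1 : H))
  rw [WeakBialgebra.comul_one_right, h2] at this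
  exact this

section Cocomm

variable [IsCocomm k H]

lemma comul_sourceMap' (g : H) : comul (R := k) (sourceMap k H g) =
    comul (1 : H) * (sourceMap k H g ⊗ₜ[k] 1) := by
  rw [← flip_comul, comul_sourceMap, map_mul, flip_comul]
  simp

lemma targetMap_sourceMap (g : H) : targetMap k H (sourceMap k H g) = sourceMap k H g := by
  rw [targetMap_apply, ← comul_sourceMap', counitL_comul]

/-- The elements `y` of the common base `H_t = H_s` of a cocommutative weak bialgebra. -/
def InBase (k : Type v) {H : Type u} [Field k] [Ring H] [Algebra k H] [Coalgebra k H] (y : H) :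
    Prop := targetMap k H y = y

lemma inBase_targetMap (g : H) : InBase k (targetMap k H g) := targetMap_targetMap g

lemma inBase_sourceMap (g : H) : InBase k (sourceMap k H g) := targetMap_sourceMap g

lemma InBase.comul_left {y : H} (hy : InBase k y) :
    comul (R := k) y = (y ⊗ₜ[k] 1) * comul (1 : H) := by
  have := comul_targetMap (k := k) y
  rwa [hy] at this

lemma InBase.comul_right {y : H} (hy : InBase k y) :
    comul (R := k) y = ((1 : H) ⊗ₜ[k] y) * comul (1 : H) := by
  rw [← flip_comul, hy.comul_left, map_mul, flip_comul]
  simp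

lemma InBase.sourceMap_eq {y : H} (hy : InBase k y) : sourceMap k H y = y := by
  rw [sourceMap_apply, ← hy.comul_right, counitR_comul]

lemma InBase.comul_left' {y : H} (hy : InBase k y) :
    comul (R := k) y = comul (1 : H) * (y ⊗ₜ[k] 1) := by
  have := comul_sourceMap' (k := k) y
  rwa [hy.sourceMap_eq] at this

lemma InBase.comul_right' {y : H} (hy : InBase k y) :
    comul (R := k) y = comul (1 : H) * (1 ⊗ₜ[k] y) := by
  have := comul_sourceMap (k := k) y
  rwa [hy.sourceMap_eq] at this

lemma inBase_of_comul {y : H} (hy : comul (R := k) y = (y ⊗ₜ[k] 1) * comul (1 : H)) :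
    InBase k y := by
  have h1 : comul (R := k) y = ((1 : H) ⊗ₜ[k] y) * comul (1 : H) := by
    rw [← flip_comul, hy, map_mul, flip_comul]
    simp
  have h2 : sourceMap k H y = y := by
    rw [sourceMap_apply, ← h1, counitR_comul]
  rw [← h2]
  exact inBase_sourceMap y

lemma InBase.mul {y z : H} (hy : InBase k y) (hz : InBase k z) : InBase k (y * z) := by
  apply inBase_of_comul
  rw [comul_mul, hy.comul_left, hz.comul_left, mul_assoc, ← hz.comul_left, one_mul_comul,
    hz.comul_left, ← mul_assoc]
  simp

lemma InBase.commute {y z : H} (hy : InBase k y) (hz : InBase k z) : y * z = z * y := by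
  have h1 : comul (R := k) (z * y) = ((y * z) ⊗ₜ[k] 1) * comul (1 : H) := by
    rw [comul_mul, hz.comul_right, hy.comul_left, mul_assoc, ← hy.comul_left, one_mul_comul,
      hy.comul_left, ← mul_assoc]
    have : ((1 : H) ⊗ₜ[k] z) * (y ⊗ₜ[k] 1) = (y ⊗ₜ[k] 1) * ((1 : H) ⊗ₜ[k] z) := by simp
    rw [this, mul_assoc, ← hz.comul_right, hz.comul_left, ← mul_assoc]
    simp
  have h2 := (hz.mul hy).comul_left
  have h3 : counitR k (((z * y) ⊗ₜ[k] (1 : H)) * comul (R := k) (1 : H)) =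
      counitR k (((y * z) ⊗ₜ[k] (1 : H)) * comul (R := k) (1 : H)) := by rw [← h1, ← h2]
  rw [counitR_mul_left, counitR_mul_left, counitR_comul] at h3
  simpa using h3.symm

/-- `h₁ ⊗ ε_t(h₂) = 1₁ h ⊗ 1₂`. -/
lemma lTensor_targetMap_comul (h : H) :
    (targetMap k H).lTensor H (comul (R := k) h) = comul (R := k) (1 : H) * (h ⊗ₜ[k] 1) := by
  have h0 : comul (R := k) (1 : H) * (h ⊗ₜ[k] 1) = (counitR k).rTensor H
      ((comul (R := k) (A := H)).rTensor H (comul (R := k) (1 : H)) * (comul h ⊗ₜ 1)) := by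
    generalize comul (R := k) (1 : H) = x
    induction x with
    | zero => simp
    | tmul a b => simp [← comul_mul, counitR_comul]
    | add x y hx hy => simp only [map_add, add_mul, hx, hy]
  have h2 : ∀ p q : H ⊗[k] H, (counitR k).rTensor H ((asc k H).symm (1 ⊗ₜ q) * (p ⊗ₜ[k] 1)) =
      (counitL k ∘ₗ LinearMap.mulLeft k q ∘ₗ
        (TensorProduct.mk k H H).flip 1).lTensor H p := by
    intro p q
    induction p with
    | zero => simp
    | tmul a b =>
      induction q with
      | zero => simp
      | tmul c d => simp [TensorProduct.smul_tmul]
      | add x y hx hy => simp_all [TensorProduct.tmul_add, map_add, mul_add, add_mul]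
    | add x y hx hy => simp only [TensorProduct.add_tmul, map_add, mul_add, hx, hy]
  rw [h0, WeakBialgebra.comul_one_right, mul_assoc, Algebra.TensorProduct.tmul_mul_tmul,
    one_mul_comul, one_mul, h2]
  rfl

/-- `ε_t(h₁) ⊗ h₂ = 1₁ ⊗ 1₂ h`. -/
lemma rTensor_targetMap_comul (h : H) :
    (targetMap k H).rTensor H (comul (R := k) h) = comul (R := k) (1 : H) * (1 ⊗ₜ[k] h) := by
  have h1 := congrArg (flip k H) (lTensor_targetMap_comul (k := k) h)
  have h2 : ∀ x : H ⊗[k] H, flip k H ((targetMap k H).lTensor H x) =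
      (targetMap k H).rTensor H (flip k H x) := by
    intro x
    induction x with
    | zero => simp
    | tmul a b => simp
    | add x y hx hy => simp only [map_add, hx, hy]
  rw [h2, flip_comul, map_mul, flip_comul] at h1
  simpa using h1

lemma rTensor_targetMap_comul_one :
    (targetMap k H).rTensor H (comul (R := k) (1 : H)) = comul (R := k) (1 : H) := by
  rw [rTensor_targetMap_comul, ← Algebra.TensorProduct.one_def, mul_one]

lemma lTensor_targetMap_comul_one :
    (targetMap k H).lTensor H (comul (R := k) (1 : H)) = comul (R := k) (1 : H) := by
  rw [lTensor_targetMap_comul, ← Algebra.TensorProduct.one_def, mul_one]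

end Cocomm

end Base

section Antipode

variable {k : Type v} {H : Type u} [Field k] [Ring H] [Algebra k H] [Coalgebra k H]
  [QuantumGroupoid k H]

/-- The antipode as a linear map. -/
abbrev S (k : Type v) {H : Type u} [Field k] [Ring H] [Algebra k H] [Coalgebra k H]
    [QuantumGroupoid k H] : H →ₗ[k] H := (QuantumGroupoid.antipode (k := k) (H := H)).toLinearMap

lemma antipode_conv_id (h : H) :
    LinearMap.mul' k H (TensorProduct.map (S k) LinearMap.id (comul h)) = sourceMap k H h :=
  QuantumGroupoid.antipode_conv_id h

lemma id_conv_antipode (h : H) :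
    LinearMap.mul' k H (TensorProduct.map LinearMap.id (S k) (comul h)) = targetMap k H h :=
  QuantumGroupoid.id_conv_antipode h

open WithConv in
lemma conv_S_id : (toConv (S k) * toConv (LinearMap.id (R := k) (M := H))) =
    toConv (sourceMap k H) := by
  ext h; exact antipode_conv_id h

open WithConv in
lemma conv_id_S : (toConv (LinearMap.id (R := k) (M := H)) * toConv (S k)) =
    toConv (targetMap k H) := by
  ext h; exact id_conv_antipode h

open WithConv in
lemma conv_source_S : (toConv (sourceMap k H) * toConv (S k)) = toConv (S (H := H) k) := by
  ext h
  have h1 := QuantumGroupoid.antipode_conv_id_conv_antipode (k := k) h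
  rw [← conv_S_id, LinearMap.convMul_apply]
  refine Eq.trans ?_ h1
  generalize comul (R := k) h = x
  induction x with
  | zero => simp
  | tmul a b => rfl
  | add x y hx hy => simp only [map_add, hx, hy]

open WithConv in
lemma conv_S_target : (toConv (S k) * toConv (targetMap k H)) = toConv (S (H := H) k) := by
  rw [← conv_id_S, ← mul_assoc, conv_S_id, conv_source_S]

variable [IsCocomm k H]

/-- The antipode is the identity on the base. -/
lemma InBase.antipode {y : H} (hy : InBase k y) : S k y = y := by
  have h1 := congrArg (fun f : WithConv (H →ₗ[k] H) => f.ofConv y) (conv_source_S (k := k) (H := H))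
  simp only [LinearMap.convMul_def, LinearMap.comp_apply] at h1
  rw [← h1, hy.comul_left]
  have h2 : ∀ x : H ⊗[k] H, LinearMap.mul' k H (TensorProduct.map (sourceMap k H) (S k)
      ((y ⊗ₜ[k] 1) * (sourceMap k H).rTensor H x)) =
      y * LinearMap.mul' k H (TensorProduct.map LinearMap.id (S k)
        ((sourceMap k H).rTensor H x)) := by
    intro x
    induction x with
    | zero => simp
    | tmul a b =>
      have := (hy.mul (inBase_sourceMap (k := k) a)).sourceMap_eq
      simp [this, mul_assoc]
    | add x y hx hy => simp only [map_add, mul_add, hx, hy]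
  have h3 := h2 (comul 1)
  rw [rTensor_sourceMap_comul_one] at h3
  rw [h3, id_conv_antipode, targetMap_one, mul_one]

lemma InBase.antipode_symm {y : H} (hy : InBase k y) :
    (QuantumGroupoid.antipode (k := k)).symm y = y := by
  rw [LinearEquiv.symm_apply_eq]
  exact hy.antipode.symm

/-- `S(h₁) h₂ z S(h₃) = z S(h)` for `z` in the base. -/
lemma conv_S_mulRight_S {z : H} (hz : InBase k z) (h : H) :
    LinearMap.mul' k H (TensorProduct.map (S k) (LinearMap.mul' k H ∘ₗ
      TensorProduct.map (LinearMap.mulRight k z) (S k) ∘ₗ comul) (comul h)) = z * S k h := by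
  have h1 : (WithConv.toConv (S k) * WithConv.toConv (LinearMap.mulRight k z)) =
      WithConv.toConv (LinearMap.mulLeft k z ∘ₗ sourceMap k H) := by
    ext w
    have h2 : ∀ x : H ⊗[k] H, LinearMap.mul' k H (TensorProduct.map (S k)
        (LinearMap.mulRight k z) x) =
        LinearMap.mul' k H (TensorProduct.map (S k) LinearMap.id x) * z := by
      intro x
      induction x with
      | zero => simp
      | tmul a b => simp [mul_assoc]
      | add x y hx hy => simp only [map_add, add_mul, hx, hy]
    refine (h2 _).trans ?_
    rw [antipode_conv_id]
    exact (inBase_sourceMap w).commute hz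
  have h3 : (WithConv.toConv (LinearMap.mulLeft k z ∘ₗ sourceMap k H) * WithConv.toConv (S k)) =
      WithConv.toConv (LinearMap.mulLeft k z ∘ₗ S k) := by
    ext w
    have h2 : ∀ x : H ⊗[k] H, LinearMap.mul' k H (TensorProduct.map
        (LinearMap.mulLeft k z ∘ₗ sourceMap k H) (S k) x) =
        z * LinearMap.mul' k H (TensorProduct.map (sourceMap k H) (S k) x) := by
      intro x
      induction x with
      | zero => simp
      | tmul a b => simp [mul_assoc]
      | add x y hx hy => simp only [map_add, mul_add, hx, hy]
    refine (h2 _).trans ?_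
    exact congrArg (fun f : WithConv (H →ₗ[k] H) => z * f.ofConv w) conv_source_S
  have h4 := mul_assoc (WithConv.toConv (S (H := H) k)) (WithConv.toConv (LinearMap.mulRight k z))
    (WithConv.toConv (S k))
  rw [h1, h3] at h4
  exact (congrArg (fun f : WithConv (H →ₗ[k] H) => f.ofConv h) h4).symm

/-- The antipode is anti-multiplicative. -/
lemma antipode_mul (h g : H) : S k (h * g) = S k g * S k h := by
  let N : (H ⊗[k] H) →ₗ[k] H := S k ∘ₗ LinearMap.mul' k H
  let m : (H ⊗[k] H) →ₗ[k] H := LinearMap.mul' k H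
  let T : (H ⊗[k] H) →ₗ[k] H := LinearMap.mul' k H ∘ₗ TensorProduct.map (S k) (S k) ∘ₗ
    (TensorProduct.comm k H H).toLinearMap
  have gen : ∀ (f f' : H ⊗[k] H →ₗ[k] H) (h g : H),
      (WithConv.toConv f * WithConv.toConv f') (h ⊗ₜ[k] g) =
      LinearMap.mul' k H (TensorProduct.map f f'
        (TensorProduct.tensorTensorTensorComm k H H H H (comul h ⊗ₜ comul g))) :=
    fun _ _ _ _ => rfl
  -- convolutions of maps factoring through the product
  have fac : ∀ (f f' : H →ₗ[k] H) (h g : H),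
      (WithConv.toConv (f ∘ₗ m) * WithConv.toConv (f' ∘ₗ m)) (h ⊗ₜ[k] g) =
      LinearMap.mul' k H (TensorProduct.map f f' (comul (h * g))) := by
    intro f f' h g
    rw [gen, comul_mul]
    generalize comul (R := k) h = x
    generalize comul (R := k) g = y
    induction x with
    | zero => simp
    | tmul a b =>
      induction y with
      | zero => simp
      | tmul c d => simp [m]
      | add x y hx hy => simp only [map_add, mul_add, TensorProduct.tmul_add, hx, hy]
    | add x y hx hy => simp only [map_add, add_mul, TensorProduct.add_tmul, hx, hy]
  have mT : WithConv.toConv m * WithConv.toConv T = WithConv.toConv (targetMap k H ∘ₗ m) := by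
    ext h g
    have h1 : ∀ x y : H ⊗[k] H, LinearMap.mul' k H (TensorProduct.map m T
        (TensorProduct.tensorTensorTensorComm k H H H H (x ⊗ₜ y))) =
        LinearMap.mul' k H (TensorProduct.map LinearMap.id (S k)
          (x * (LinearMap.mul' k H (TensorProduct.map LinearMap.id (S k) y) ⊗ₜ[k] 1))) := by
      intro x y
      induction x with
      | zero => simp
      | tmul a b =>
        induction y with
        | zero => simp
        | tmul c d => simp [m, T, mul_assoc]
        | add x y hx hy =>
          simp only [map_add, mul_add, TensorProduct.tmul_add, TensorProduct.add_tmul, hx, hy]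
      | add x y hx hy => simp only [map_add, add_mul, TensorProduct.add_tmul, hx, hy]
    refine (h1 (comul h) (comul g)).trans ?_
    have h2 : comul (R := k) h * (targetMap k H g ⊗ₜ[k] 1) = comul (h * targetMap k H g) := by
      rw [comul_mul, (inBase_targetMap g).comul_left', ← mul_assoc, comul_mul_one]
    rw [id_conv_antipode, h2, id_conv_antipode, targetMap_mul_targetMap]
    rfl
  have Tm : WithConv.toConv T * WithConv.toConv m = WithConv.toConv (sourceMap k H ∘ₗ m) := by
    ext h g
    have h1 : ∀ x y : H ⊗[k] H, LinearMap.mul' k H (TensorProduct.map T m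
        (TensorProduct.tensorTensorTensorComm k H H H H (x ⊗ₜ y))) =
        LinearMap.mul' k H (TensorProduct.map (S k) LinearMap.id
          (((1 : H) ⊗ₜ[k] LinearMap.mul' k H (TensorProduct.map (S k) LinearMap.id x)) * y)) := by
      intro x y
      induction y with
      | zero => simp
      | tmul a b =>
        induction x with
        | zero => simp
        | tmul c d => simp [m, T, mul_assoc]
        | add x y hx hy =>
          simp only [map_add, add_mul, TensorProduct.tmul_add, TensorProduct.add_tmul, hx, hy]
      | add x y hx hy => simp only [map_add, mul_add, TensorProduct.tmul_add, hx, hy]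
    refine (h1 (comul h) (comul g)).trans ?_
    have h2 : ((1 : H) ⊗ₜ[k] sourceMap k H h) * comul (R := k) g = comul (sourceMap k H h * g) := by
      rw [comul_mul, (inBase_sourceMap h).comul_right, mul_assoc, one_mul_comul]
    rw [antipode_conv_id, h2, antipode_conv_id, sourceMap_sourceMap_mul]
    rfl
  have Nm : WithConv.toConv N * WithConv.toConv m = WithConv.toConv (sourceMap k H ∘ₗ m) := by
    ext h g
    exact (fac (S k) LinearMap.id h g).trans (antipode_conv_id (h * g))
  have NmN : WithConv.toConv N * WithConv.toConv (targetMap k H ∘ₗ m) = WithConv.toConv N := by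
    ext h g
    exact (fac (S k) (targetMap k H) h g).trans
      (congrArg (fun f : WithConv (H →ₗ[k] H) => f.ofConv (h * g)) conv_S_target)
  have TmT : WithConv.toConv T * (WithConv.toConv m * WithConv.toConv T) = WithConv.toConv T := by
    ext h g
    rw [mT]
    have h1 : ∀ y : H ⊗[k] H, LinearMap.mul' k H (TensorProduct.map T (targetMap k H ∘ₗ m)
        (TensorProduct.tensorTensorTensorComm k H H H H (comul h ⊗ₜ y))) =
        LinearMap.mul' k H (TensorProduct.map (S k) (targetMap k H) y) * S k h := by
      intro y
      induction y with
      | zero => simp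
      | tmul a b =>
        have hb := inBase_targetMap (k := k) b
        have hK : (LinearMap.mul' k H ∘ₗ TensorProduct.map
            (LinearMap.mulRight k (targetMap k H b)) (S k) ∘ₗ comul) =
            targetMap k H ∘ₗ LinearMap.mulRight k b := by
          ext w
          have h3 : ∀ u : H ⊗[k] H, LinearMap.mul' k H (TensorProduct.map
              (LinearMap.mulRight k (targetMap k H b)) (S k) u) = LinearMap.mul' k H
              (TensorProduct.map LinearMap.id (S k) (u * (targetMap k H b ⊗ₜ 1))) := by
            intro u
            induction u with
            | zero => simp
            | tmul p q => simp
            | add x y hx hy => simp only [map_add, add_mul, hx, hy]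
          have h4 : comul (R := k) w * (targetMap k H b ⊗ₜ[k] 1) =
              comul (w * targetMap k H b) := by
            rw [comul_mul, hb.comul_left', ← mul_assoc, comul_mul_one]
          have h5 := h3 (comul w)
          rw [h4, id_conv_antipode, targetMap_mul_targetMap] at h5
          exact h5
        have h6 := conv_S_mulRight_S hb h
        rw [hK] at h6
        have h7 : ∀ x : H ⊗[k] H, LinearMap.mul' k H (TensorProduct.map T (targetMap k H ∘ₗ m)
            (TensorProduct.tensorTensorTensorComm k H H H H (x ⊗ₜ (a ⊗ₜ b)))) =
            S k a * LinearMap.mul' k H (TensorProduct.map (S k)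
              (targetMap k H ∘ₗ LinearMap.mulRight k b) x) := by
          intro x
          induction x with
          | zero => simp
          | tmul p q => simp [T, m, mul_assoc]
          | add x y hx hy => simp only [map_add, mul_add, TensorProduct.add_tmul, hx, hy]
        rw [h7, h6]
        simp [mul_assoc]
      | add x y hx hy => simp only [map_add, add_mul, TensorProduct.tmul_add, hx, hy]
    refine (h1 (comul g)).trans ?_
    have h8 := congrArg (fun f : WithConv (H →ₗ[k] H) => f.ofConv g * S k h)
      (conv_S_target (k := k) (H := H))
    exact h8.trans (by simp [T])
  have e : WithConv.toConv N = WithConv.toConv T := by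
    rw [← NmN, ← mT, ← mul_assoc, Nm, ← Tm, mul_assoc, TmT]
  exact congrArg (fun f : WithConv (H ⊗[k] H →ₗ[k] H) => f.ofConv (h ⊗ₜ g)) e

end Antipode

section Adjoint

variable (k : Type v) (H : Type u) [Field k] [Ring H] [Algebra k H] [Coalgebra k H]

/-- The target space `H_t`, the image of the target map. -/
def targetSpace : Submodule k H := LinearMap.range (targetMap k H)

/-- The source space `H_s`, the image of the source map. -/
def sourceSpace : Submodule k H := LinearMap.range (sourceMap k H)

/-- The centralizer `C_H(H_s)` of the source space in `H`. -/
def sourceCentralizer : Subalgebra k H := Subalgebra.centralizer k (sourceSpace k H : Set H)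

variable {k H} [QuantumGroupoid k H]

/-- The map `a ⊗ b ↦ (g ↦ a g S(b))`. -/
def sandwich : H ⊗[k] H →ₗ[k] H →ₗ[k] H :=
  TensorProduct.lift (LinearMap.mk₂ k
    (fun a b => LinearMap.mulRight k (S k b) ∘ₗ LinearMap.mulLeft k a)
    (fun a a' b => by ext; simp [add_mul]) (fun c a b => by ext; simp)
    (fun a b b' => by ext; simp [mul_add]) (fun c a b => by ext; simp))

@[simp] lemma sandwich_tmul (a b g : H) : sandwich (a ⊗ₜ[k] b) g = a * g * S k b := by
  simp [sandwich]

/-- The adjoint action `Ad_h(g) = h₁ g S(h₂)`. -/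
def Ad : H →ₗ[k] H →ₗ[k] H := sandwich ∘ₗ comul

/-- The componentwise adjoint action `u ⊗ v ↦ (a ⊗ b ↦ Ad_u(a) ⊗ Ad_v(b))`. -/
def Ad₂ : H ⊗[k] H →ₗ[k] H ⊗[k] H →ₗ[k] H ⊗[k] H :=
  TensorProduct.homTensorHomMap (RingHom.id k) H H H H ∘ₗ TensorProduct.map Ad Ad

@[simp] lemma Ad₂_tmul (u v a b : H) :
    Ad₂ (u ⊗ₜ[k] v) (a ⊗ₜ[k] b) = Ad (k := k) u a ⊗ₜ[k] Ad (k := k) v b := rfl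

variable [IsCocomm k H]

lemma mem_targetSpace {y : H} : y ∈ targetSpace k H ↔ InBase k y :=
  ⟨by rintro ⟨x, rfl⟩; exact inBase_targetMap x, fun h => ⟨y, h⟩⟩

lemma mem_sourceSpace {y : H} : y ∈ sourceSpace k H ↔ InBase k y :=
  ⟨by rintro ⟨x, rfl⟩; exact inBase_sourceMap x, fun h => ⟨y, h.sourceMap_eq⟩⟩

lemma mem_sourceCentralizer {a : H} :
    a ∈ sourceCentralizer k H ↔ ∀ y : H, InBase k y → y * a = a * y := by
  simp [sourceCentralizer, Subalgebra.mem_centralizer_iff, mem_sourceSpace]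

lemma sandwich_mul (x y : H ⊗[k] H) (g : H) :
    sandwich (x * y) g = sandwich x (sandwich y g) := by
  induction x with
  | zero => simp
  | tmul a b =>
    induction y with
    | zero => simp
    | tmul c d => rw [Algebra.TensorProduct.tmul_mul_tmul]; simp only [sandwich_tmul, antipode_mul, mul_assoc]
    | add x y hx hy => simp only [map_add, mul_add, LinearMap.add_apply, hx, hy]
  | add x y hx hy => simp only [map_add, add_mul, LinearMap.add_apply, hx, hy]

lemma Ad_mul (h l g : H) : Ad (k := k) (h * l) g = Ad (k := k) h (Ad (k := k) l g) := by
  simp [Ad, comul_mul, sandwich_mul]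

lemma Ad_one {g : H} (hg : g ∈ sourceCentralizer k H) : Ad (k := k) 1 g = g := by
  rw [mem_sourceCentralizer] at hg
  have h1 : ∀ x : H ⊗[k] H, sandwich ((targetMap k H).rTensor H x) g =
      g * LinearMap.mul' k H (TensorProduct.map LinearMap.id (S k)
        ((targetMap k H).rTensor H x)) := by
    intro x
    induction x with
    | zero => simp
    | tmul a b => simp [hg _ (inBase_targetMap a), mul_assoc]
    | add x y hx hy => simp only [map_add, LinearMap.add_apply, mul_add, hx, hy]
  have h2 := h1 (comul 1)
  rw [rTensor_targetMap_comul_one, id_conv_antipode, targetMap_one, mul_one] at h2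
  exact h2

lemma Ad_mem (h g : H) : Ad (k := k) h g ∈ sourceCentralizer k H := by
  rw [mem_sourceCentralizer]
  intro y hy
  have h1 : ∀ x : H ⊗[k] H, y * sandwich x g = sandwich ((y ⊗ₜ[k] 1) * x) g := by
    intro x
    induction x with
    | zero => simp
    | tmul a b => simp [mul_assoc]
    | add x y hx hy => simp only [map_add, LinearMap.add_apply, mul_add, hx, hy]
  have h2 : ∀ x : H ⊗[k] H, sandwich x g * y = sandwich (((1 : H) ⊗ₜ[k] y) * x) g := by
    intro x
    induction x with
    | zero => simp
    | tmul a b =>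
      rw [Algebra.TensorProduct.tmul_mul_tmul, sandwich_tmul, sandwich_tmul, antipode_mul,
        hy.antipode]
      simp [mul_assoc]
    | add x y hx hy => simp only [map_add, LinearMap.add_apply, add_mul, mul_add, hx, hy]
  have h3 : (y ⊗ₜ[k] (1 : H)) * comul (R := k) h = ((1 : H) ⊗ₜ[k] y) * comul h := by
    rw [← one_mul_comul, ← mul_assoc, ← mul_assoc, ← hy.comul_left, ← hy.comul_right]
  simp only [Ad, LinearMap.comp_apply, h1, h2, h3]

end Adjoint

section Cocycle

variable (k : Type v) (H : Type u) [Field k] [Ring H] [Algebra k H] [Coalgebra k H]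
  [QuantumGroupoid k H]

/-- A weak invertible unit 2-cocycle `F ∈ Δ(1)(H ⊗ H)Δᶜᵒᵖ(1)`, with its inverse
`F⁻¹ ∈ Δᶜᵒᵖ(1)(H ⊗ H)Δ(1)`. -/
structure WeakUnitCocycle where
  /-- The element `F`. -/
  F : H ⊗[k] H
  /-- The element `F⁻¹`. -/
  Finv : H ⊗[k] H
  mem : ∃ x, F = comul (1 : H) * x * flip k H (comul 1)
  mem_inv : ∃ x, Finv = flip k H (comul 1) * x * comul (1 : H)
  mul_inv : F * Finv = comul (1 : H)
  inv_mul : Finv * F = flip k H (comul 1)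
  /-- `((Δ ⊗ id)F)F₁₂ = ((id ⊗ Δ)F)F₂₃` -/
  cocycle : asc k H ((comul (R := k) (A := H)).rTensor H F * (F ⊗ₜ[k] (1 : H))) =
    (comul (R := k) (A := H)).lTensor H F * ((1 : H) ⊗ₜ[k] F)
  source_F : ∀ y ∈ sourceSpace k H, ((1 : H) ⊗ₜ[k] y) * F = F * (y ⊗ₜ[k] (1 : H))
  target_F : ∀ z ∈ targetSpace k H, (z ⊗ₜ[k] (1 : H)) * F = F * ((1 : H) ⊗ₜ[k] z)
  Finv_source : ∀ y ∈ sourceSpace k H, Finv * ((1 : H) ⊗ₜ[k] y) = (y ⊗ₜ[k] (1 : H)) * Finv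
  Finv_target : ∀ z ∈ targetSpace k H, Finv * (z ⊗ₜ[k] (1 : H)) = ((1 : H) ⊗ₜ[k] z) * Finv
  source_Finv : ∀ y ∈ sourceSpace k H, ((1 : H) ⊗ₜ[k] y) * Finv =
    ((QuantumGroupoid.antipode (k := k)).symm y ⊗ₜ[k] (1 : H)) * Finv
  F_target : ∀ z ∈ targetSpace k H, F * (z ⊗ₜ[k] (1 : H)) =
    F * ((1 : H) ⊗ₜ[k] (QuantumGroupoid.antipode (k := k)).symm z)
  /-- The unit condition `(ε ⊗ id)F = 1`. -/
  counitL_F : counitL k F = 1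
  /-- The unit condition `(id ⊗ ε)F = 1`. -/
  counitR_F : counitR k F = 1

end Cocycle

section Twist

variable {k : Type v} {H : Type u} [Field k] [Ring H] [Algebra k H] [Coalgebra k H]
  [QuantumGroupoid k H]

namespace WeakUnitCocycle

/-- The map `h ↦ F⁻¹ Δ(h) F` through which `H` acts on tensor products. -/
def twistedComul (F : WeakUnitCocycle k H) : H →ₗ[k] H ⊗[k] H :=
  LinearMap.mulRight k F.F ∘ₗ LinearMap.mulLeft k F.Finv ∘ₗ comul

variable (F : WeakUnitCocycle k H)

lemma twistedComul_apply (h : H) : F.twistedComul h = F.Finv * comul h * F.F := rfl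

variable [IsCocomm k H]

@[simp] lemma one_mul_F : comul (R := k) (1 : H) * F.F = F.F := by
  obtain ⟨x, hx⟩ := F.mem
  rw [hx, ← mul_assoc, ← mul_assoc, one_mul_comul]

@[simp] lemma F_mul_one : F.F * comul (R := k) (1 : H) = F.F := by
  obtain ⟨x, hx⟩ := F.mem
  rw [hx, flip_comul, mul_assoc _ _ (comul 1), one_mul_comul]

@[simp] lemma one_mul_Finv : comul (R := k) (1 : H) * F.Finv = F.Finv := by
  obtain ⟨x, hx⟩ := F.mem_inv
  rw [hx, flip_comul, ← mul_assoc, ← mul_assoc, one_mul_comul]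

@[simp] lemma Finv_mul_one : F.Finv * comul (R := k) (1 : H) = F.Finv := by
  obtain ⟨x, hx⟩ := F.mem_inv
  rw [hx, mul_assoc _ _ (comul 1), one_mul_comul]

lemma Finv_mul_F : F.Finv * F.F = comul (R := k) (1 : H) := by
  rw [F.inv_mul, flip_comul]

lemma F_mul_Finv : F.F * F.Finv = comul (R := k) (1 : H) := F.mul_inv

lemma twistedComul_one : F.twistedComul 1 = comul (R := k) (1 : H) := by
  rw [twistedComul_apply, Finv_mul_one, Finv_mul_F]

lemma twistedComul_mul (h l : H) :
    F.twistedComul (h * l) = F.twistedComul h * F.twistedComul l := by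
  simp only [twistedComul_apply, comul_mul]
  calc _ = F.Finv * comul h * (comul (1 : H) * comul l) * F.F := by
          rw [one_mul_comul]; simp only [mul_assoc]
    _ = _ := by rw [← F.F_mul_Finv]; simp only [mul_assoc]

@[simp] lemma one_mul_twistedComul (h : H) :
    comul (R := k) (1 : H) * F.twistedComul h = F.twistedComul h := by
  simp only [twistedComul_apply, ← mul_assoc, one_mul_Finv]

@[simp] lemma twistedComul_mul_one (h : H) :
    F.twistedComul h * comul (R := k) (1 : H) = F.twistedComul h := by
  simp only [twistedComul_apply, mul_assoc, F_mul_one]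

/-- `Finv` commutes with `1 ⊗ y` for `y` in the base. -/
lemma commute_Finv {y : H} (hy : InBase k y) :
    ((1 : H) ⊗ₜ[k] y) * F.Finv = F.Finv * ((1 : H) ⊗ₜ[k] y) := by
  have h1 := F.source_Finv y (mem_sourceSpace.2 hy)
  rw [hy.antipode_symm] at h1
  rw [h1, F.Finv_source y (mem_sourceSpace.2 hy)]

/-- Maps `φ ⊗ id` are multiplicative when `φ` is. -/
lemma rTensor_mul' {A B : Type u} [Ring A] [Algebra k A] [Ring B] [Algebra k B]
    (φ : H →ₗ[k] A) (hφ : ∀ a b, φ (a * b) = φ a * φ b) (x y : H ⊗[k] B) :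
    φ.rTensor B (x * y) = φ.rTensor B x * φ.rTensor B y := by
  induction x with
  | zero => simp
  | tmul a b =>
    induction y with
    | zero => simp
    | tmul c d => simp [hφ]
    | add x y hx hy => simp only [map_add, mul_add, hx, hy]
  | add x y hx hy => simp only [map_add, add_mul, hx, hy]

lemma lTensor_mul' {A B : Type u} [Ring A] [Algebra k A] [Ring B] [Algebra k B]
    (φ : H →ₗ[k] A) (hφ : ∀ a b, φ (a * b) = φ a * φ b) (x y : B ⊗[k] H) :
    φ.lTensor B (x * y) = φ.lTensor B x * φ.lTensor B y := by
  induction x with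
  | zero => simp
  | tmul a b =>
    induction y with
    | zero => simp
    | tmul c d => simp [hφ]
    | add x y hx hy => simp only [map_add, mul_add, hx, hy]
  | add x y hx hy => simp only [map_add, add_mul, hx, hy]

/-- `(Δ_F ⊗ id)(x) = F₁₂⁻¹ (Δ ⊗ id)(x) F₁₂`. -/
lemma rTensor_twistedComul (x : H ⊗[k] H) :
    F.twistedComul.rTensor H x =
      (F.Finv ⊗ₜ[k] 1) * (comul (R := k) (A := H)).rTensor H x * (F.F ⊗ₜ[k] 1) := by
  induction x with
  | zero => simp
  | tmul a b => simp [twistedComul_apply]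
  | add x y hx hy => simp only [map_add, mul_add, add_mul, hx, hy]

lemma lTensor_twistedComul (x : H ⊗[k] H) :
    F.twistedComul.lTensor H x =
      ((1 : H) ⊗ₜ[k] F.Finv) * (comul (R := k) (A := H)).lTensor H x * ((1 : H) ⊗ₜ[k] F.F) := by
  induction x with
  | zero => simp
  | tmul a b => simp [twistedComul_apply]
  | add x y hx hy => simp only [map_add, mul_add, add_mul, hx, hy]

/-- The iterated cocycle `G = ((id ⊗ Δ)F)F₂₃`. -/
def G : H ⊗[k] (H ⊗[k] H) := (comul (R := k) (A := H)).lTensor H F.F * ((1 : H) ⊗ₜ[k] F.F)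

/-- The inverse of the iterated cocycle. -/
def Ginv : H ⊗[k] (H ⊗[k] H) :=
  ((1 : H) ⊗ₜ[k] F.Finv) * (comul (R := k) (A := H)).lTensor H F.Finv

/-- Another form of the inverse of the iterated cocycle. -/
def Ginv' : H ⊗[k] (H ⊗[k] H) :=
  asc k H ((F.Finv ⊗ₜ[k] (1 : H)) * (comul (R := k) (A := H)).rTensor H F.Finv)

/-- The element `1₁ ⊗ 1₂ ⊗ 1₃`. -/
def P3 (k : Type v) (H : Type u) [Field k] [Ring H] [Algebra k H] [Coalgebra k H] :
    H ⊗[k] (H ⊗[k] H) := (comul (R := k) (A := H)).lTensor H (comul 1)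

lemma coassoc' (h : H) : asc k H ((comul (R := k) (A := H)).rTensor H (comul h)) =
    (comul (R := k) (A := H)).lTensor H (comul h) := Coalgebra.coassoc_apply h

lemma lTensor_comul_mul_one (x : H ⊗[k] H) : (comul (R := k) (A := H)).lTensor H x *
    ((1 : H) ⊗ₜ[k] comul (1 : H)) = (comul (R := k) (A := H)).lTensor H x := by
  induction x with
  | zero => simp
  | tmul a b => simp
  | add x y hx hy => simp only [map_add, add_mul, hx, hy]

lemma rTensor_comul_mul_one (x : H ⊗[k] H) : (comul (R := k) (A := H)).rTensor H x *
    (comul (1 : H) ⊗ₜ[k] (1 : H)) = (comul (R := k) (A := H)).rTensor H x := by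
  induction x with
  | zero => simp
  | tmul a b => simp
  | add x y hx hy => simp only [map_add, add_mul, hx, hy]

lemma G_eq : F.G = asc k H ((comul (R := k) (A := H)).rTensor H F.F * (F.F ⊗ₜ[k] (1 : H))) :=
  F.cocycle.symm

lemma G_mul_Ginv : F.G * F.Ginv = P3 k H := by
  calc _ = (comul (R := k) (A := H)).lTensor H F.F * (((1 : H) ⊗ₜ[k] F.F) *
      ((1 : H) ⊗ₜ[k] F.Finv)) * (comul (R := k) (A := H)).lTensor H F.Finv := by
        simp only [G, Ginv, mul_assoc]
    _ = _ := by
      rw [Algebra.TensorProduct.tmul_mul_tmul, one_mul, F_mul_Finv, lTensor_comul_mul_one,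
        ← lTensor_mul' _ comul_mul, F_mul_Finv, P3]

lemma G_mul_Ginv' : F.G * F.Ginv' = P3 k H := by
  rw [G_eq, Ginv', ← map_mul]
  calc _ = asc k H ((comul (R := k) (A := H)).rTensor H F.F * ((F.F ⊗ₜ[k] (1 : H)) *
      (F.Finv ⊗ₜ[k] (1 : H))) * (comul (R := k) (A := H)).rTensor H F.Finv) := by
        simp only [mul_assoc]
    _ = _ := by
      rw [Algebra.TensorProduct.tmul_mul_tmul, one_mul, F_mul_Finv, rTensor_comul_mul_one,
        ← rTensor_mul' _ comul_mul, F_mul_Finv, P3, coassoc']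

lemma Ginv_mul_P3 : F.Ginv * P3 k H = F.Ginv := by
  rw [P3, Ginv, mul_assoc, ← lTensor_mul' _ comul_mul, Finv_mul_one]

lemma Ginv'_mul_P3 : F.Ginv' * P3 k H = F.Ginv' := by
  rw [P3, ← coassoc', Ginv', ← map_mul, mul_assoc, ← rTensor_mul' _ comul_mul, Finv_mul_one]

lemma P3_mul_G : P3 k H * F.G = F.G := by
  rw [P3, G, ← mul_assoc, ← lTensor_mul' _ comul_mul, one_mul_F]

lemma Ginv_mul_mul_G (h : H) : F.Ginv * (comul (R := k) (A := H)).lTensor H (comul h) * F.G =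
    F.twistedComul.lTensor H (F.twistedComul h) := by
  rw [lTensor_twistedComul, F.twistedComul_apply, lTensor_mul' _ comul_mul,
    lTensor_mul' _ comul_mul, G, Ginv]
  simp only [mul_assoc]

lemma Ginv'_mul_mul_G (h : H) : F.Ginv' * (comul (R := k) (A := H)).lTensor H (comul h) * F.G =
    asc k H (F.twistedComul.rTensor H (F.twistedComul h)) := by
  rw [rTensor_twistedComul, F.twistedComul_apply, rTensor_mul' _ comul_mul,
    rTensor_mul' _ comul_mul, G_eq, Ginv', ← coassoc']
  simp only [mul_assoc, map_mul]

lemma Ginv_mul_G : F.Ginv * F.G = F.twistedComul.lTensor H (comul 1) := by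
  have := F.Ginv_mul_mul_G 1
  rwa [← P3, mul_assoc, P3_mul_G, twistedComul_one] at this

lemma Ginv'_mul_G : F.Ginv' * F.G = asc k H (F.twistedComul.rTensor H (comul 1)) := by
  have := F.Ginv'_mul_mul_G 1
  rwa [← P3, mul_assoc, P3_mul_G, twistedComul_one] at this


lemma P3_eq : P3 k H =
    asc k H (comul (1 : H) ⊗ₜ[k] (1 : H)) * ((1 : H) ⊗ₜ[k] comul (1 : H)) := by
  rw [P3, ← coassoc', WeakBialgebra.comul_one_left, map_mul, AlgEquiv.apply_symm_apply]

lemma P3_eq' : P3 k H =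
    ((1 : H) ⊗ₜ[k] comul (1 : H)) * asc k H (comul (1 : H) ⊗ₜ[k] (1 : H)) := by
  rw [P3, ← coassoc', WeakBialgebra.comul_one_right, map_mul, AlgEquiv.apply_symm_apply]

lemma commute_Finv' {y : H} (hy : InBase k y) :
    (y ⊗ₜ[k] (1 : H)) * F.Finv = F.Finv * (y ⊗ₜ[k] (1 : H)) := by
  rw [← F.Finv_source y (mem_sourceSpace.2 hy), F.Finv_target y (mem_targetSpace.2 hy),
    commute_Finv _ hy]

lemma commute_Finv_left : asc k H (F.Finv ⊗ₜ[k] (1 : H)) * ((1 : H) ⊗ₜ[k] comul (1 : H)) =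
    ((1 : H) ⊗ₜ[k] comul (1 : H)) * asc k H (F.Finv ⊗ₜ[k] (1 : H)) := by
  apply (asc k H).symm.injective
  rw [map_mul, map_mul, AlgEquiv.symm_apply_apply]
  rw [← rTensor_targetMap_comul_one]
  generalize comul (R := k) (1 : H) = x
  induction x with
  | zero => simp
  | tmul a b => simp [commute_Finv _ (inBase_targetMap a)]
  | add x y hx hy => simp only [map_add, TensorProduct.tmul_add, mul_add, add_mul, hx, hy]

lemma commute_Finv_right : ((1 : H) ⊗ₜ[k] F.Finv) * asc k H (comul (1 : H) ⊗ₜ[k] (1 : H)) =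
    asc k H (comul (1 : H) ⊗ₜ[k] (1 : H)) * ((1 : H) ⊗ₜ[k] F.Finv) := by
  rw [← lTensor_targetMap_comul_one]
  generalize comul (R := k) (1 : H) = x
  induction x with
  | zero => simp
  | tmul a b => simp [commute_Finv' _ (inBase_targetMap b)]
  | add x y hx hy => simp only [map_add, TensorProduct.add_tmul, mul_add, add_mul, hx, hy]

lemma rTensor_twistedComul_one :
    asc k H (F.twistedComul.rTensor H (comul 1)) = P3 k H := by
  rw [rTensor_twistedComul, map_mul, map_mul, coassoc', ← P3, P3_eq', ← mul_assoc,
    commute_Finv_left, mul_assoc, mul_assoc, ← map_mul, ← map_mul,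
    Algebra.TensorProduct.tmul_mul_tmul, Algebra.TensorProduct.tmul_mul_tmul, one_mul_F,
    Finv_mul_F, one_mul, one_mul]

lemma lTensor_twistedComul_one :
    F.twistedComul.lTensor H (comul 1) = P3 k H := by
  rw [lTensor_twistedComul, ← P3, P3_eq, ← mul_assoc, commute_Finv_right, mul_assoc, mul_assoc,
    Algebra.TensorProduct.tmul_mul_tmul, Algebra.TensorProduct.tmul_mul_tmul, one_mul_F,
    Finv_mul_F, one_mul, one_mul]

lemma Ginv_eq : F.Ginv' = F.Ginv := by
  calc F.Ginv' = F.Ginv' * F.G * F.Ginv := by rw [mul_assoc, G_mul_Ginv, Ginv'_mul_P3]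
    _ = F.Ginv * F.G * F.Ginv := by
      rw [Ginv'_mul_G, Ginv_mul_G, rTensor_twistedComul_one, lTensor_twistedComul_one]
    _ = F.Ginv := by rw [mul_assoc, G_mul_Ginv, Ginv_mul_P3]

/-- Coassociativity of the twisted comultiplication. -/
lemma twisted_coassoc (h : H) : asc k H (F.twistedComul.rTensor H (F.twistedComul h)) =
    F.twistedComul.lTensor H (F.twistedComul h) := by
  rw [← Ginv'_mul_mul_G, ← Ginv_mul_mul_G, Ginv_eq]

/-- The map `a ⊗ b ↦ ε_t(a) b`. -/
def unitL : H ⊗[k] H →ₗ[k] H :=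
  LinearMap.mul' k H ∘ₗ TensorProduct.map (targetMap k H) LinearMap.id

/-- The map `a ⊗ b ↦ ε_t(b) a`. -/
def unitR : H ⊗[k] H →ₗ[k] H :=
  unitL ∘ₗ (flip k H).toLinearMap

@[simp] lemma unitL_tmul (a b : H) : unitL (a ⊗ₜ[k] b) = targetMap k H a * b := by simp [unitL]
@[simp] lemma unitR_tmul (a b : H) : unitR (a ⊗ₜ[k] b) = targetMap k H b * a := by simp [unitR]

lemma unitL_mul (x y : H ⊗[k] H) :
    unitL (x * y) = unitL (x * (targetMap k H).rTensor H y) := by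
  induction x with
  | zero => simp
  | tmul a b =>
    induction y with
    | zero => simp
    | tmul c d => simp [targetMap_mul_targetMap]
    | add x y hx hy => simp only [map_add, mul_add, hx, hy]
  | add x y hx hy => simp only [map_add, add_mul, hx, hy]

lemma unitL_mul_right (x : H ⊗[k] H) (h : H) : unitL (x * ((1 : H) ⊗ₜ[k] h)) = unitL x * h := by
  induction x with
  | zero => simp
  | tmul a b => simp [mul_assoc]
  | add x y hx hy => simp only [map_add, add_mul, hx, hy]

lemma unitL_comul_one : unitL (comul (R := k) (1 : H)) = 1 := by
  have h1 : ∀ x : H ⊗[k] H, unitL x = counitL k (comul (1 : H) * x) := by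
    intro x
    induction x with
    | zero => simp
    | tmul a b =>
      have : a ⊗ₜ[k] b = (a ⊗ₜ[k] (1 : H)) * ((1 : H) ⊗ₜ[k] b) := by simp
      rw [this, ← mul_assoc, counitL_mul_right, ← targetMap_apply]
      simp
    | add x y hx hy => simp only [map_add, mul_add, hx, hy]
  rw [h1, one_mul_comul, counitL_comul]

/-- `ε_t(x₁) ⊗ x₂ = 1₁ ⊗ 1₂ ε(x₁) x₂` for `x` with `Δ(1) x = x`. -/
lemma rTensor_targetMap_eq {x : H ⊗[k] H} (hx : comul (1 : H) * x = x) :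
    (targetMap k H).rTensor H x = comul (1 : H) * ((1 : H) ⊗ₜ[k] counitL k x) := by
  have hz : ∀ z : H, InBase k z → (z ⊗ₜ[k] (1 : H)) * x = ((1 : H) ⊗ₜ[k] z) * x := by
    intro z h
    rw [← hx, ← mul_assoc, ← mul_assoc, ← h.comul_left, ← h.comul_right]
  have h1 : ∀ (a b : H) (y : H ⊗[k] H),
      (counitL k ∘ₗ LinearMap.mulLeft k (a ⊗ₜ[k] b) ∘ₗ
        (TensorProduct.mk k H H).flip 1).rTensor H y =
      b ⊗ₜ[k] counitL k ((a ⊗ₜ[k] (1 : H)) * y) := by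
    intro a b y
    induction y with
    | zero => simp
    | tmul c d => simp [TensorProduct.smul_tmul]
    | add x y hx hy => simp only [map_add, mul_add, TensorProduct.tmul_add, hx, hy]
  have h2 : ∀ p : H ⊗[k] H,
      (counitL k ∘ₗ LinearMap.mulLeft k ((targetMap k H).rTensor H p) ∘ₗ
        (TensorProduct.mk k H H).flip 1).rTensor H x =
      flip k H ((targetMap k H).rTensor H p) * ((1 : H) ⊗ₜ[k] counitL k x) := by
    intro p
    induction p with
    | zero => simp [LinearMap.rTensor, show LinearMap.mulLeft k (0 : H ⊗[k] H) = 0 by ext; simp]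
    | tmul a b =>
      rw [LinearMap.rTensor_tmul, h1, hz _ (inBase_targetMap a), counitL_mul_left]
      simp
    | add p q hp hq =>
      rw [map_add, map_add, add_mul, ← hp, ← hq, ← LinearMap.add_apply, ← LinearMap.rTensor_add]
      congr 2
      ext
      simp [add_mul]
  have h3 := h2 (comul 1)
  rw [rTensor_targetMap_comul_one, flip_comul] at h3
  exact h3

lemma unitL_Finv : unitL F.Finv = 1 := by
  have h1 := unitL_mul F.Finv F.F
  rw [rTensor_targetMap_eq F.one_mul_F, F.counitL_F, ← Algebra.TensorProduct.one_def, mul_one,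
    Finv_mul_F, Finv_mul_one, unitL_comul_one] at h1
  exact h1.symm

lemma unitL_twistedComul (h : H) : unitL (F.twistedComul h) = h := by
  rw [twistedComul_apply, unitL_mul, rTensor_targetMap_eq F.one_mul_F, F.counitL_F,
    ← Algebra.TensorProduct.one_def, mul_one, mul_assoc, comul_mul_one, unitL_mul,
    rTensor_targetMap_comul, ← mul_assoc, Finv_mul_one, unitL_mul_right, unitL_Finv, one_mul]

lemma unitL_twistedComul_mul (h : H) {z : H} (hz : InBase k z) :
    unitL (F.twistedComul h * (z ⊗ₜ[k] (1 : H))) = h * z := by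
  rw [← twistedComul_mul_one, mul_assoc, ← hz.comul_left', hz.comul_right', ← mul_assoc,
    twistedComul_mul_one, unitL_mul_right, unitL_twistedComul]

lemma counitL_flip (x : H ⊗[k] H) : counitL k (flip k H x) = counitR k x := by
  induction x with
  | zero => simp
  | tmul a b => simp
  | add x y hx hy => simp only [map_add, hx, hy]

lemma rTensor_targetMap_flip_F :
    (targetMap k H).rTensor H (flip k H F.F) = comul (1 : H) := by
  have : comul (1 : H) * flip k H F.F = flip k H F.F := by
    rw [← flip_comul, ← map_mul, one_mul_F]
  rw [rTensor_targetMap_eq this, counitL_flip, F.counitR_F, ← Algebra.TensorProduct.one_def,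
    mul_one]

lemma unitR_Finv : unitR F.Finv = 1 := by
  have h1 := unitL_mul (flip k H F.Finv) (flip k H F.F)
  rw [rTensor_targetMap_flip_F, ← map_mul, Finv_mul_F, flip_comul, unitL_comul_one] at h1
  rw [← flip_comul, ← map_mul, Finv_mul_one] at h1
  exact h1.symm

lemma unitR_twistedComul (h : H) : unitR (F.twistedComul h) = h := by
  have h2 : flip k H F.Finv * comul (1 : H) = flip k H F.Finv := by
    rw [← flip_comul, ← map_mul, Finv_mul_one]
  have h1 : unitL (flip k H F.Finv) = 1 := unitR_Finv F
  change unitL (flip k H (F.twistedComul h)) = h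
  rw [twistedComul_apply, map_mul (flip k H), map_mul (flip k H), flip_comul, unitL_mul, rTensor_targetMap_flip_F,
    mul_assoc, comul_mul_one, unitL_mul,
    rTensor_targetMap_comul, ← mul_assoc, h2, unitL_mul_right, h1, one_mul]

lemma unitR_twistedComul_mul (h : H) {z : H} (hz : InBase k z) :
    unitR (F.twistedComul h * ((1 : H) ⊗ₜ[k] z)) = h * z := by
  have h1 : ∀ x : H ⊗[k] H, unitR (x * (z ⊗ₜ[k] (1 : H))) = unitR x * z := by
    intro x
    induction x with
    | zero => simp
    | tmul a b => simp [mul_assoc]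
    | add x y hx hy => simp only [map_add, add_mul, hx, hy]
  rw [← twistedComul_mul_one, mul_assoc, ← hz.comul_right', hz.comul_left', ← mul_assoc,
    twistedComul_mul_one, h1, unitR_twistedComul]

end WeakUnitCocycle
end Twist

section Category

open CategoryTheory

variable {k : Type v} {H : Type u} [Field k] [Ring H] [Algebra k H] [Coalgebra k H]
  [QuantumGroupoid k H]

/-- An object of the category `_H M_F`: a left `H`-module (with its underlying vector space). -/
structure TwMod (F : WeakUnitCocycle k H) where
  /-- The underlying type. -/
  carrier : Type u
  [addCommGroup : AddCommGroup carrier]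
  [moduleBase : Module k carrier]
  [module : Module H carrier]
  [isScalarTower : IsScalarTower k H carrier]

attribute [instance] TwMod.addCommGroup TwMod.moduleBase TwMod.module TwMod.isScalarTower

namespace TwMod

variable {F : WeakUnitCocycle k H}

/-- A morphism of `_H M_F`: an `H`-linear map. -/
@[ext]
structure Hom (M N : TwMod F) where
  /-- The underlying linear map. -/
  lin : M.carrier →ₗ[H] N.carrier

instance : Category (TwMod F) where
  Hom := Hom
  id M := ⟨LinearMap.id⟩
  comp f g := ⟨g.lin ∘ₗ f.lin⟩

/-- The `H`-linear map underlying a morphism. -/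
def lin {M N : TwMod F} (f : M ⟶ N) : M.carrier →ₗ[H] N.carrier := Hom.lin f

/-- The `k`-linear map underlying a morphism. -/
def klin {M N : TwMod F} (f : M ⟶ N) : M.carrier →ₗ[k] N.carrier :=
  (lin f).restrictScalars k

/-- The morphism given by a `k`-linear map that commutes with the action of `H`. -/
def homMk {M N : TwMod F} (f : M.carrier →ₗ[k] N.carrier) (hf : ∀ (h : H) x, f (h • x) = h • f x) :
    M ⟶ N :=
  (⟨{ toFun := f, map_add' := map_add f, map_smul' := hf }⟩ : Hom M N)

@[simp] lemma klin_homMk {M N : TwMod F} (f : M.carrier →ₗ[k] N.carrier)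
    (hf : ∀ (h : H) x, f (h • x) = h • f x) : klin (homMk f hf) = f := rfl

@[simp] lemma klin_id (M : TwMod F) : klin (𝟙 M) = LinearMap.id := rfl

@[simp] lemma klin_comp {M N L : TwMod F} (f : M ⟶ N) (g : N ⟶ L) :
    klin (f ≫ g) = klin g ∘ₗ klin f := rfl

lemma klin_smul {M N : TwMod F} (f : M ⟶ N) (h : H) (x : M.carrier) :
    klin f (h • x) = h • klin f x := (lin f).map_smul h x

lemma hom_ext {M N : TwMod F} {f g : M ⟶ N} (h : klin f = klin g) : f = g :=
  Hom.ext (LinearMap.ext fun x => congrArg (fun p : M.carrier →ₗ[k] N.carrier => p x) h)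

/-- An isomorphism given by mutually inverse `k`-linear maps, one commuting with `H`. -/
def isoMk {M N : TwMod F} (f : M.carrier →ₗ[k] N.carrier) (g : N.carrier →ₗ[k] M.carrier)
    (hf : ∀ (h : H) x, f (h • x) = h • f x) (hfg : ∀ x, f (g x) = x) (hgf : ∀ x, g (f x) = x) :
    M ≅ N where
  hom := homMk f hf
  inv := homMk g (fun h x => by rw [← hgf (h • g x), hf, hfg])
  hom_inv_id := hom_ext (LinearMap.ext hgf)
  inv_hom_id := hom_ext (LinearMap.ext hfg)

end TwMod

section Act

variable {A B C : Type u} [Ring A] [Algebra k A] [Ring B] [Algebra k B] [Ring C] [Algebra k C]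
  {M N L : Type u} [AddCommGroup M] [Module k M] [AddCommGroup N] [Module k N]
  [AddCommGroup L] [Module k L]

/-- The tensor product of representations, as a representation of the tensor product algebra. -/
def tprod (f : A →ₐ[k] Module.End k M) (g : B →ₐ[k] Module.End k N) :
    A ⊗[k] B →ₐ[k] Module.End k (M ⊗[k] N) :=
  (Module.endTensorEndAlgHom (R := k) (S := k) (A := k)).comp (Algebra.TensorProduct.map f g)

@[simp] lemma tprod_tmul (f : A →ₐ[k] Module.End k M) (g : B →ₐ[k] Module.End k N) (a : A) (b : B)
    (m : M) (n : N) : tprod f g (a ⊗ₜ b) (m ⊗ₜ n) = f a m ⊗ₜ g b n := rfl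

lemma tprod_tmul' (f : A →ₐ[k] Module.End k M) (g : B →ₐ[k] Module.End k N) (a : A) (b : B) :
    tprod f g (a ⊗ₜ b) = TensorProduct.map (f a) (g b) := rfl

lemma tprod_assoc (f : A →ₐ[k] Module.End k M) (g : B →ₐ[k] Module.End k N)
    (h : C →ₐ[k] Module.End k L) (x : (A ⊗[k] B) ⊗[k] C) (w : (M ⊗[k] N) ⊗[k] L) :
    TensorProduct.assoc k M N L (tprod (tprod f g) h x w) =
      tprod f (tprod g h) (Algebra.TensorProduct.assoc k k k A B C x)
        (TensorProduct.assoc k M N L w) := by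
  induction x with
  | zero => simp
  | add x y hx hy => simp only [map_add, LinearMap.add_apply, hx, hy]
  | tmul ab c =>
    induction ab with
    | zero => simp
    | add x y hx hy => simp only [map_add, TensorProduct.add_tmul, LinearMap.add_apply, hx, hy]
    | tmul a b =>
      induction w with
      | zero => simp
      | add x y hx hy => simp only [map_add, hx, hy]
      | tmul mn l =>
        induction mn with
        | zero => simp
        | add x y hx hy => simp only [map_add, TensorProduct.add_tmul, hx, hy]
        | tmul m n => simp

lemma tprod_comm (f : A →ₐ[k] Module.End k M) (g : B →ₐ[k] Module.End k N)
    (x : A ⊗[k] B) (w : M ⊗[k] N) :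
    TensorProduct.comm k M N (tprod f g x w) =
      tprod g f (Algebra.TensorProduct.comm k A B x) (TensorProduct.comm k M N w) := by
  induction x with
  | zero => simp
  | add x y hx hy => simp only [map_add, LinearMap.add_apply, hx, hy]
  | tmul a b =>
    induction w with
    | zero => simp
    | add x y hx hy => simp only [map_add, hx, hy]
    | tmul m n => simp

end Act

namespace TwMod

variable {F : WeakUnitCocycle k H}

/-- The representation of `H` on an object. -/
def rep (M : TwMod F) : H →ₐ[k] Module.End k M.carrier := Algebra.lsmul k k M.carrier

@[simp] lemma rep_apply (M : TwMod F) (h : H) (m : M.carrier) : M.rep h m = h • m := rfl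

/-- The componentwise action of `H ⊗ H` on the tensor product over `k` of two modules:
`(a ⊗ b)(m ⊗ n) = a m ⊗ b n`. -/
def act (M N : TwMod F) : H ⊗[k] H →ₐ[k] Module.End k (M.carrier ⊗[k] N.carrier) :=
  tprod M.rep N.rep

@[simp] lemma act_tmul (M N : TwMod F) (a b : H) (m : M.carrier) (n : N.carrier) :
    act M N (a ⊗ₜ b) (m ⊗ₜ n) = (a • m) ⊗ₜ (b • n) := rfl

lemma act_mul (M N : TwMod F) (x y : H ⊗[k] H) (w : M.carrier ⊗[k] N.carrier) :
    act M N (x * y) w = act M N x (act M N y w) := by simp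

lemma map_act {M N M' N' : TwMod F} (f : M ⟶ M') (g : N ⟶ N') (x : H ⊗[k] H)
    (w : M.carrier ⊗[k] N.carrier) :
    TensorProduct.map (klin f) (klin g) (act M N x w) =
      act M' N' x (TensorProduct.map (klin f) (klin g) w) := by
  induction x with
  | zero => simp
  | add x y hx hy => simp only [map_add, LinearMap.add_apply, hx, hy]
  | tmul a b =>
    induction w with
    | zero => simp
    | add x y hx hy => simp only [map_add, hx, hy]
    | tmul m n => simp [klin_smul]

/-- The subspace `M ⊗_t N = Δ(1)(M ⊗ N)` of `M ⊗ N`, the vectors fixed by `Δ(1)`. -/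
def tens (M N : TwMod F) : Submodule k (M.carrier ⊗[k] N.carrier) :=
  LinearMap.eqLocus (act M N (comul 1)) LinearMap.id

lemma mem_tens {M N : TwMod F} {w : M.carrier ⊗[k] N.carrier} :
    w ∈ tens M N ↔ act M N (comul 1) w = w := Iff.rfl

lemma act_mem {M N : TwMod F} {x : H ⊗[k] H} (hx : comul (1 : H) * x = x)
    (w : M.carrier ⊗[k] N.carrier) : act M N x w ∈ tens M N := by
  rw [mem_tens, ← act_mul, hx]

variable [IsCocomm k H]

/-- The action of `H` on `M ⊗_t N`, by `h · (m ⊗ n) = F⁻⁽¹⁾ h₁ F⁽¹⁾ m ⊗ F⁻⁽²⁾ h₂ F⁽²⁾ n`. -/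
abbrev tensModule (M N : TwMod F) : Module H (tens M N) where
  smul h x := ⟨act M N (F.twistedComul h) x, act_mem (F.one_mul_twistedComul h) _⟩
  one_smul x := Subtype.ext (by
    change act M N (F.twistedComul 1) x = x
    rw [F.twistedComul_one]; exact x.2)
  mul_smul h l x := Subtype.ext (by
    change act M N (F.twistedComul (h * l)) x =
      act M N (F.twistedComul h) (act M N (F.twistedComul l) x)
    rw [F.twistedComul_mul, act_mul])
  smul_zero h := Subtype.ext (map_zero (act M N (F.twistedComul h)))
  smul_add h x y := Subtype.ext (map_add (act M N (F.twistedComul h)) _ _)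
  add_smul h l x := Subtype.ext (by
    change act M N (F.twistedComul (h + l)) x =
      act M N (F.twistedComul h) x + act M N (F.twistedComul l) x
    simp)
  zero_smul x := Subtype.ext (by
    change act M N (F.twistedComul 0) x = 0
    simp)

/-- The tensor product `M ⊗_t N` as an object of `_H M_F`. -/
def tensObj (M N : TwMod F) : TwMod F :=
  letI := tensModule M N
  { carrier := tens M N
    isScalarTower := ⟨fun c h x => Subtype.ext (by
      change act M N (F.twistedComul (c • h)) x = c • act M N (F.twistedComul h) x
      simp)⟩ }

/-- The inclusion of `M ⊗_t N` in `M ⊗ N`. -/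
def val (M N : TwMod F) : (tensObj M N).carrier →ₗ[k] M.carrier ⊗[k] N.carrier :=
  (tens M N).subtype

/-- The projection of `M ⊗ N` to `M ⊗_t N`, given by the action of `Δ(1)`. -/
def proj (M N : TwMod F) : M.carrier ⊗[k] N.carrier →ₗ[k] (tensObj M N).carrier :=
  (act M N (comul 1)).codRestrict (tens M N) (act_mem (one_mul_comul 1))

lemma val_injective (M N : TwMod F) : Function.Injective (val M N) := Subtype.val_injective

@[simp] lemma val_proj (M N : TwMod F) (w : M.carrier ⊗[k] N.carrier) :
    val M N (proj M N w) = act M N (comul 1) w := rfl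

@[simp] lemma act_one_val (M N : TwMod F) (x : (tensObj M N).carrier) :
    act M N (comul 1) (val M N x) = val M N x := x.2

@[simp] lemma val_smul (M N : TwMod F) (h : H) (x : (tensObj M N).carrier) :
    val M N (h • x) = act M N (F.twistedComul h) (val M N x) := rfl

@[simp] lemma proj_val (M N : TwMod F) (x : (tensObj M N).carrier) : proj M N (val M N x) = x :=
  val_injective M N (by simp)

/-- The tensor product of two morphisms. -/
def tensHom {M M' N N' : TwMod F} (f : M ⟶ M') (g : N ⟶ N') : tensObj M N ⟶ tensObj M' N' :=
  homMk (proj M' N' ∘ₗ TensorProduct.map (klin f) (klin g) ∘ₗ val M N) (by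
    intro h x
    apply val_injective
    simp only [LinearMap.comp_apply, val_proj, val_smul, ← map_act, act_one_val]
    rw [← act_mul, F.one_mul_twistedComul])

@[simp] lemma val_tensHom {M M' N N' : TwMod F} (f : M ⟶ M') (g : N ⟶ N')
    (x : (tensObj M N).carrier) :
    val M' N' (klin (tensHom f g) x) = TensorProduct.map (klin f) (klin g) (val M N x) := by
  simp [tensHom, ← map_act]

/-- The inclusion of `(M ⊗_t N) ⊗_t L` in `(M ⊗ N) ⊗ L`. -/
def valL (M N L : TwMod F) : (tensObj (tensObj M N) L).carrier →ₗ[k]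
    (M.carrier ⊗[k] N.carrier) ⊗[k] L.carrier :=
  (val M N).rTensor L.carrier ∘ₗ val (tensObj M N) L

/-- The inclusion of `M ⊗_t (N ⊗_t L)` in `M ⊗ (N ⊗ L)`. -/
def valR (M N L : TwMod F) : (tensObj M (tensObj N L)).carrier →ₗ[k]
    M.carrier ⊗[k] (N.carrier ⊗[k] L.carrier) :=
  (val N L).lTensor M.carrier ∘ₗ val M (tensObj N L)

lemma valL_injective (M N L : TwMod F) : Function.Injective (valL M N L) :=
  (Module.Flat.rTensor_preserves_injective_linearMap _ (val_injective M N)).comp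
    (val_injective _ _)

lemma valR_injective (M N L : TwMod F) : Function.Injective (valR M N L) :=
  (Module.Flat.lTensor_preserves_injective_linearMap _ (val_injective N L)).comp
    (val_injective _ _)

/-- The action of `(H ⊗ H) ⊗ H` on `(M ⊗ N) ⊗ L`. -/
def actL (M N L : TwMod F) : (H ⊗[k] H) ⊗[k] H →ₐ[k]
    Module.End k ((M.carrier ⊗[k] N.carrier) ⊗[k] L.carrier) := tprod (act M N) L.rep

/-- The action of `H ⊗ (H ⊗ H)` on `M ⊗ (N ⊗ L)`. -/
def actR (M N L : TwMod F) : H ⊗[k] (H ⊗[k] H) →ₐ[k]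
    Module.End k (M.carrier ⊗[k] (N.carrier ⊗[k] L.carrier)) := tprod M.rep (act N L)

lemma actL_mul (M N L : TwMod F) (x y : (H ⊗[k] H) ⊗[k] H) (w) :
    actL M N L (x * y) w = actL M N L x (actL M N L y w) := by simp

lemma actR_mul (M N L : TwMod F) (x y : H ⊗[k] (H ⊗[k] H)) (w) :
    actR M N L (x * y) w = actR M N L x (actR M N L y w) := by simp

lemma assoc_actL (M N L : TwMod F) (x : (H ⊗[k] H) ⊗[k] H) (w) :
    TensorProduct.assoc k _ _ _ (actL M N L x w) =
      actR M N L (asc k H x) (TensorProduct.assoc k _ _ _ w) := tprod_assoc _ _ _ _ _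

lemma rTensor_val_act (M N L : TwMod F) (x : H ⊗[k] H)
    (w : (tensObj M N).carrier ⊗[k] L.carrier) :
    (val M N).rTensor L.carrier (act (tensObj M N) L x w) =
      actL M N L (F.twistedComul.rTensor H x) ((val M N).rTensor L.carrier w) := by
  induction x with
  | zero => simp
  | add x y hx hy => simp only [map_add, LinearMap.add_apply, hx, hy]
  | tmul a b =>
    induction w with
    | zero => simp
    | add x y hx hy => simp only [map_add, hx, hy]
    | tmul m n => simp [actL]

lemma lTensor_val_act (M N L : TwMod F) (x : H ⊗[k] H)
    (w : M.carrier ⊗[k] (tensObj N L).carrier) :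
    (val N L).lTensor M.carrier (act M (tensObj N L) x w) =
      actR M N L (F.twistedComul.lTensor H x) ((val N L).lTensor M.carrier w) := by
  induction x with
  | zero => simp
  | add x y hx hy => simp only [map_add, LinearMap.add_apply, hx, hy]
  | tmul a b =>
    induction w with
    | zero => simp
    | add x y hx hy => simp only [map_add, hx, hy]
    | tmul m n => simp [actR]

lemma valL_smul (M N L : TwMod F) (h : H) (x : (tensObj (tensObj M N) L).carrier) :
    valL M N L (h • x) =
      actL M N L (F.twistedComul.rTensor H (F.twistedComul h)) (valL M N L x) := by
  simp only [valL, LinearMap.comp_apply, val_smul, rTensor_val_act]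

lemma valR_smul (M N L : TwMod F) (h : H) (x : (tensObj M (tensObj N L)).carrier) :
    valR M N L (h • x) =
      actR M N L (F.twistedComul.lTensor H (F.twistedComul h)) (valR M N L x) := by
  simp only [valR, LinearMap.comp_apply, val_smul, lTensor_val_act]

lemma valR_proj (M N L : TwMod F) (w : M.carrier ⊗[k] (N.carrier ⊗[k] L.carrier)) :
    valR M N L (proj M (tensObj N L) ((proj N L).lTensor M.carrier w)) =
      actR M N L (WeakUnitCocycle.P3 k H) w := by
  have h1 : ∀ w : M.carrier ⊗[k] (N.carrier ⊗[k] L.carrier),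
      (val N L).lTensor M.carrier ((proj N L).lTensor M.carrier w) =
      actR M N L ((1 : H) ⊗ₜ comul 1) w := by
    intro w
    induction w with
    | zero => simp
    | add x y hx hy => simp only [map_add, hx, hy]
    | tmul m n => simp [actR]
  have h2 : WeakUnitCocycle.P3 k H * ((1 : H) ⊗ₜ comul (1 : H)) = WeakUnitCocycle.P3 k H :=
    WeakUnitCocycle.lTensor_comul_mul_one _
  simp only [valR, LinearMap.comp_apply, val_proj, lTensor_val_act, F.lTensor_twistedComul_one, h1]
  rw [← actR_mul, h2]

lemma valL_proj (M N L : TwMod F) (w : (M.carrier ⊗[k] N.carrier) ⊗[k] L.carrier) :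
    valL M N L (proj (tensObj M N) L ((proj M N).rTensor L.carrier w)) =
      actL M N L ((asc k H).symm (WeakUnitCocycle.P3 k H)) w := by
  have h1 : ∀ w : (M.carrier ⊗[k] N.carrier) ⊗[k] L.carrier,
      (val M N).rTensor L.carrier ((proj M N).rTensor L.carrier w) =
      actL M N L (comul 1 ⊗ₜ (1 : H)) w := by
    intro w
    induction w with
    | zero => simp
    | add x y hx hy => simp only [map_add, hx, hy]
    | tmul m n => simp [actL]
  have h3 : (asc k H).symm (WeakUnitCocycle.P3 k H) =
      (comul (R := k) (A := H)).rTensor H (comul 1) := by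
    rw [AlgEquiv.symm_apply_eq, WeakUnitCocycle.coassoc', WeakUnitCocycle.P3]
  have h4 : F.twistedComul.rTensor H (comul 1) = (asc k H).symm (WeakUnitCocycle.P3 k H) := by
    rw [AlgEquiv.eq_symm_apply, F.rTensor_twistedComul_one]
  have h2 : (asc k H).symm (WeakUnitCocycle.P3 k H) * (comul (1 : H) ⊗ₜ (1 : H)) =
      (asc k H).symm (WeakUnitCocycle.P3 k H) := by
    rw [h3, WeakUnitCocycle.rTensor_comul_mul_one]
  simp only [valL, LinearMap.comp_apply, val_proj, rTensor_val_act, h4, h1]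
  rw [← actL_mul, h2]

lemma actL_valL (M N L : TwMod F) (x : (tensObj (tensObj M N) L).carrier) :
    actL M N L ((asc k H).symm (WeakUnitCocycle.P3 k H)) (valL M N L x) = valL M N L x := by
  have h4 : F.twistedComul.rTensor H (comul 1) = (asc k H).symm (WeakUnitCocycle.P3 k H) := by
    rw [AlgEquiv.eq_symm_apply, F.rTensor_twistedComul_one]
  have := valL_smul M N L 1 x
  rw [one_smul, F.twistedComul_one, h4] at this
  exact this.symm

lemma actR_valR (M N L : TwMod F) (x : (tensObj M (tensObj N L)).carrier) :
    actR M N L (WeakUnitCocycle.P3 k H) (valR M N L x) = valR M N L x := by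
  have := valR_smul M N L 1 x
  rw [one_smul, F.twistedComul_one, F.lTensor_twistedComul_one] at this
  exact this.symm

/-- The associator, as a linear map: the restriction of `(m ⊗ n) ⊗ l ↦ m ⊗ (n ⊗ l)`. -/
def assocHom (M N L : TwMod F) :
    (tensObj (tensObj M N) L).carrier →ₗ[k] (tensObj M (tensObj N L)).carrier :=
  proj M (tensObj N L) ∘ₗ (proj N L).lTensor M.carrier ∘ₗ
    (TensorProduct.assoc k M.carrier N.carrier L.carrier).toLinearMap ∘ₗ valL M N L

/-- The inverse of the associator, as a linear map. -/
def assocInv (M N L : TwMod F) :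
    (tensObj M (tensObj N L)).carrier →ₗ[k] (tensObj (tensObj M N) L).carrier :=
  proj (tensObj M N) L ∘ₗ (proj M N).rTensor L.carrier ∘ₗ
    (TensorProduct.assoc k M.carrier N.carrier L.carrier).symm.toLinearMap ∘ₗ valR M N L

lemma valR_assocHom (M N L : TwMod F) (x : (tensObj (tensObj M N) L).carrier) :
    valR M N L (assocHom M N L x) = TensorProduct.assoc k _ _ _ (valL M N L x) := by
  simp only [assocHom, LinearMap.comp_apply, LinearEquiv.coe_coe, valR_proj]
  have := assoc_actL M N L ((asc k H).symm (WeakUnitCocycle.P3 k H)) (valL M N L x)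
  rw [actL_valL, AlgEquiv.apply_symm_apply] at this
  exact this.symm

lemma valL_assocInv (M N L : TwMod F) (x : (tensObj M (tensObj N L)).carrier) :
    valL M N L (assocInv M N L x) = (TensorProduct.assoc k _ _ _).symm (valR M N L x) := by
  simp only [assocInv, LinearMap.comp_apply, LinearEquiv.coe_coe, valL_proj]
  rw [LinearEquiv.eq_symm_apply, assoc_actL, AlgEquiv.apply_symm_apply,
    LinearEquiv.apply_symm_apply, actR_valR]

/-- The associator of `_H M_F`. -/
def assocIso (M N L : TwMod F) : tensObj (tensObj M N) L ≅ tensObj M (tensObj N L) :=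
  isoMk (assocHom M N L) (assocInv M N L)
    (fun h x => valR_injective _ _ _ (by
      rw [valR_assocHom, valR_smul, valL_smul, assoc_actL, F.twisted_coassoc, valR_assocHom]))
    (fun x => valR_injective _ _ _ (by
      rw [valR_assocHom, valL_assocInv, LinearEquiv.apply_symm_apply]))
    (fun x => valL_injective _ _ _ (by
      rw [valL_assocInv, valR_assocHom, LinearEquiv.symm_apply_apply]))

end TwMod
end Category

section Monoidal

open CategoryTheory

variable {k : Type v} {H : Type u} [Field k] [Ring H] [Algebra k H] [Coalgebra k H]
  [QuantumGroupoid k H] [IsCocomm k H]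

namespace TwMod

variable {F : WeakUnitCocycle k H}

/-- The action `h · z = ε_t(h z)` of `H` on the target space `H_t`. -/
abbrev targetModule (k : Type v) (H : Type u) [Field k] [Ring H] [Algebra k H] [Coalgebra k H]
    [QuantumGroupoid k H] [IsCocomm k H] : Module H (targetSpace k H) where
  smul h z := ⟨targetMap k H (h * z), _, rfl⟩
  one_smul z := Subtype.ext (by
    change targetMap k H (1 * z) = z
    rw [one_mul]; exact mem_targetSpace.1 z.2)
  mul_smul h l z := Subtype.ext (by
    change targetMap k H (h * l * z) = targetMap k H (h * targetMap k H (l * z))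
    rw [targetMap_mul_targetMap, mul_assoc])
  smul_zero h := Subtype.ext (by
    change targetMap k H (h * 0) = 0
    simp)
  smul_add h x y := Subtype.ext (by
    change targetMap k H (h * (x + y)) = targetMap k H (h * x) + targetMap k H (h * y)
    simp [mul_add])
  add_smul h l x := Subtype.ext (by
    change targetMap k H ((h + l) * x) = targetMap k H (h * x) + targetMap k H (l * x)
    simp [add_mul])
  zero_smul x := Subtype.ext (by
    change targetMap k H (0 * x) = 0
    simp)

variable (F) in
/-- The unit object `H_t`. -/
def unitObj : TwMod F :=
  letI := targetModule k H
  { carrier := targetSpace k H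
    isScalarTower := ⟨fun c h x => Subtype.ext (by
      change targetMap k H ((c • h) * x) = c • targetMap k H (h * x)
      simp)⟩ }

variable (F) in
/-- The inclusion of the unit object in `H`. -/
def unitVal : (unitObj F).carrier →ₗ[k] H := (targetSpace k H).subtype

variable (F) in
/-- The target map, with values in the unit object. -/
def unitProj : H →ₗ[k] (unitObj F).carrier := (targetMap k H).rangeRestrict

lemma unitVal_injective : Function.Injective (unitVal F) := Subtype.val_injective

lemma inBase_unitVal (z : (unitObj F).carrier) : InBase k (unitVal F z) := mem_targetSpace.1 z.2

@[simp] lemma unitVal_proj (h : H) : unitVal F (unitProj F h) = targetMap k H h := rfl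

@[simp] lemma unitVal_smul (h : H) (z : (unitObj F).carrier) :
    unitVal F (h • z) = targetMap k H (h * unitVal F z) := rfl

/-- The map `m ⊗ z ↦ S⁻¹(z) m`. -/
def mulR (M : TwMod F) : M.carrier ⊗[k] (unitObj F).carrier →ₗ[k] M.carrier :=
  TensorProduct.lift (M.rep.toLinearMap ∘ₗ
    (QuantumGroupoid.antipode (k := k) (H := H)).symm.toLinearMap ∘ₗ unitVal F).flip

/-- The map `z ⊗ m ↦ z m`. -/
def mulL (M : TwMod F) : (unitObj F).carrier ⊗[k] M.carrier →ₗ[k] M.carrier :=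
  TensorProduct.lift (M.rep.toLinearMap ∘ₗ unitVal F)

@[simp] lemma mulR_tmul (M : TwMod F) (m : M.carrier) (z : (unitObj F).carrier) :
    mulR M (m ⊗ₜ z) = unitVal F z • m := by
  simp [mulR, (inBase_unitVal z).antipode_symm]

@[simp] lemma mulL_tmul (M : TwMod F) (m : M.carrier) (z : (unitObj F).carrier) :
    mulL M (z ⊗ₜ m) = unitVal F z • m := by
  simp [mulL]

lemma mulL_act (M : TwMod F) (h : H) (w : (unitObj F).carrier ⊗[k] M.carrier) :
    mulL M (act (unitObj F) M (F.twistedComul h) w) = h • mulL M w := by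
  have h1 : ∀ (x : H ⊗[k] H) (z : (unitObj F).carrier) (m : M.carrier),
      mulL M (act (unitObj F) M x (z ⊗ₜ m)) =
        WeakUnitCocycle.unitL (x * (unitVal F z ⊗ₜ (1 : H))) • m := by
    intro x z m
    induction x with
    | zero => simp
    | add x y hx hy => simp only [map_add, add_mul, add_smul, LinearMap.add_apply, hx, hy]
    | tmul a b => simp [mul_smul]
  induction w with
  | zero => simp
  | add x y hx hy => simp only [map_add, smul_add, hx, hy]
  | tmul z m => simp [h1, F.unitL_twistedComul_mul h (inBase_unitVal z), mul_smul]

lemma mulR_act (M : TwMod F) (h : H) (w : M.carrier ⊗[k] (unitObj F).carrier) :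
    mulR M (act M (unitObj F) (F.twistedComul h) w) = h • mulR M w := by
  have h1 : ∀ (x : H ⊗[k] H) (z : (unitObj F).carrier) (m : M.carrier),
      mulR M (act M (unitObj F) x (m ⊗ₜ z)) =
        WeakUnitCocycle.unitR (x * ((1 : H) ⊗ₜ unitVal F z)) • m := by
    intro x z m
    induction x with
    | zero => simp
    | add x y hx hy => simp only [map_add, add_mul, add_smul, LinearMap.add_apply, hx, hy]
    | tmul a b => simp [mul_smul]
  induction w with
  | zero => simp
  | add x y hx hy => simp only [map_add, smul_add, hx, hy]
  | tmul m z => simp [h1, F.unitR_twistedComul_mul h (inBase_unitVal z), mul_smul]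

/-- The unit of the unit object. -/
def unitOne : (unitObj F).carrier := unitProj F 1

@[simp] lemma unitVal_unitOne : unitVal F unitOne = 1 := targetMap_one

lemma comul_one_act_left (M : TwMod F) (w : (unitObj F).carrier ⊗[k] M.carrier) :
    act (unitObj F) M (comul 1) (unitOne ⊗ₜ mulL M w) = act (unitObj F) M (comul 1) w := by
  have h1 : ∀ (x : H ⊗[k] H) (z : (unitObj F).carrier) (m : M.carrier),
      act (unitObj F) M x (z ⊗ₜ m) = act (unitObj F) M (x * (unitVal F z ⊗ₜ (1 : H)))
        (unitOne ⊗ₜ m) := by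
    intro x z m
    rw [act_mul]
    congr 1
    rw [act_tmul, one_smul]
    congr 1
    apply unitVal_injective
    simpa using (inBase_unitVal z).symm
  induction w with
  | zero => simp
  | add x y hx hy => simp only [map_add, TensorProduct.tmul_add, hx, hy]
  | tmul z m =>
    rw [h1 _ z, ← (inBase_unitVal z).comul_left', (inBase_unitVal z).comul_right', act_mul]
    simp

lemma comul_one_act_right (M : TwMod F) (w : M.carrier ⊗[k] (unitObj F).carrier) :
    act M (unitObj F) (comul 1) (mulR M w ⊗ₜ unitOne) = act M (unitObj F) (comul 1) w := by
  have h1 : ∀ (x : H ⊗[k] H) (z : (unitObj F).carrier) (m : M.carrier),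
      act M (unitObj F) x (m ⊗ₜ z) = act M (unitObj F) (x * ((1 : H) ⊗ₜ unitVal F z))
        (m ⊗ₜ unitOne) := by
    intro x z m
    rw [act_mul]
    congr 1
    rw [act_tmul, one_smul]
    congr 1
    apply unitVal_injective
    simpa using (inBase_unitVal z).symm
  induction w with
  | zero => simp
  | add x y hx hy => simp only [map_add, TensorProduct.add_tmul, hx, hy]
  | tmul m z =>
    rw [h1 _ z, ← (inBase_unitVal z).comul_right', (inBase_unitVal z).comul_left', act_mul]
    simp

lemma mulL_comul_one_act (M : TwMod F) (w : (unitObj F).carrier ⊗[k] M.carrier) :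
    mulL M (act (unitObj F) M (comul 1) w) = mulL M w := by
  rw [← F.twistedComul_one, mulL_act, one_smul]

lemma mulR_comul_one_act (M : TwMod F) (w : M.carrier ⊗[k] (unitObj F).carrier) :
    mulR M (act M (unitObj F) (comul 1) w) = mulR M w := by
  rw [← F.twistedComul_one, mulR_act, one_smul]

/-- The left unit constraint `z ⊗ m ↦ z m`. -/
def leftIso (M : TwMod F) : tensObj (unitObj F) M ≅ M :=
  isoMk (mulL M ∘ₗ val _ _) (proj _ _ ∘ₗ TensorProduct.mk k _ _ unitOne)
    (fun h x => by simp [mulL_act])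
    (fun x => by simp [mulL_comul_one_act])
    (fun x => val_injective _ _ (by simp [comul_one_act_left]))

/-- The right unit constraint `m ⊗ z ↦ S⁻¹(z) m`. -/
def rightIso (M : TwMod F) : tensObj M (unitObj F) ≅ M :=
  isoMk (mulR M ∘ₗ val _ _) (proj _ _ ∘ₗ (TensorProduct.mk k _ _).flip unitOne)
    (fun h x => by simp [mulR_act])
    (fun x => by simp [mulR_comul_one_act])
    (fun x => val_injective _ _ (by simp [comul_one_act_right]))

instance : MonoidalCategoryStruct (TwMod F) where
  tensorObj := tensObj
  whiskerLeft M _ _ g := tensHom (𝟙 M) g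
  whiskerRight f N := tensHom f (𝟙 N)
  tensorHom := tensHom
  tensorUnit := unitObj F
  associator := assocIso
  leftUnitor := leftIso
  rightUnitor := rightIso

lemma valL_tensHom {M M' N N' L L' : TwMod F} (f : M ⟶ M') (g : N ⟶ N') (h : L ⟶ L')
    (x : (tensObj (tensObj M N) L).carrier) :
    valL M' N' L' (klin (tensHom (tensHom f g) h) x) =
      TensorProduct.map (TensorProduct.map (klin f) (klin g)) (klin h) (valL M N L x) := by
  simp only [valL, LinearMap.comp_apply, val_tensHom]
  generalize val (tensObj M N) L x = w
  induction w with
  | zero => simp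
  | add x y hx hy => simp only [map_add, hx, hy]
  | tmul a b => simp

lemma valR_tensHom {M M' N N' L L' : TwMod F} (f : M ⟶ M') (g : N ⟶ N') (h : L ⟶ L')
    (x : (tensObj M (tensObj N L)).carrier) :
    valR M' N' L' (klin (tensHom f (tensHom g h)) x) =
      TensorProduct.map (klin f) (TensorProduct.map (klin g) (klin h)) (valR M N L x) := by
  simp only [valR, LinearMap.comp_apply, val_tensHom]
  generalize val M (tensObj N L) x = w
  induction w with
  | zero => simp
  | add x y hx hy => simp only [map_add, hx, hy]
  | tmul a b => simp

lemma klin_assocIso (M N L : TwMod F) : klin (assocIso M N L).hom = assocHom M N L := rfl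

lemma klin_assocIso_inv (M N L : TwMod F) : klin (assocIso M N L).inv = assocInv M N L := rfl

lemma klin_leftIso (M : TwMod F) : klin (leftIso M).hom = mulL M ∘ₗ val _ _ := rfl

lemma klin_rightIso (M : TwMod F) : klin (rightIso M).hom = mulR M ∘ₗ val _ _ := rfl

lemma tensHom_id (M N : TwMod F) : tensHom (𝟙 M) (𝟙 N) = 𝟙 (tensObj M N) :=
  hom_ext (LinearMap.ext fun x => val_injective _ _ (by simp))

lemma tensHom_comp {M₁ N₁ L₁ M₂ N₂ L₂ : TwMod F} (f₁ : M₁ ⟶ N₁) (f₂ : M₂ ⟶ N₂) (g₁ : N₁ ⟶ L₁)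
    (g₂ : N₂ ⟶ L₂) : tensHom f₁ f₂ ≫ tensHom g₁ g₂ = tensHom (f₁ ≫ g₁) (f₂ ≫ g₂) :=
  hom_ext (LinearMap.ext fun x => val_injective _ _ (by
    simp only [klin_comp, LinearMap.comp_apply, val_tensHom, TensorProduct.map_comp]))

lemma assocIso_naturality {M₁ M₂ M₃ N₁ N₂ N₃ : TwMod F} (f₁ : M₁ ⟶ N₁) (f₂ : M₂ ⟶ N₂)
    (f₃ : M₃ ⟶ N₃) : tensHom (tensHom f₁ f₂) f₃ ≫ (assocIso N₁ N₂ N₃).hom =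
      (assocIso M₁ M₂ M₃).hom ≫ tensHom f₁ (tensHom f₂ f₃) :=
  hom_ext (LinearMap.ext fun x => valR_injective _ _ _ (by
    simp only [klin_comp, LinearMap.comp_apply, klin_assocIso, valR_assocHom, valL_tensHom,
      valR_tensHom]
    generalize valL _ _ _ x = w
    induction w with
    | zero => simp
    | add x y hx hy => simp only [map_add, hx, hy]
    | tmul a b =>
      induction a with
      | zero => simp
      | add x y hx hy => simp only [map_add, TensorProduct.add_tmul, hx, hy]
      | tmul a c => simp))

lemma leftIso_naturality {M N : TwMod F} (f : M ⟶ N) :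
    tensHom (𝟙 (unitObj F)) f ≫ (leftIso N).hom = (leftIso M).hom ≫ f :=
  hom_ext (LinearMap.ext fun x => by
    simp only [klin_comp, LinearMap.comp_apply, klin_leftIso, val_tensHom]
    generalize val _ _ x = w
    induction w with
    | zero => simp
    | add x y hx hy => simp only [map_add, hx, hy]
    | tmul a b => simp [klin_smul])

lemma rightIso_naturality {M N : TwMod F} (f : M ⟶ N) :
    tensHom f (𝟙 (unitObj F)) ≫ (rightIso N).hom = (rightIso M).hom ≫ f :=
  hom_ext (LinearMap.ext fun x => by
    simp only [klin_comp, LinearMap.comp_apply, klin_rightIso, val_tensHom]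
    generalize val _ _ x = w
    induction w with
    | zero => simp
    | add x y hx hy => simp only [map_add, hx, hy]
    | tmul a b => simp [klin_smul])

lemma triangle' (M N : TwMod F) : (assocIso M (unitObj F) N).hom ≫ tensHom (𝟙 M) (leftIso N).hom =
    tensHom (rightIso M).hom (𝟙 N) :=
  hom_ext (LinearMap.ext fun x => val_injective _ _ (by
    have h1 : ∀ w : (M.carrier ⊗[k] (unitObj F).carrier) ⊗[k] N.carrier,
        act M N (comul 1) ((mulL N).lTensor M.carrier (TensorProduct.assoc k _ _ _ w)) =
        act M N (comul 1) ((mulR M).rTensor N.carrier w) := by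
      intro w
      induction w with
      | zero => simp
      | add x y hx hy => simp only [map_add, hx, hy]
      | tmul a n =>
        induction a with
        | zero => simp
        | add x y hx hy => simp only [map_add, TensorProduct.add_tmul, hx, hy]
        | tmul m z =>
          have h2 : comul (1 : H) * ((1 : H) ⊗ₜ[k] unitVal F z) =
              comul (1 : H) * (unitVal F z ⊗ₜ[k] (1 : H)) := by
            rw [← (inBase_unitVal z).comul_left', ← (inBase_unitVal z).comul_right']
          have h3 := congrArg (fun u => act M N u (m ⊗ₜ n)) h2
          simpa [act_mul] using h3
    have h4 : val M N (klin ((assocIso M (unitObj F) N).hom ≫ tensHom (𝟙 M) (leftIso N).hom) x) =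
        (mulL N).lTensor M.carrier (TensorProduct.assoc k _ _ _ (valL M (unitObj F) N x)) := by
      rw [← valR_assocHom, klin_comp, LinearMap.comp_apply, klin_assocIso, val_tensHom,
        klin_leftIso, valR, LinearMap.comp_apply, ← LinearMap.lTensor_comp_apply]
      rfl
    have h5 : val M N (klin (tensHom (rightIso M).hom (𝟙 N)) x) =
        (mulR M).rTensor N.carrier (valL M (unitObj F) N x) := by
      rw [val_tensHom, klin_rightIso, valL, LinearMap.comp_apply, ← LinearMap.rTensor_comp_apply]
      rfl
    rw [← act_one_val, h4, h1, ← h5, act_one_val]))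

lemma pentagon' (W X Y Z : TwMod F) :
    tensHom (assocIso W X Y).hom (𝟙 Z) ≫ (assocIso W (tensObj X Y) Z).hom ≫
      tensHom (𝟙 W) (assocIso X Y Z).hom =
    (assocIso (tensObj W X) Y Z).hom ≫ (assocIso W X (tensObj Y Z)).hom :=
  hom_ext (LinearMap.ext fun x => by
    apply (Module.Flat.lTensor_preserves_injective_linearMap (M := W.carrier) _
      (valR_injective X Y Z)).comp (val_injective W _)
    simp only [klin_comp, LinearMap.comp_apply, klin_assocIso, Function.comp_apply]
    -- left-hand side
    have a1 : ∀ w, (valR X Y Z).lTensor W.carrier (TensorProduct.map (klin (𝟙 W))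
        (klin (assocIso X Y Z).hom) w) =
        ((TensorProduct.assoc k X.carrier Y.carrier Z.carrier).toLinearMap ∘ₗ
          valL X Y Z).lTensor W.carrier w := by
      intro w
      induction w with
      | zero => simp
      | add x y hx hy => simp only [map_add, hx, hy]
      | tmul a b => simp [klin_assocIso, valR_assocHom]
    have a2 : ∀ w : (W.carrier ⊗[k] (tensObj X Y).carrier) ⊗[k] Z.carrier,
        ((val X Y).rTensor Z.carrier).lTensor W.carrier (TensorProduct.assoc k _ _ _ w) =
          TensorProduct.assoc k _ _ _
            (((val X Y).lTensor W.carrier).rTensor Z.carrier w) := by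
      intro w
      induction w with
      | zero => simp
      | add x y hx hy => simp only [map_add, hx, hy]
      | tmul a b =>
        induction a with
        | zero => simp
        | add x y hx hy => simp only [map_add, TensorProduct.add_tmul, hx, hy]
        | tmul c d => simp
    have a3 : ∀ w, ((val X Y).lTensor W.carrier).rTensor Z.carrier
        ((val W (tensObj X Y)).rTensor Z.carrier (TensorProduct.map
          (klin (assocIso W X Y).hom) (klin (𝟙 Z)) w)) =
        ((TensorProduct.assoc k W.carrier X.carrier Y.carrier).toLinearMap).rTensor Z.carrier
          ((valL W X Y).rTensor Z.carrier w) := by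
      intro w
      induction w with
      | zero => simp
      | add x y hx hy => simp only [map_add, hx, hy]
      | tmul a b =>
        have := valR_assocHom W X Y a
        simp only [valR, LinearMap.comp_apply] at this
        simp [klin_assocIso, this]
    have b1 : ∀ w : (W.carrier ⊗[k] X.carrier) ⊗[k] (tensObj Y Z).carrier,
        ((val Y Z).lTensor X.carrier).lTensor W.carrier (TensorProduct.assoc k _ _ _ w) =
        TensorProduct.assoc k _ _ _ ((val Y Z).lTensor (W.carrier ⊗[k] X.carrier) w) := by
      intro w
      induction w with
      | zero => simp
      | add x y hx hy => simp only [map_add, hx, hy]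
      | tmul a b =>
        induction a with
        | zero => simp
        | add x y hx hy => simp only [map_add, TensorProduct.add_tmul, hx, hy]
        | tmul c d => simp
    have b2 : ∀ w : (tensObj W X).carrier ⊗[k] (tensObj Y Z).carrier,
        (val Y Z).lTensor (W.carrier ⊗[k] X.carrier) ((val W X).rTensor _ w) =
        (val W X).rTensor _ ((val Y Z).lTensor _ w) := by
      intro w
      induction w with
      | zero => simp
      | add x y hx hy => simp only [map_add, hx, hy]
      | tmul a b => simp
    have b3 : ∀ w : ((tensObj W X).carrier ⊗[k] Y.carrier) ⊗[k] Z.carrier,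
        (val W X).rTensor _ (TensorProduct.assoc k _ _ _ w) =
        TensorProduct.assoc k _ _ _ (((val W X).rTensor Y.carrier).rTensor Z.carrier w) := by
      intro w
      induction w with
      | zero => simp
      | add x y hx hy => simp only [map_add, hx, hy]
      | tmul a b =>
        induction a with
        | zero => simp
        | add x y hx hy => simp only [map_add, TensorProduct.add_tmul, hx, hy]
        | tmul c d => simp
    have pent : ∀ w : ((W.carrier ⊗[k] X.carrier) ⊗[k] Y.carrier) ⊗[k] Z.carrier,
        ((TensorProduct.assoc k X.carrier Y.carrier Z.carrier).toLinearMap).lTensor W.carrier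
          (TensorProduct.assoc k _ _ _
            (((TensorProduct.assoc k W.carrier X.carrier Y.carrier).toLinearMap).rTensor
              Z.carrier w)) =
        TensorProduct.assoc k _ _ _ (TensorProduct.assoc k _ _ _ w) := by
      intro w
      induction w with
      | zero => simp
      | add x y hx hy => simp only [map_add, hx, hy]
      | tmul a z =>
        induction a with
        | zero => simp
        | add x y hx hy => simp only [map_add, TensorProduct.add_tmul, hx, hy]
        | tmul b y =>
          induction b with
          | zero => simp
          | add x y hx hy => simp only [map_add, TensorProduct.add_tmul, hx, hy]
          | tmul c d => simp
    have c1 := valR_assocHom W (tensObj X Y) Z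
      (klin (tensHom (assocIso W X Y).hom (𝟙 Z)) x)
    simp only [valR, valL, LinearMap.comp_apply, val_tensHom] at c1
    have c2 := valR_assocHom (tensObj W X) Y Z x
    simp only [valR, valL, LinearMap.comp_apply] at c2
    have c3 := valR_assocHom W X (tensObj Y Z) (assocHom (tensObj W X) Y Z x)
    simp only [valR, valL, LinearMap.comp_apply] at c3
    have L : (valR X Y Z).lTensor W.carrier (val W (tensObj X (tensObj Y Z))
        (klin (tensHom (𝟙 W) (assocIso X Y Z).hom) (assocHom W (tensObj X Y) Z
          (klin (tensHom (assocIso W X Y).hom (𝟙 Z)) x)))) =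
        ((TensorProduct.assoc k X.carrier Y.carrier Z.carrier).toLinearMap).lTensor W.carrier
          (TensorProduct.assoc k _ _ _
            (((TensorProduct.assoc k W.carrier X.carrier Y.carrier).toLinearMap).rTensor
              Z.carrier ((valL W X Y).rTensor Z.carrier (val _ _ x)))) := by
      rw [val_tensHom, a1, LinearMap.lTensor_comp, LinearMap.comp_apply, valL,
        LinearMap.lTensor_comp, LinearMap.comp_apply, c1, ← a3, ← a2]
    rw [L, pent]
    simp only [valR, valL, LinearMap.lTensor_comp, LinearMap.rTensor_comp, LinearMap.comp_apply]
    rw [c3, b1, b2, c2, b3])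

instance : MonoidalCategory (TwMod F) := MonoidalCategory.ofTensorHom
  (id_tensorHom_id := tensHom_id)
  (id_tensorHom := fun _ _ _ _ => rfl)
  (tensorHom_id := fun _ _ => rfl)
  (tensorHom_comp_tensorHom := tensHom_comp)
  (associator_naturality := assocIso_naturality)
  (leftUnitor_naturality := leftIso_naturality)
  (rightUnitor_naturality := rightIso_naturality)
  (pentagon := pentagon')
  (triangle := triangle')

end TwMod
end Monoidal

section Braided

open CategoryTheory MonoidalCategory

variable {k : Type v} {H : Type u} [Field k] [Ring H] [Algebra k H] [Coalgebra k H]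
  [QuantumGroupoid k H] [IsCocomm k H]

namespace WeakUnitCocycle

variable (F : WeakUnitCocycle k H)

/-- The cyclic permutation `a ⊗ (b ⊗ c) ↦ b ⊗ (c ⊗ a)`. -/
def cyc (k : Type v) (H : Type u) [Field k] [Ring H] [Algebra k H] :
    H ⊗[k] (H ⊗[k] H) →ₐ[k] H ⊗[k] (H ⊗[k] H) :=
  (asc k H).toAlgHom.comp (Algebra.TensorProduct.comm k H (H ⊗[k] H)).toAlgHom

/-- The flip of the first two factors of `(H ⊗ H) ⊗ H`. -/
def t12 (k : Type v) (H : Type u) [Field k] [Ring H] [Algebra k H] :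
    (H ⊗[k] H) ⊗[k] H →ₐ[k] (H ⊗[k] H) ⊗[k] H :=
  Algebra.TensorProduct.map (flip k H).toAlgHom (AlgHom.id k H)

/-- The flip of the last two factors of `H ⊗ (H ⊗ H)`. -/
def t23 (k : Type v) (H : Type u) [Field k] [Ring H] [Algebra k H] :
    H ⊗[k] (H ⊗[k] H) →ₐ[k] H ⊗[k] (H ⊗[k] H) :=
  Algebra.TensorProduct.map (AlgHom.id k H) (flip k H).toAlgHom

@[simp] lemma cyc_tmul (a : H) (x : H ⊗[k] H) : cyc k H (a ⊗ₜ x) = asc k H (x ⊗ₜ a) := rfl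
@[simp] lemma t12_tmul (a : H) (x : H ⊗[k] H) : t12 k H (x ⊗ₜ a) = flip k H x ⊗ₜ a := rfl
@[simp] lemma t23_tmul (a : H) (x : H ⊗[k] H) : t23 k H (a ⊗ₜ x) = a ⊗ₜ flip k H x := rfl

lemma t12_comul (x : H ⊗[k] H) : t12 k H ((comul (R := k) (A := H)).rTensor H x) =
    (comul (R := k) (A := H)).rTensor H x := by
  induction x with
  | zero => simp
  | tmul a b => rw [LinearMap.rTensor_tmul, t12_tmul, flip_comul]
  | add x y hx hy => simp only [map_add, hx, hy]

lemma t23_comul (x : H ⊗[k] H) : t23 k H ((comul (R := k) (A := H)).lTensor H x) =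
    (comul (R := k) (A := H)).lTensor H x := by
  induction x with
  | zero => simp
  | tmul a b => rw [LinearMap.lTensor_tmul, t23_tmul, flip_comul]
  | add x y hx hy => simp only [map_add, hx, hy]

lemma t23_asc_t12 (x : (H ⊗[k] H) ⊗[k] H) : t23 k H (asc k H (t12 k H x)) = cyc k H (asc k H x) := by
  induction x with
  | zero => simp
  | add x y hx hy => simp only [map_add, hx, hy]
  | tmul a b =>
    induction a with
    | zero => simp
    | add x y hx hy => simp only [map_add, TensorProduct.add_tmul, hx, hy]
    | tmul c d => simp

/-- The element of `H ⊗ H ⊗ H` describing the composite of two braidings. -/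
def hexElt : H ⊗[k] (H ⊗[k] H) :=
  ((1 : H) ⊗ₜ F.Finv) * t23 k H (((1 : H) ⊗ₜ F.F) *
    asc k H ((F.Finv ⊗ₜ (1 : H)) * t12 k H (F.F ⊗ₜ (1 : H))))

lemma G_mul_hexElt : F.G * F.hexElt = cyc k H F.G := by
  have h1 : F.G * ((1 : H) ⊗ₜ F.Finv) = (comul (R := k) (A := H)).lTensor H F.F := by
    rw [G, mul_assoc, Algebra.TensorProduct.tmul_mul_tmul, one_mul, F_mul_Finv,
      lTensor_comul_mul_one]
  have h2 : F.G * asc k H (F.Finv ⊗ₜ (1 : H)) =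
      asc k H ((comul (R := k) (A := H)).rTensor H F.F) := by
    rw [G_eq, ← map_mul, mul_assoc, Algebra.TensorProduct.tmul_mul_tmul, one_mul, F_mul_Finv,
      rTensor_comul_mul_one]
  rw [hexElt, ← mul_assoc, h1, ← t23_comul F.F, ← map_mul, ← mul_assoc, ← G, map_mul (asc k H),
    ← mul_assoc, h2, ← t12_comul F.F, ← map_mul, ← map_mul, t23_asc_t12, ← G_eq]

lemma one_mul_G : ((1 : H) ⊗ₜ comul (1 : H)) * F.G = F.G := by
  have h : ((1 : H) ⊗ₜ[k] comul (1 : H)) * P3 k H = P3 k H := by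
    rw [P3_eq', ← mul_assoc, Algebra.TensorProduct.tmul_mul_tmul, one_mul_comul, one_mul]
  rw [← P3_mul_G, ← mul_assoc, h]

/-- The element of `H ⊗ H ⊗ H` describing the braiding with a tensor product. -/
lemma hexElt_left : asc k H (F.twistedComul.rTensor H F.Finv) *
    cyc k H (F.twistedComul.lTensor H F.F) = F.Ginv * cyc k H F.G := by
  have h1 : asc k H (F.twistedComul.rTensor H F.Finv) =
      F.Ginv * cyc k H ((1 : H) ⊗ₜ F.F) := by
    rw [rTensor_twistedComul, map_mul, ← Ginv_eq, cyc_tmul]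
    rfl
  have h2 : F.twistedComul.lTensor H F.F = ((1 : H) ⊗ₜ F.Finv) * F.G := by
    rw [lTensor_twistedComul, mul_assoc]
    rfl
  rw [h1, h2, mul_assoc, ← map_mul, ← mul_assoc, Algebra.TensorProduct.tmul_mul_tmul, one_mul,
    F_mul_Finv, one_mul_G]

lemma P3_mul_hexElt : P3 k H * F.hexElt = F.Ginv * cyc k H F.G := by
  rw [← G_mul_hexElt, ← mul_assoc, Ginv_mul_G, lTensor_twistedComul_one]

end WeakUnitCocycle

namespace TwMod

variable {F : WeakUnitCocycle k H}

/-- The braiding `Φ(m ⊗ n) = F⁻⁽¹⁾ F⁽²⁾ n ⊗ F⁻⁽²⁾ F⁽¹⁾ m`, as a morphism. -/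
def braidHom (M N : TwMod F) : tensObj M N ⟶ tensObj N M :=
  homMk (proj N M ∘ₗ act N M F.Finv ∘ₗ (TensorProduct.comm k M.carrier N.carrier).toLinearMap ∘ₗ
    act M N F.F ∘ₗ val M N) (by
    intro h x
    apply val_injective
    have h1 : F.twistedComul h * F.Finv = F.Finv * comul h := by
      rw [F.twistedComul_apply, mul_assoc, F.F_mul_Finv, mul_assoc, comul_mul_one]
    have h2 : F.F * F.twistedComul h = comul h * F.F := by
      rw [F.twistedComul_apply, ← mul_assoc, ← mul_assoc, F.F_mul_Finv, one_mul_comul]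
    simp only [LinearMap.comp_apply, val_proj, val_smul, LinearEquiv.coe_coe, ← act_mul,
      F.one_mul_Finv, h1, h2]
    rw [act_mul M N, act_mul N M]
    congr 1
    rw [act, tprod_comm]
    congr 2
    exact flip_comul h)

lemma val_braidHom (M N : TwMod F) (x : (tensObj M N).carrier) :
    val N M (klin (braidHom M N) x) = act N M F.Finv
      (TensorProduct.comm k M.carrier N.carrier (act M N F.F (val M N x))) := by
  simp only [braidHom, klin_homMk, LinearMap.comp_apply, val_proj, LinearEquiv.coe_coe, ← act_mul,
    F.one_mul_Finv]

lemma braidHom_braidHom (M N : TwMod F) : braidHom M N ≫ braidHom N M = 𝟙 (tensObj M N) :=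
  hom_ext (LinearMap.ext fun x => val_injective _ _ (by
    rw [klin_comp, LinearMap.comp_apply, val_braidHom, val_braidHom, ← act_mul, F.F_mul_Finv]
    have h1 := tprod_comm N.rep M.rep (comul 1) (TensorProduct.comm k M.carrier N.carrier
      (act M N F.F (val M N x)))
    have h2 : Algebra.TensorProduct.comm k H H (comul 1) = comul (R := k) (1 : H) := flip_comul 1
    rw [h2] at h1
    simp only [act] at h1 ⊢
    rw [h1]
    have h3 : TensorProduct.comm k N.carrier M.carrier (TensorProduct.comm k M.carrier N.carrier
      (tprod M.rep N.rep F.F (val M N x))) = tprod M.rep N.rep F.F (val M N x) :=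
      (TensorProduct.comm k M.carrier N.carrier).symm_apply_apply _
    rw [h3]
    change act M N F.Finv (act M N (comul 1) (act M N F.F (val M N x))) = _
    rw [← act_mul, ← act_mul, F.Finv_mul_one, F.Finv_mul_F]
    exact act_one_val M N x))

/-- The braiding of `_H M_F`. -/
def braidIso (M N : TwMod F) : tensObj M N ≅ tensObj N M where
  hom := braidHom M N
  inv := braidHom N M
  hom_inv_id := braidHom_braidHom M N
  inv_hom_id := braidHom_braidHom N M

lemma braid_naturality {M M' N N' : TwMod F} (f : M ⟶ M') (g : N ⟶ N') :
    tensHom f g ≫ braidHom M' N' = braidHom M N ≫ tensHom g f :=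
  hom_ext (LinearMap.ext fun x => val_injective _ _ (by
    have h1 : ∀ w, TensorProduct.comm k M'.carrier N'.carrier
        (TensorProduct.map (klin f) (klin g) w) =
        TensorProduct.map (klin g) (klin f) (TensorProduct.comm k M.carrier N.carrier w) := by
      intro w
      induction w with
      | zero => simp
      | add x y hx hy => simp only [map_add, hx, hy]
      | tmul a b => simp
    rw [klin_comp, LinearMap.comp_apply, val_braidHom, val_tensHom, ← map_act, h1, klin_comp,
      LinearMap.comp_apply, val_tensHom, val_braidHom, map_act]))

lemma valL_braid (X Y Z : TwMod F) (x : (tensObj (tensObj X Y) Z).carrier) :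
    valL Y X Z (klin (tensHom (braidHom X Y) (𝟙 Z)) x) =
      actL Y X Z (F.Finv ⊗ₜ (1 : H)) ((TensorProduct.comm k X.carrier Y.carrier).toLinearMap.rTensor
        Z.carrier (actL X Y Z (F.F ⊗ₜ (1 : H)) (valL X Y Z x))) := by
  simp only [valL, LinearMap.comp_apply, val_tensHom]
  generalize val (tensObj X Y) Z x = w
  induction w with
  | zero => simp
  | add x y hx hy => simp only [map_add, hx, hy]
  | tmul a b => simp [actL, val_braidHom]

lemma valR_braid (X Y Z : TwMod F) (x : (tensObj X (tensObj Y Z)).carrier) :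
    valR X Z Y (klin (tensHom (𝟙 X) (braidHom Y Z)) x) =
      actR X Z Y ((1 : H) ⊗ₜ F.Finv) ((TensorProduct.comm k Y.carrier Z.carrier).toLinearMap.lTensor
        X.carrier (actR X Y Z ((1 : H) ⊗ₜ F.F) (valR X Y Z x))) := by
  simp only [valR, LinearMap.comp_apply, val_tensHom]
  generalize val X (tensObj Y Z) x = w
  induction w with
  | zero => simp
  | add x y hx hy => simp only [map_add, hx, hy]
  | tmul a b => simp [actR, val_braidHom]

lemma rTensor_comm_actL (X Y Z : TwMod F) (u : (H ⊗[k] H) ⊗[k] H) (w) :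
    (TensorProduct.comm k X.carrier Y.carrier).toLinearMap.rTensor Z.carrier (actL X Y Z u w) =
      actL Y X Z (WeakUnitCocycle.t12 k H u)
        ((TensorProduct.comm k X.carrier Y.carrier).toLinearMap.rTensor Z.carrier w) := by
  induction u with
  | zero => simp
  | add x y hx hy => simp only [map_add, LinearMap.add_apply, hx, hy]
  | tmul a b =>
    induction w with
    | zero => simp
    | add x y hx hy => simp only [map_add, hx, hy]
    | tmul m n => simp [actL, act, tprod_comm]

lemma lTensor_comm_actR (X Y Z : TwMod F) (u : H ⊗[k] (H ⊗[k] H)) (w) :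
    (TensorProduct.comm k Y.carrier Z.carrier).toLinearMap.lTensor X.carrier (actR X Y Z u w) =
      actR X Z Y (WeakUnitCocycle.t23 k H u)
        ((TensorProduct.comm k Y.carrier Z.carrier).toLinearMap.lTensor X.carrier w) := by
  induction u with
  | zero => simp
  | add x y hx hy => simp only [map_add, LinearMap.add_apply, hx, hy]
  | tmul a b =>
    induction w with
    | zero => simp
    | add x y hx hy => simp only [map_add, hx, hy]
    | tmul m n => simp [actR, act, tprod_comm]

lemma cyc_actR (X Y Z : TwMod F) (u : H ⊗[k] (H ⊗[k] H)) (w) :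
    TensorProduct.assoc k Y.carrier Z.carrier X.carrier (TensorProduct.comm k X.carrier
      (Y.carrier ⊗[k] Z.carrier) (actR X Y Z u w)) =
    actR Y Z X (WeakUnitCocycle.cyc k H u) (TensorProduct.assoc k Y.carrier Z.carrier X.carrier
      (TensorProduct.comm k X.carrier (Y.carrier ⊗[k] Z.carrier) w)) := by
  rw [actR, tprod_comm]
  exact tprod_assoc _ _ _ _ _

lemma hexagon (X Y Z : TwMod F) :
    (assocIso X Y Z).hom ≫ braidHom X (tensObj Y Z) ≫ (assocIso Y Z X).hom =
      tensHom (braidHom X Y) (𝟙 Z) ≫ (assocIso Y X Z).hom ≫ tensHom (𝟙 Y) (braidHom X Z) :=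
  hom_ext (LinearMap.ext fun x => valR_injective _ _ _ (by
    set v := TensorProduct.assoc k Y.carrier Z.carrier X.carrier
      (TensorProduct.comm k X.carrier (Y.carrier ⊗[k] Z.carrier)
        (TensorProduct.assoc k X.carrier Y.carrier Z.carrier (valL X Y Z x))) with hv
    have hexk : ∀ w : (X.carrier ⊗[k] Y.carrier) ⊗[k] Z.carrier,
        (TensorProduct.comm k X.carrier Z.carrier).toLinearMap.lTensor Y.carrier
          (TensorProduct.assoc k _ _ _ ((TensorProduct.comm k X.carrier
            Y.carrier).toLinearMap.rTensor Z.carrier w)) =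
        TensorProduct.assoc k Y.carrier Z.carrier X.carrier
          (TensorProduct.comm k X.carrier (Y.carrier ⊗[k] Z.carrier)
          (TensorProduct.assoc k X.carrier Y.carrier Z.carrier w)) := by
      intro w
      induction w with
      | zero => simp
      | add x y hx hy => simp only [map_add, hx, hy]
      | tmul a b =>
        induction a with
        | zero => simp
        | add x y hx hy => simp only [map_add, TensorProduct.add_tmul, hx, hy]
        | tmul c d => simp
    have R : valR Y Z X (klin (tensHom (braidHom X Y) (𝟙 Z) ≫ (assocIso Y X Z).hom ≫
        tensHom (𝟙 Y) (braidHom X Z)) x) = actR Y Z X F.hexElt v := by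
      simp only [klin_comp, LinearMap.comp_apply, klin_assocIso]
      rw [valR_braid, valR_assocHom, valL_braid, rTensor_comm_actL, ← actL_mul, assoc_actL,
        ← actR_mul, lTensor_comm_actR, ← actR_mul, hexk]
      rfl
    have L : valR Y Z X (klin ((assocIso X Y Z).hom ≫ braidHom X (tensObj Y Z) ≫
        (assocIso Y Z X).hom) x) = actR Y Z X (F.Ginv * WeakUnitCocycle.cyc k H F.G) v := by
      have h1 : ∀ w : X.carrier ⊗[k] (tensObj Y Z).carrier,
          (val Y Z).rTensor X.carrier (TensorProduct.comm k _ _ w) =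
          TensorProduct.comm k _ _ ((val Y Z).lTensor X.carrier w) := by
        intro w
        induction w with
        | zero => simp
        | add x y hx hy => simp only [map_add, hx, hy]
        | tmul a b => simp
      have h2 := valR_assocHom X Y Z x
      simp only [valR, LinearMap.comp_apply] at h2
      simp only [klin_comp, LinearMap.comp_apply, klin_assocIso]
      rw [valR_assocHom, valL, LinearMap.comp_apply, val_braidHom, rTensor_val_act, h1,
        lTensor_val_act, h2, assoc_actL, cyc_actR, ← actR_mul, F.hexElt_left]
    have e := actR_valR Y Z X (klin (tensHom (braidHom X Y) (𝟙 Z) ≫ (assocIso Y X Z).hom ≫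
      tensHom (𝟙 Y) (braidHom X Z)) x)
    rw [R, ← actR_mul, F.P3_mul_hexElt, ← L] at e
    rw [R]
    exact e))

instance : BraidedCategory (TwMod F) where
  braiding := braidIso
  braiding_naturality_right X _ _ f := braid_naturality (𝟙 X) f
  braiding_naturality_left f Z := braid_naturality f (𝟙 Z)
  hexagon_forward := hexagon
  hexagon_reverse X Y Z := by
    have e : assocIso Z X Y ≪≫ braidIso Z (tensObj X Y) ≪≫ assocIso X Y Z =
        whiskerRightIso (braidIso Z X) Y ≪≫ assocIso X Z Y ≪≫
          whiskerLeftIso X (braidIso Z Y) := Iso.ext (hexagon Z X Y)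
    have e' := congrArg Iso.inv e
    simp only [Iso.trans_inv, Category.assoc, whiskerRightIso_inv, whiskerLeftIso_inv] at e'
    exact e'

end TwMod

end Braided

section Main

open CategoryTheory MonoidalCategory

variable {k : Type v} {H : Type u} [Field k] [Ring H] [Algebra k H] [Coalgebra k H]
  [QuantumGroupoid k H] [IsCocomm k H]

namespace TwMod

/-- The adjoint action of `H` on the centralizer `C_H(H_s)`. -/
abbrev centralizerModule (k : Type v) (H : Type u) [Field k] [Ring H] [Algebra k H]
    [Coalgebra k H] [QuantumGroupoid k H] [IsCocomm k H] : Module H (sourceCentralizer k H) where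
  smul h a := ⟨Ad (k := k) h a, Ad_mem h a⟩
  one_smul a := Subtype.ext (Ad_one a.2)
  mul_smul h l a := Subtype.ext (Ad_mul h l a)
  smul_zero h := Subtype.ext (map_zero (Ad (k := k) h))
  smul_add h a b := Subtype.ext (map_add (Ad (k := k) h) _ _)
  add_smul h l a := Subtype.ext (by
    change Ad (k := k) (h + l) (a : H) = Ad (k := k) h (a : H) + Ad (k := k) l (a : H)
    simp)
  zero_smul a := Subtype.ext (by
    change Ad (k := k) (0 : H) (a : H) = 0
    simp)

/-- The centralizer `C_H(H_s)` with the adjoint action, as an object of `_H M_F`. -/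
def centralizerObj (F : WeakUnitCocycle k H) : TwMod F :=
  letI := centralizerModule k H
  { carrier := sourceCentralizer k H
    isScalarTower := ⟨fun c h a => Subtype.ext (by
      change Ad (k := k) (c • h) (a : H) = c • Ad (k := k) h (a : H)
      simp)⟩ }

/-- The inclusion of `C_H(H_s)` in `H`. -/
def centralizerVal (F : WeakUnitCocycle k H) : (centralizerObj F).carrier →ₗ[k] H :=
  (sourceCentralizer k H).val.toLinearMap

/-- The element `m ⊗_t n = Δ(1)(m ⊗ n)` of `M ⊗_t N`. -/
def tmul {F : WeakUnitCocycle k H} {M N : TwMod F} (m : M.carrier) (n : N.carrier) :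
    (M ⊗ N : TwMod F).carrier := proj M N (m ⊗ₜ n)

end TwMod
end Main

end WeakHopf

end

/-! The cocycle `F` acts as a change of gauge. Since `H` is cocommutative, `Δ(1)` is itself a weak
invertible unit 2-cocycle, and the category that belongs to it is the ordinary category of
`H`-modules, with `H` acting on `M ⊗_t N` through `Δ` and with the flip as braiding. For every `F`
the spaces `M ⊗_t N` are the same; only the action of `H` and the braiding change. The identity on
modules is therefore a functor `twist F` from the untwisted category to `_H M_F`, and it is braided
monoidal with the action of `F` as comparison of tensor products. Linearity is `F (F⁻¹ Δ(h) F) =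
Δ(h) F`, compatibility with the associators is the cocycle equation, compatibility with the unit
constraints comes from `(ε ⊗ id)F = 1 = (id ⊗ ε)F`, and the braiding of `_H M_F` is the flip
conjugated by `F` (`twistBraided`).

Braided monoidal functors carry Hopf algebras to Hopf algebras (`hopfObjObj`). It is thus enough to
treat `F = Δ(1)`. The transported product is the old one preceded by `F`, the transported coproduct
is the old one followed by `F⁻¹`, and unit, counit and antipode do not change; these are the
formulas of the theorem.

In the untwisted case (`centHopfObj`) product, coproduct and antipode are the restrictions of those
of `H`, and the counit is `ε_t`. By cocommutativity `H_s = H_t` is a commutative base on which `S`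
is the identity. The rest needs that `S` is an involution and a coalgebra map (`antipode_antipode`,
`comul_antipode`), that product and coproduct are equivariant for `Ad` (`mul'_Ad₂_comul`,
`comul_Ad`), that `Δ(a)` lies in the tensor square of the centralizer (`Ad₂_one_one_comul`,
`Ad₂_comul_one_comul`), and that `ε_s = ε_t` on the centralizer (`sourceMap_eq_targetMap`). Most of
these are computations in convolution algebras, where `S` is a weak inverse of the identity with the
maps `ε_t` and `ε_s` in place of units. -/

noncomputable section

namespace WeakHopf

open scoped TensorProduct
open Coalgebra

set_option linter.unusedSectionVars false
set_option linter.unusedSimpArgs false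

/-! ### Convolution over a cocommutative coalgebra -/

section CocommutativeConvolution

open WithConv

variable {k : Type v} {C : Type u} [Field k] [AddCommGroup C] [Module k C] [Coalgebra k C]
  {A B : Type u} [Ring A] [Algebra k A] [Ring B] [Algebra k B]

lemma conv_apply (f g : C →ₗ[k] A) (c : C) : (toConv f * toConv g).ofConv c =
    LinearMap.mul' k A (TensorProduct.map f g (comul c)) := rfl

/-- Over a cocommutative coalgebra, linear maps with commuting values commute for the convolution
product. -/
lemma conv_comm_of_commute [IsCocomm k C] (f g : C →ₗ[k] A) (hfg : ∀ a b, f a * g b = g b * f a) :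
    toConv f * toConv g = toConv g * toConv f := by
  ext c
  change LinearMap.mul' k A (TensorProduct.map f g (comul c)) =
    LinearMap.mul' k A (TensorProduct.map g f (comul c))
  conv_rhs => rw [← comm_comul (R := k) c]
  generalize comul (R := k) c = x
  induction x with
  | zero => simp
  | tmul a b => simp [hfg]
  | add x y hx hy => simp only [map_add, hx, hy]

/-- Composition with a multiplicative linear map preserves convolution products. -/
lemma comp_conv (φ : A →ₗ[k] B) (hφ : ∀ a b, φ (a * b) = φ a * φ b) (f g : C →ₗ[k] A) :
    toConv (φ ∘ₗ f) * toConv (φ ∘ₗ g) =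
      toConv (φ ∘ₗ (toConv f * toConv g : WithConv (C →ₗ[k] A)).ofConv) := by
  ext c
  change LinearMap.mul' k B (TensorProduct.map (φ ∘ₗ f) (φ ∘ₗ g) (comul c)) =
    φ (LinearMap.mul' k A (TensorProduct.map f g (comul c)))
  generalize comul (R := k) c = x
  induction x with
  | zero => simp
  | tmul a b => simp [hφ]
  | add x y hx hy => simp only [map_add, hx, hy]

/-- Composition with an antimultiplicative linear map preserves convolution products over a
cocommutative coalgebra, up to exchanging the factors. -/
lemma comp_conv_of_anti [IsCocomm k C] (φ : A →ₗ[k] B) (hφ : ∀ a b, φ (a * b) = φ b * φ a)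
    (f g : C →ₗ[k] A) :
    toConv (φ ∘ₗ g) * toConv (φ ∘ₗ f) =
      toConv (φ ∘ₗ (toConv f * toConv g : WithConv (C →ₗ[k] A)).ofConv) := by
  ext c
  change LinearMap.mul' k B (TensorProduct.map (φ ∘ₗ g) (φ ∘ₗ f) (comul c)) =
    φ (LinearMap.mul' k A (TensorProduct.map f g (comul c)))
  -- This flips both sides and the next line flips the right side again, so in effect the two sides
  -- differ by one flip; that is the exchange made by the antimultiplicative map.
  rw [← comm_comul (R := k) c]
  conv_rhs => rw [← comm_comul (R := k) c]
  generalize comul (R := k) c = x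
  induction x with
  | zero => simp
  | tmul a b => simp [hφ]
  | add x y hx hy => simp only [map_add, hx, hy]

end CocommutativeConvolution

/-! ### The antipode of a cocommutative quantum groupoid -/

section CocommutativeAntipode

open WithConv

variable {k : Type v} {H : Type u} [Field k] [Ring H] [Algebra k H] [Coalgebra k H]
  [QuantumGroupoid k H] [IsCocomm k H]

/-- The first leg of `Δ(1)` lies in the base, where `ε_t` is the identity, so `1₁1₂ = ε_t(1₁)1₂`. -/
lemma mul'_comul_one : LinearMap.mul' k H (comul (R := k) (1 : H)) = 1 := by
  have h := WeakUnitCocycle.unitL_comul_one (k := k) (H := H)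
  rw [← rTensor_targetMap_comul_one]
  exact h

lemma mul'_mul_right (x : H ⊗[k] H) (h : H) :
    LinearMap.mul' k H (x * ((1 : H) ⊗ₜ[k] h)) = LinearMap.mul' k H x * h := by
  induction x with
  | zero => simp
  | tmul a b => simp [mul_assoc]
  | add x y hx hy => simp only [map_add, add_mul, hx, hy]

/-- Multiply the legs of `ε_t(h₁) ⊗ h₂ = Δ(1)(1 ⊗ h)` and use `1₁1₂ = 1`. -/
lemma conv_target_id :
    toConv (targetMap k H) * toConv (LinearMap.id (R := k) (M := H)) = toConv LinearMap.id := by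
  ext h
  change LinearMap.mul' k H ((targetMap k H).rTensor H (comul h)) = h
  rw [rTensor_targetMap_comul, mul'_mul_right, mul'_comul_one, one_mul]

/-- Both `ε_t * id` and `id * ε_s` are `id * S * id`. This supplies the half of weak invertibility,
`id * S * id = id`, that is not among the axioms. -/
lemma conv_id_source :
    toConv (LinearMap.id (R := k) (M := H)) * toConv (sourceMap k H) = toConv LinearMap.id := by
  rw [← conv_S_id, ← mul_assoc, conv_id_S, conv_target_id]

/-- The antipode of a cocommutative quantum groupoid is an involution. -/
lemma antipode_antipode (h : H) : S k (S k h) = h := by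
  -- The antimultiplicative map `S` applied to `id * S = ε_t`; it fixes the values of `ε_t`.
  have h1 : toConv (S k ∘ₗ S k) * toConv (S (H := H) k) = toConv (targetMap k H) := by
    have := comp_conv_of_anti (S (H := H) k) antipode_mul LinearMap.id (S k)
    rw [conv_id_S, LinearMap.comp_id] at this
    rw [this]
    ext h
    exact (inBase_targetMap h).antipode
  -- The multiplicative map `S²` applied to `id * ε_s = id`; it fixes the values of `ε_s`.
  have h2 : toConv (S k ∘ₗ S k) * toConv (sourceMap k H) = toConv (S (H := H) k ∘ₗ S k) := by
    have := comp_conv (S (H := H) k ∘ₗ S k)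
      (fun a b => by simp only [LinearMap.comp_apply, antipode_mul])
      LinearMap.id (sourceMap k H)
    rw [conv_id_source, LinearMap.comp_id] at this
    rw [← this]
    congr 2
    ext h
    simp only [LinearMap.comp_apply, (inBase_sourceMap (k := k) h).antipode]
  -- `S² = S² * ε_s = S² * S * id = ε_t * id = id`.
  have h3 : toConv (S (H := H) k ∘ₗ S k) = toConv LinearMap.id := by
    rw [← h2, ← conv_S_id, ← mul_assoc, h1, conv_target_id]
  exact congrArg (fun f : WithConv (H →ₗ[k] H) => f.ofConv h) h3

/-- The map `h ↦ h ⊗ 1`. -/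
def inl (k : Type v) (H : Type u) [Field k] [Ring H] [Algebra k H] : H →ₗ[k] H ⊗[k] H :=
  (TensorProduct.mk k H H).flip 1

/-- The map `h ↦ 1 ⊗ h`. -/
def inr (k : Type v) (H : Type u) [Field k] [Ring H] [Algebra k H] : H →ₗ[k] H ⊗[k] H :=
  TensorProduct.mk k H H 1

@[simp] lemma inl_apply (h : H) : inl k H h = h ⊗ₜ 1 := rfl
@[simp] lemma inr_apply (h : H) : inr k H h = 1 ⊗ₜ h := rfl

/-- Splitting `(f ⊗ g) ∘ Δ` into two factors turns Sweedler computations in `H ⊗ H` into convolution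
identities that can be applied one leg at a time. -/
lemma inl_conv_inr (f g : H →ₗ[k] H) : toConv (inl k H ∘ₗ f) * toConv (inr k H ∘ₗ g) =
    toConv (TensorProduct.map f g ∘ₗ comul) := by
  ext h
  change LinearMap.mul' k _ (TensorProduct.map (inl k H ∘ₗ f) (inr k H ∘ₗ g) (comul h)) =
    TensorProduct.map f g (comul h)
  generalize comul (R := k) h = x
  induction x with
  | zero => simp
  | tmul a b => simp
  | add x y hx hy => simp only [map_add, hx, hy]

/-- The two tensor factors commute in `H ⊗ H` and `H` is cocommutative, so the order of the factors
is immaterial. -/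
lemma inr_conv_inl (f g : H →ₗ[k] H) : toConv (inr k H ∘ₗ g) * toConv (inl k H ∘ₗ f) =
    toConv (TensorProduct.map f g ∘ₗ comul) := by
  rw [← inl_conv_inr]
  exact conv_comm_of_commute _ _ (fun a b => by simp)

lemma inl_conv (f g : H →ₗ[k] H) : toConv (inl k H ∘ₗ f) * toConv (inl k H ∘ₗ g) =
    toConv (inl k H ∘ₗ (toConv f * toConv g).ofConv) :=
  comp_conv _ (fun a b => by simp) f g

lemma inr_conv (f g : H →ₗ[k] H) : toConv (inr k H ∘ₗ f) * toConv (inr k H ∘ₗ g) =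
    toConv (inr k H ∘ₗ (toConv f * toConv g).ofConv) :=
  comp_conv _ (fun a b => by simp) f g

/-- On the second leg `ε_t` turns `Δ(h)` into `Δ(1)(h ⊗ 1)`. On the first leg it does not
distinguish `h` from `ε_t(h)`, and `Δ(1)(ε_t(h) ⊗ 1) = Δ(ε_t(h))`. The computation then repeats for
`ε_t(h)`, an element of the base. -/
lemma map_targetMap_comul (h : H) :
    TensorProduct.map (targetMap k H) (targetMap k H) (comul (R := k) h) =
      comul (R := k) (targetMap k H h) := by
  have h1 : ∀ x : H ⊗[k] H, TensorProduct.map (targetMap k H) (targetMap k H) x =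
      (targetMap k H).rTensor H ((targetMap k H).lTensor H x) := fun x => by
    rw [← LinearMap.comp_apply, LinearMap.rTensor_comp_lTensor]
  have h2 : ∀ x : H ⊗[k] H, (targetMap k H).rTensor H (x * (h ⊗ₜ[k] 1)) =
      (targetMap k H).rTensor H (x * (targetMap k H h ⊗ₜ[k] 1)) := by
    intro x
    induction x with
    | zero => simp
    | tmul a b => simp [targetMap_mul_targetMap]
    | add x y hx hy => simp only [map_add, add_mul, hx, hy]
  rw [h1, lTensor_targetMap_comul, h2, ← (inBase_targetMap h).comul_left',
    rTensor_targetMap_comul, ← (inBase_targetMap h).comul_right']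

/-- Both legs of `Δ(1)` lie in the base, where `S` is the identity. -/
lemma map_antipode_comul_one :
    TensorProduct.map (S k) (S k) (comul (R := k) (1 : H)) = comul (R := k) (1 : H) := by
  rw [← targetMap_one (k := k), ← map_targetMap_comul, ← LinearMap.comp_apply,
    ← TensorProduct.map_comp]
  congr 2 <;> exact LinearMap.ext fun h => (inBase_targetMap h).antipode

/-- `S ⊗ S` reverses products and fixes `Δ(1)`, so the claim is the image of `Δ(h)Δ(1) = Δ(h)`. In a
weak bialgebra `Δ(1)` is only an idempotent, and its absorption has to be known before weak inverses
can be compared. -/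
lemma one_mul_map_antipode_comul (h : H) :
    comul (R := k) (1 : H) * TensorProduct.map (S k) (S k) (comul (R := k) h) =
      TensorProduct.map (S k) (S k) (comul (R := k) h) := by
  have h1 : ∀ x y : H ⊗[k] H, TensorProduct.map (S k) (S k) (x * y) =
      TensorProduct.map (S k) (S k) y * TensorProduct.map (S k) (S k) x := by
    intro x y
    induction x with
    | zero => simp
    | tmul a b =>
      induction y with
      | zero => simp
      | tmul c d =>
        rw [Algebra.TensorProduct.tmul_mul_tmul]
        simp only [TensorProduct.map_tmul, antipode_mul, Algebra.TensorProduct.tmul_mul_tmul]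
      | add x y hx hy => simp only [map_add, mul_add, add_mul, hx, hy]
    | add x y hx hy => simp only [map_add, mul_add, add_mul, hx, hy]
  conv_lhs => rw [← map_antipode_comul_one, ← h1, comul_mul_one]

/-- The antipode of a cocommutative quantum groupoid is a coalgebra map. -/
lemma comul_antipode (h : H) :
    comul (R := k) (S k h) = TensorProduct.map (S k) (S k) (comul (R := k) h) := by
  -- `Δ ∘ S` and `T = (S ⊗ S) ∘ Δ` are both weak convolution inverses of `Δ`; the proof is the
  -- uniqueness of such an inverse.
  let D : H →ₗ[k] H ⊗[k] H := comul
  let T : H →ₗ[k] H ⊗[k] H := TensorProduct.map (S k) (S k) ∘ₗ comul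
  have hD : D = TensorProduct.map LinearMap.id LinearMap.id ∘ₗ comul := by
    rw [TensorProduct.map_id, LinearMap.id_comp]
  have DN : toConv D * toConv (D ∘ₗ S k) = toConv (D ∘ₗ targetMap k H) := by
    have := comp_conv D comul_mul LinearMap.id (S k)
    rwa [conv_id_S, LinearMap.comp_id] at this
  have ND : toConv (D ∘ₗ S k) * toConv D = toConv (D ∘ₗ sourceMap k H) := by
    have := comp_conv D comul_mul (S k) LinearMap.id
    rwa [conv_S_id, LinearMap.comp_id] at this
  have NDN : toConv (D ∘ₗ S k) * toConv (D ∘ₗ targetMap k H) = toConv (D ∘ₗ S k) := by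
    rw [comp_conv D comul_mul, conv_S_target]
  -- With the factors of `T` in reverse order the second legs are adjacent and collapse to `ε_t`.
  -- Since `inl` and `inr` factors may be exchanged, the first legs then collapse as well, which
  -- leaves `(ε_t ⊗ ε_t) ∘ Δ = Δ ∘ ε_t`.
  have DT : toConv D * toConv T = toConv (D ∘ₗ targetMap k H) := by
    have hT : toConv T = toConv (inr k H ∘ₗ S k) * toConv (inl k H ∘ₗ S k) :=
      (inr_conv_inl _ _).symm
    rw [hD, hT, ← inl_conv_inr, mul_assoc, ← mul_assoc (toConv (inr k H ∘ₗ LinearMap.id)),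
      inr_conv, conv_id_S, inr_conv_inl, ← inl_conv_inr, ← mul_assoc, inl_conv, conv_id_S,
      inl_conv_inr]
    ext h
    simpa using map_targetMap_comul h
  -- `Δ(y) = (y ⊗ 1)Δ(1)` for `y` in the base, and `T` absorbs `Δ(1)`. Only `ε_s` in the first leg
  -- remains, where `ε_s * S = S`.
  have ST : toConv (D ∘ₗ sourceMap k H) * toConv T = toConv T := by
    have h1 : toConv (D ∘ₗ sourceMap k H) * toConv T =
        toConv (inl k H ∘ₗ sourceMap k H) * toConv T := by
      ext h
      change LinearMap.mul' k _ (TensorProduct.map _ T (comul h)) =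
        LinearMap.mul' k _ (TensorProduct.map _ T (comul h))
      generalize comul (R := k) h = x
      induction x with
      | zero => simp
      | tmul a b =>
        have := one_mul_map_antipode_comul (k := k) b
        simp only [TensorProduct.map_tmul, LinearMap.mul'_apply, LinearMap.comp_apply, inl_apply,
          D, T]
        rw [(inBase_sourceMap a).comul_left, mul_assoc, this]
      | add x y hx hy => simp only [map_add, hx, hy]
    rw [h1]
    change _ * toConv (TensorProduct.map (S k) (S k) ∘ₗ comul) = _
    rw [← inl_conv_inr, ← mul_assoc, inl_conv, conv_source_S, inl_conv_inr]
  -- With `N = Δ ∘ S`: `N = N * (Δ ∘ ε_t) = N * Δ * T = (Δ ∘ ε_s) * T = T`.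
  have e : toConv (D ∘ₗ S k) = toConv T := by
    rw [← NDN, ← DT, ← mul_assoc, ND, ST]
  exact congrArg (fun f : WithConv (H →ₗ[k] H ⊗[k] H) => f.ofConv h) e

/-- `ε_t ∘ S = ε_s`. -/
lemma targetMap_antipode (h : H) : targetMap k H (S k h) = sourceMap k H h := by
  -- As `S` is a coalgebra map and an involution, `S(h)₁ S(S(h)₂) = S(h₁)h₂`.
  rw [← id_conv_antipode, comul_antipode, ← LinearMap.comp_apply (TensorProduct.map _ _),
    ← TensorProduct.map_comp, ← antipode_conv_id]
  congr 3
  exact LinearMap.ext antipode_antipode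

/-- In `ε_t(zh) = (zh)₁S((zh)₂)` the element `z` appears only in the first leg, because `Δ(zh) = (z
⊗ 1)Δ(h)`. -/
lemma targetMap_base_mul {z : H} (hz : InBase k z) (h : H) :
    targetMap k H (z * h) = z * targetMap k H h := by
  rw [← id_conv_antipode, ← id_conv_antipode, comul_mul, hz.comul_left, mul_assoc, one_mul_comul]
  generalize comul (R := k) h = x
  induction x with
  | zero => simp
  | tmul a b => simp [mul_assoc]
  | add x y hx hy => simp only [map_add, mul_add, hx, hy]

end CocommutativeAntipode

/-! ### The adjoint action and the centralizer of the base -/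

section CentralizerAdjoint

open WithConv

variable {k : Type v} {H : Type u} [Field k] [Ring H] [Algebra k H] [Coalgebra k H]
  [QuantumGroupoid k H]

/-- The adjoint action on `a` is the convolution product of `h ↦ h a` and the antipode. -/
lemma conv_mulRight_antipode (a : H) : toConv (LinearMap.mulRight k a) * toConv (S (H := H) k) =
    toConv ((Ad (k := k)).flip a) := by
  ext h
  change LinearMap.mul' k H (TensorProduct.map _ _ (comul h)) = sandwich (comul h) a
  generalize comul (R := k) h = x
  induction x with
  | zero => simp
  | tmul a b => simp
  | add x y hx hy => simp only [map_add, LinearMap.add_apply, hx, hy]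

/-- Since each adjoint action is itself a convolution product with `S`, the product of two of them
becomes a fourfold convolution whose middle factors can be contracted. -/
lemma conv_Ad_Ad (a b h : H) :
    (toConv ((Ad (k := k)).flip a) * toConv ((Ad (k := k)).flip b)).ofConv h =
      LinearMap.mul' k H (Ad₂ (comul (R := k) h) (a ⊗ₜ b)) := by
  rw [conv_apply]
  generalize comul (R := k) h = x
  induction x with
  | zero => simp
  | tmul a b => simp
  | add x y hx hy => simp only [map_add, LinearMap.add_apply, hx, hy]

variable [IsCocomm k H]

/-- The adjoint action of a product: `Ad_{h₁}(a) Ad_{h₂}(b) = Ad_h(ab)`. -/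
lemma mul'_Ad₂_comul (h : H) {a : H} (ha : a ∈ sourceCentralizer k H) (b : H) :
    LinearMap.mul' k H (Ad₂ (comul (R := k) h) (a ⊗ₜ b)) = Ad (k := k) h (a * b) := by
  rw [mem_sourceCentralizer] at ha
  -- The middle factors of `h₁ a S(h₂) h₃ b S(h₄)` contract to `ε_s(h₂) b`.
  have h1 : toConv (S (H := H) k) * toConv (LinearMap.mulRight k b) =
      toConv (LinearMap.mulRight k b ∘ₗ sourceMap k H) := by
    ext h
    change LinearMap.mul' k H (TensorProduct.map _ _ (comul h)) = sourceMap k H h * b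
    rw [← antipode_conv_id]
    generalize comul (R := k) h = x
    induction x with
    | zero => simp
    | tmul a b => simp [mul_assoc]
    | add x y hx hy => simp only [map_add, add_mul, hx, hy]
  -- `a` centralizes the base, so `ε_s(h₂)` passes to its left and is absorbed by `h₁ε_s(h₂) = h`.
  have h2 : toConv (LinearMap.mulRight k a) *
      toConv (LinearMap.mulRight k b ∘ₗ sourceMap k H) = toConv (LinearMap.mulRight k (a * b)) := by
    ext h
    have h3 := congrArg (fun f : WithConv (H →ₗ[k] H) => f.ofConv h)
      (conv_id_source (k := k) (H := H))
    change LinearMap.mul' k H (TensorProduct.map _ _ (comul h)) = h at h3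
    change LinearMap.mul' k H (TensorProduct.map _ _ (comul h)) = h * (a * b)
    conv_rhs => rw [← h3]
    generalize comul (R := k) h = x
    induction x with
    | zero => simp
    | tmul c d =>
      simp only [TensorProduct.map_tmul, LinearMap.mul'_apply, LinearMap.mulRight_apply,
        LinearMap.comp_apply, LinearMap.id_apply, mul_assoc]
      rw [← mul_assoc a, ← ha _ (inBase_sourceMap d), mul_assoc]
    | add x y hx hy => simp only [map_add, add_mul, hx, hy]
  rw [← conv_Ad_Ad, ← conv_mulRight_antipode, ← conv_mulRight_antipode, mul_assoc,
    ← mul_assoc (toConv (S k)), h1, ← mul_assoc, h2, conv_mulRight_antipode]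
  rfl

/-- The comultiplication is equivariant: `Δ(Ad_h(a)) = Ad_{h₁}(a₁) ⊗ Ad_{h₂}(a₂)`. -/
lemma comul_Ad (h a : H) :
    comul (R := k) (Ad (k := k) h a) = Ad₂ (comul (R := k) h) (comul (R := k) a) := by
  -- Replacing `Δ(a)` by an arbitrary `w` makes the identity linear, so that `w` can be taken to be
  -- a pure tensor, for which the two legs separate.
  have h1 : ∀ w : H ⊗[k] H, (toConv (LinearMap.mulRight k w ∘ₗ comul) *
      toConv (TensorProduct.map (S k) (S k) ∘ₗ comul)).ofConv h = Ad₂ (comul (R := k) h) w := by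
    intro w
    have hadd : ∀ x y : H ⊗[k] H, LinearMap.mulRight k (x + y) =
        LinearMap.mulRight k x + LinearMap.mulRight k y := fun x y => by
      ext; simp [mul_add]
    induction w with
    | zero =>
      rw [conv_apply, map_zero]
      generalize comul (R := k) h = y
      induction y with
      | zero => simp
      | tmul a b => simp
      | add x y hx hy => rw [map_add, map_add, hx, hy, add_zero]
    | add x y hx hy =>
      rw [map_add, ← hx, ← hy, hadd, LinearMap.add_comp, toConv_add, add_mul]
      rfl
    | tmul x y =>
      have h2 : LinearMap.mulRight k (x ⊗ₜ[k] y) ∘ₗ comul (R := k) (A := H) =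
          TensorProduct.map (LinearMap.mulRight k x) (LinearMap.mulRight k y) ∘ₗ comul := by
        congr 1
        ext
        simp
      -- The four factors are regrouped so that in each leg right multiplication meets its own
      -- antipode and gives an adjoint action.
      rw [h2, ← inl_conv_inr, ← inr_conv_inl, mul_assoc,
        ← mul_assoc (toConv (inr k H ∘ₗ LinearMap.mulRight k y)), inr_conv, inr_conv_inl,
        ← inl_conv_inr, ← mul_assoc, inl_conv, inl_conv_inr, conv_mulRight_antipode,
        conv_mulRight_antipode]
      change TensorProduct.map _ _ (comul h) = _
      generalize comul (R := k) h = x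
      induction x with
      | zero => simp
      | tmul a b => simp
      | add x y hx hy => simp only [map_add, LinearMap.add_apply, hx, hy]
  have h2 := congrArg (fun f : WithConv (H →ₗ[k] H) => f.ofConv h)
    (conv_mulRight_antipode (k := k) a)
  change _ = Ad (k := k) h a at h2
  rw [← h1, ← h2]
  -- `Δ` is multiplicative, so it maps the factorization of `Ad` as a convolution product to one of
  -- `Δ ∘ Ad`; its last factor is rewritten because `S` is a coalgebra map.
  have h3 := comp_conv (comul (R := k) (A := H)) comul_mul (LinearMap.mulRight k a) (S k)
  have h4 : comul (R := k) (A := H) ∘ₗ LinearMap.mulRight k a =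
      LinearMap.mulRight k (comul a) ∘ₗ comul := by
    ext; simp [comul_mul]
  have h5 : comul (R := k) (A := H) ∘ₗ S k = TensorProduct.map (S k) (S k) ∘ₗ comul :=
    LinearMap.ext comul_antipode
  rw [h4, h5] at h3
  rw [h3]
  rfl

lemma InBase.mem_sourceCentralizer {z : H} (hz : InBase k z) : z ∈ sourceCentralizer k H :=
  WeakHopf.mem_sourceCentralizer.2 fun _ hy => hy.commute hz

lemma comul_mul_base {z : H} (hz : InBase k z) (h : H) :
    comul (R := k) h * (z ⊗ₜ[k] (1 : H)) = comul (h * z) := by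
  rw [comul_mul, hz.comul_left', ← mul_assoc, comul_mul_one]

lemma comul_base_mul {z : H} (hz : InBase k z) (h : H) :
    (z ⊗ₜ[k] (1 : H)) * comul (R := k) h = comul (z * h) := by
  rw [comul_mul, hz.comul_left, mul_assoc, one_mul_comul]

/-- `Ad_h(z) = ε_t(hz)` for `z` in the base. -/
lemma Ad_base (h : H) {z : H} (hz : InBase k z) : Ad (k := k) h z = targetMap k H (h * z) := by
  rw [← id_conv_antipode, ← comul_mul_base hz]
  change sandwich (comul h) z = _
  generalize comul (R := k) h = x
  induction x with
  | zero => simp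
  | tmul a b => simp
  | add x y hx hy => simp only [map_add, add_mul, LinearMap.add_apply, hx, hy]

/-- `Ad_z(a) = za` for `z` in the base. -/
lemma base_Ad {z a : H} (hz : InBase k z) (ha : a ∈ sourceCentralizer k H) :
    Ad (k := k) z a = z * a := by
  conv_rhs => rw [← Ad_one (k := k) ha]
  change sandwich (comul z) a = z * sandwich (comul 1) a
  rw [hz.comul_left]
  generalize comul (R := k) (1 : H) = x
  induction x with
  | zero => simp
  | tmul a b => simp [mul_assoc]
  | add x y hx hy => simp only [map_add, mul_add, LinearMap.add_apply, hx, hy]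

/-- `ε_t(Ad_h(a)) = ε_t(ha)` for `a` in the centralizer of the base. -/
lemma targetMap_Ad (h : H) {a : H} (ha : a ∈ sourceCentralizer k H) :
    targetMap k H (Ad (k := k) h a) = targetMap k H (h * a) := by
  rw [mem_sourceCentralizer] at ha
  have h3 := congrArg (fun f : WithConv (H →ₗ[k] H) => f.ofConv h)
    (conv_id_source (k := k) (H := H))
  change LinearMap.mul' k H (TensorProduct.map _ _ (comul h)) = h at h3
  -- The bare `h` on the right is expanded as `h₁ε_s(h₂)`.
  conv_rhs => rw [← h3]
  change targetMap k H (sandwich (comul h) a) = _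
  generalize comul (R := k) h = x
  induction x with
  | zero => simp
  | tmul c d =>
    simp only [sandwich_tmul, TensorProduct.map_tmul, LinearMap.mul'_apply, LinearMap.id_apply]
    -- Inside `ε_t` the last factor `S(d)` may be replaced by `ε_t(S(d)) = ε_s(d)`, which commutes
    -- with `a`.
    rw [← targetMap_mul_targetMap, targetMap_antipode, mul_assoc, mul_assoc,
      ha _ (inBase_sourceMap d)]
  | add x y hx hy => simp only [map_add, add_mul, LinearMap.add_apply, hx, hy]

/-- The adjoint action commutes with the antipode. -/
lemma antipode_Ad (h a : H) : S k (Ad (k := k) h a) = Ad (k := k) h (S k a) := by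
  change S k (sandwich (comul h) a) = sandwich (comul h) (S k a)
  -- `S(h₁ a S(h₂)) = S²(h₂)S(a)S(h₁) = h₂S(a)S(h₁)`, and cocommutativity restores the order of the
  -- legs.
  conv_rhs => rw [← flip_comul]
  generalize comul (R := k) h = x
  induction x with
  | zero => simp
  | tmul c d =>
    rw [sandwich_tmul, antipode_mul, antipode_mul, antipode_antipode, ← mul_assoc]
    exact (sandwich_tmul d c (S k a)).symm
  | add x y hx hy => simp only [map_add, LinearMap.add_apply, hx, hy]

/-- `a = Ad_1(a)`, hence `S(a) = Ad_1(S(a))`, and every value of the adjoint action lies in the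
centralizer. -/
lemma antipode_mem {a : H} (ha : a ∈ sourceCentralizer k H) : S k a ∈ sourceCentralizer k H := by
  rw [← Ad_one (k := k) ha, antipode_Ad]
  exact Ad_mem _ _

/-- The comultiplication of the centralizer takes values in its tensor product with `H`. -/
lemma rTensor_Ad_one_comul {a : H} (ha : a ∈ sourceCentralizer k H) :
    (Ad (k := k) (1 : H)).rTensor H (comul (R := k) a) = comul (R := k) a := by
  rw [mem_sourceCentralizer] at ha
  -- For base elements `c`, `d` the sandwich on the first leg gives `(c ⊗ 1)Δ(a)(d ⊗ 1) = Δ(cad) =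
  -- Δ(acd)`. Taking `Δ(1)` for `x`, both of whose legs lie in the base, and using `1₁1₂ = 1` leaves
  -- `Δ(a)`.
  have h1 : ∀ x : H ⊗[k] H, (sandwich (TensorProduct.map (targetMap k H) (targetMap k H) x)).rTensor
      H (comul (R := k) a) = comul (R := k)
        (a * LinearMap.mul' k H (TensorProduct.map (targetMap k H) (targetMap k H) x)) := by
    intro x
    induction x with
    | zero => simp
    | add x y hx hy =>
      rw [map_add, map_add, LinearMap.rTensor_add, LinearMap.add_apply, hx, hy, map_add, mul_add,
        map_add]
    | tmul c d =>
      have hc := inBase_targetMap (k := k) c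
      have hd := inBase_targetMap (k := k) d
      rw [TensorProduct.map_tmul, LinearMap.mul'_apply, ← mul_assoc, ← ha _ hc,
        ← comul_mul_base hd, ← comul_base_mul hc]
      generalize comul (R := k) a = y
      induction y with
      | zero => simp
      | add x y hx hy => simp only [map_add, mul_add, add_mul, hx, hy]
      | tmul p q => simp [hd.antipode]
  have h2 := h1 (comul 1)
  rw [map_targetMap_comul, targetMap_one, mul'_comul_one, mul_one] at h2
  exact h2

/-- Cocommutativity carries the result for the first leg over to the second. As `Ad_1` takes values
in the centralizer, both legs of `Δ(a)` may be taken there. -/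
lemma Ad₂_one_one_comul {a : H} (ha : a ∈ sourceCentralizer k H) :
    Ad₂ ((1 : H) ⊗ₜ[k] (1 : H)) (comul (R := k) a) = comul (R := k) a := by
  have h1 : ∀ x : H ⊗[k] H, Ad₂ ((1 : H) ⊗ₜ[k] (1 : H)) x =
      flip k H ((Ad (k := k) (1 : H)).rTensor H (flip k H ((Ad (k := k) (1 : H)).rTensor H x))) := by
    intro x
    induction x with
    | zero => simp
    | add x y hx hy => simp only [map_add, hx, hy]
    | tmul p q => simp
  rw [h1, rTensor_Ad_one_comul ha, flip_comul, rTensor_Ad_one_comul ha, flip_comul]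

/-- Equivariance of `Δ` at `h = 1`. It places `Δ(a)` in the subspace `⊗_t` of the tensor square. -/
lemma Ad₂_comul_one_comul {a : H} (ha : a ∈ sourceCentralizer k H) :
    Ad₂ (comul (R := k) (1 : H)) (comul (R := k) a) = comul (R := k) a := by
  rw [← comul_Ad, Ad_one ha]

/-- The source and target maps agree on the centralizer of the base. -/
lemma sourceMap_eq_targetMap {a : H} (ha : a ∈ sourceCentralizer k H) :
    sourceMap k H a = targetMap k H a := by
  rw [mem_sourceCentralizer] at ha
  -- `ε_s(a)` and `ε_t(a)` differ by the side on which `a` multiplies a leg of `Δ(1)` and by the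
  -- choice of that leg. The leg lies in the base and so commutes with `a`, and `Δ(1)` is symmetric.
  have h1 : ∀ x : H ⊗[k] H, counitR k (((1 : H) ⊗ₜ[k] a) * (targetMap k H).lTensor H x) =
      counitL k (flip k H ((targetMap k H).lTensor H x) * (a ⊗ₜ[k] 1)) := by
    intro x
    induction x with
    | zero => simp
    | add x y hx hy => simp only [map_add, mul_add, add_mul, hx, hy]
    | tmul p q => simp [ha _ (inBase_targetMap q)]
  have h2 := h1 (comul 1)
  rwa [lTensor_targetMap_comul_one, flip_comul] at h2

end CentralizerAdjoint

/-! ### Twisting by `F` as a braided monoidal functor -/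

section Untwisted

open CategoryTheory MonoidalCategory

variable {k : Type v} {H : Type u} [Field k] [Ring H] [Algebra k H] [Coalgebra k H]
  [QuantumGroupoid k H] [IsCocomm k H]

/-- The cocycle `Δ(1)`, for which `_H M_F` is the untwisted category of modules. -/
def trivialCocycle (k : Type v) (H : Type u) [Field k] [Ring H] [Algebra k H] [Coalgebra k H]
    [QuantumGroupoid k H] [IsCocomm k H] : WeakUnitCocycle k H where
  F := comul 1
  Finv := comul 1
  mem := ⟨1, by rw [flip_comul, mul_one, one_mul_comul]⟩
  mem_inv := ⟨1, by rw [flip_comul, mul_one, one_mul_comul]⟩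
  mul_inv := one_mul_comul 1
  inv_mul := by rw [flip_comul, one_mul_comul]
  cocycle := by
    rw [WeakUnitCocycle.rTensor_comul_mul_one, WeakUnitCocycle.lTensor_comul_mul_one,
      WeakUnitCocycle.coassoc']
  source_F y hy := by
    have hy := mem_sourceSpace.1 hy
    rw [← hy.comul_right, ← hy.comul_left']
  target_F y hy := by
    have hy := mem_targetSpace.1 hy
    rw [← hy.comul_left, ← hy.comul_right']
  Finv_source y hy := by
    have hy := mem_sourceSpace.1 hy
    rw [← hy.comul_left, ← hy.comul_right']
  Finv_target y hy := by
    have hy := mem_targetSpace.1 hy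
    rw [← hy.comul_right, ← hy.comul_left']
  source_Finv y hy := by
    have hy := mem_sourceSpace.1 hy
    rw [hy.antipode_symm, ← hy.comul_right, ← hy.comul_left]
  F_target y hy := by
    have hy := mem_targetSpace.1 hy
    rw [hy.antipode_symm, ← hy.comul_right', ← hy.comul_left']
  counitL_F := counitL_comul 1
  counitR_F := counitR_comul 1

@[simp] lemma trivialCocycle_F : (trivialCocycle k H).F = comul 1 := rfl

@[simp] lemma trivialCocycle_Finv : (trivialCocycle k H).Finv = comul 1 := rfl

@[simp] lemma twistedComul_trivialCocycle : (trivialCocycle k H).twistedComul = comul := by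
  ext h
  simp [WeakUnitCocycle.twistedComul_apply]

namespace TwMod

variable (F : WeakUnitCocycle k H)

/-- An untwisted module, as an object of `_H M_F`. -/
abbrev twistObj (M : TwMod (trivialCocycle k H)) : TwMod F where
  carrier := M.carrier

/-- A morphism of untwisted modules, as a morphism of `_H M_F`. -/
def twistHom {M N : TwMod (trivialCocycle k H)} (f : M ⟶ N) : twistObj F M ⟶ twistObj F N :=
  (⟨lin (M := M) (N := N) f⟩ : Hom (twistObj F M) (twistObj F N))

/-- The identity on modules, as a functor from the untwisted category to `_H M_F`. -/
def twist : TwMod (trivialCocycle k H) ⥤ TwMod F where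
  obj M := twistObj F M
  map f := twistHom F f

/-- The inclusion of the twisted tensor product of untwisted modules in their tensor product. -/
def twistVal (M N : TwMod (trivialCocycle k H)) :
    (tensObj (twistObj F M) (twistObj F N)).carrier →ₗ[k] M.carrier ⊗[k] N.carrier :=
  val (twistObj F M) (twistObj F N)

/-- The projection to the twisted tensor product of untwisted modules. -/
def twistProj (M N : TwMod (trivialCocycle k H)) :
    M.carrier ⊗[k] N.carrier →ₗ[k] (tensObj (twistObj F M) (twistObj F N)).carrier :=
  proj (twistObj F M) (twistObj F N)

lemma twistVal_injective (M N : TwMod (trivialCocycle k H)) :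
    Function.Injective (twistVal F M N) := val_injective _ _

lemma twistVal_twistProj (M N : TwMod (trivialCocycle k H)) (w) :
    twistVal F M N (twistProj F M N w) = act M N (comul 1) w := rfl

lemma act_one_twistVal (M N : TwMod (trivialCocycle k H)) (x) :
    act M N (comul 1) (twistVal F M N x) = twistVal F M N x :=
  act_one_val (twistObj F M) (twistObj F N) x

/-- The subspace `M ⊗_t N` does not depend on the cocycle; the action of `H` on it does. -/
lemma twistVal_smul (M N : TwMod (trivialCocycle k H)) (h : H) (x) :
    twistVal F M N (h • x) = act M N (F.twistedComul h) (twistVal F M N x) := rfl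

/-- The action of `F`, from the twisted to the untwisted tensor product. -/
def untwist (M N : TwMod (trivialCocycle k H)) :
    (tensObj (twistObj F M) (twistObj F N)).carrier →ₗ[k] (tensObj M N).carrier :=
  proj M N ∘ₗ act M N F.F ∘ₗ twistVal F M N

/-- The action of `F⁻¹`, from the untwisted to the twisted tensor product. -/
def retwist (M N : TwMod (trivialCocycle k H)) :
    (tensObj M N).carrier →ₗ[k] (tensObj (twistObj F M) (twistObj F N)).carrier :=
  twistProj F M N ∘ₗ act M N F.Finv ∘ₗ val M N

/-- `Δ(1)F = F`, so the projection does nothing after `F`. -/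
lemma val_untwist (M N : TwMod (trivialCocycle k H)) (x) :
    val M N (untwist F M N x) = act M N F.F (twistVal F M N x) := by
  simp only [untwist, LinearMap.comp_apply, val_proj, ← act_mul, F.one_mul_F]

lemma twistVal_retwist (M N : TwMod (trivialCocycle k H)) (x) :
    twistVal F M N (retwist F M N x) = act M N F.Finv (val M N x) := by
  simp only [retwist, LinearMap.comp_apply, twistVal_twistProj, ← act_mul, F.one_mul_Finv]

/-- `F` intertwines the twisted with the untwisted comultiplication: `F F⁻¹ Δ(h) F = Δ(h)F`. -/
lemma untwist_smul (M N : TwMod (trivialCocycle k H)) (h : H) (x) :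
    untwist F M N (h • x) = h • untwist F M N x := by
  apply val_injective
  have h2 : F.F * F.twistedComul h = comul h * F.F := by
    rw [F.twistedComul_apply, ← mul_assoc, ← mul_assoc, F.F_mul_Finv, one_mul_comul]
  rw [val_smul, val_untwist, val_untwist, twistVal_smul, ← act_mul, ← act_mul, h2,
    twistedComul_trivialCocycle]

/-- `FF⁻¹` and, in the next lemma, `F⁻¹F` equal `Δ(1)`, which acts as the identity on `M ⊗_t N`. -/
lemma untwist_retwist (M N : TwMod (trivialCocycle k H)) (x) :
    untwist F M N (retwist F M N x) = x := by
  apply val_injective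
  rw [val_untwist, twistVal_retwist, ← act_mul, F.F_mul_Finv, act_one_val]

lemma retwist_untwist (M N : TwMod (trivialCocycle k H)) (x) :
    retwist F M N (untwist F M N x) = x := by
  apply twistVal_injective
  rw [twistVal_retwist, val_untwist, ← act_mul, F.Finv_mul_F, act_one_twistVal]

/-- The isomorphism from the twisted to the untwisted tensor product given by the action of `F`. -/
def twistTensor (M N : TwMod (trivialCocycle k H)) :
    tensObj (twistObj F M) (twistObj F N) ≅ twistObj F (tensObj M N) :=
  isoMk (N := twistObj F (tensObj M N)) (untwist F M N) (retwist F M N) (untwist_smul F M N)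
    (untwist_retwist F M N) (retwist_untwist F M N)

lemma untwist_naturality {M M' N N' : TwMod (trivialCocycle k H)} (f : M ⟶ M') (g : N ⟶ N') (x) :
    untwist F M' N' (klin (tensHom (twistHom F f) (twistHom F g)) x) =
      klin (tensHom f g) (untwist F M N x) := by
  apply val_injective
  have h1 : twistVal F M' N' (klin (tensHom (twistHom F f) (twistHom F g)) x) =
      TensorProduct.map (klin f) (klin g) (twistVal F M N x) :=
    val_tensHom (twistHom F f) (twistHom F g) x
  rw [val_tensHom, val_untwist, val_untwist, h1, map_act]

lemma twistTensor_naturality {M M' N N' : TwMod (trivialCocycle k H)} (f : M ⟶ M') (g : N ⟶ N') :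
    tensHom ((twist F).map f) ((twist F).map g) ≫ (twistTensor F M' N').hom =
      (twistTensor F M N).hom ≫ (twist F).map (tensHom f g) :=
  hom_ext (LinearMap.ext fun x => untwist_naturality F f g x)

lemma rTensor_val_map_untwist (X Y Z : TwMod (trivialCocycle k H))
    (u : (tensObj (twistObj F X) (twistObj F Y)).carrier ⊗[k] Z.carrier) :
    (val X Y).rTensor Z.carrier (TensorProduct.map (untwist F X Y) LinearMap.id u) =
      actL X Y Z (F.F ⊗ₜ (1 : H)) ((twistVal F X Y).rTensor Z.carrier u) := by
  induction u with
  | zero => simp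
  | add x y hx hy => simp only [map_add, hx, hy]
  | tmul a b => simp [actL, val_untwist]

lemma lTensor_val_map_untwist (X Y Z : TwMod (trivialCocycle k H))
    (u : X.carrier ⊗[k] (tensObj (twistObj F Y) (twistObj F Z)).carrier) :
    (val Y Z).lTensor X.carrier (TensorProduct.map LinearMap.id (untwist F Y Z) u) =
      actR X Y Z ((1 : H) ⊗ₜ F.F) ((twistVal F Y Z).lTensor X.carrier u) := by
  induction u with
  | zero => simp
  | add x y hx hy => simp only [map_add, hx, hy]
  | tmul a b => simp [actR, val_untwist]

/-- The inclusion of the twisted tensor product of three modules, bracketed to the left. -/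
def twistValL (X Y Z : TwMod (trivialCocycle k H)) :
    (tensObj (tensObj (twistObj F X) (twistObj F Y)) (twistObj F Z)).carrier →ₗ[k]
      (X.carrier ⊗[k] Y.carrier) ⊗[k] Z.carrier :=
  valL (twistObj F X) (twistObj F Y) (twistObj F Z)

/-- The inclusion of the twisted tensor product of three modules, bracketed to the right. -/
def twistValR (X Y Z : TwMod (trivialCocycle k H)) :
    (tensObj (twistObj F X) (tensObj (twistObj F Y) (twistObj F Z))).carrier →ₗ[k]
      X.carrier ⊗[k] (Y.carrier ⊗[k] Z.carrier) :=
  valR (twistObj F X) (twistObj F Y) (twistObj F Z)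

/-- `H` acts on the untwisted `X ⊗_t Y` through `Δ`, so the outer comparison acts by `(Δ ⊗ id)F`
after the inner one has acted by `F ⊗ 1`. This is the left side of the cocycle equation;
`valR_twistTensor` gives the right side. -/
lemma valL_twistTensor (X Y Z : TwMod (trivialCocycle k H)) (x) :
    valL X Y Z (untwist F (tensObj X Y) Z
      (klin (tensHom (twistTensor F X Y).hom (𝟙 (twistObj F Z))) x)) =
      actL X Y Z ((comul (R := k) (A := H)).rTensor H F.F * (F.F ⊗ₜ (1 : H)))
        (twistValL F X Y Z x) := by
  have e2 : twistVal F (tensObj X Y) Z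
      (klin (tensHom (twistTensor F X Y).hom (𝟙 (twistObj F Z))) x) =
      TensorProduct.map (untwist F X Y) LinearMap.id
        (val (tensObj (twistObj F X) (twistObj F Y)) (twistObj F Z) x) :=
    val_tensHom (twistTensor F X Y).hom (𝟙 (twistObj F Z)) x
  rw [valL, LinearMap.comp_apply, val_untwist, rTensor_val_act, twistedComul_trivialCocycle,
    actL_mul, e2, rTensor_val_map_untwist]
  rfl

lemma valR_twistTensor (X Y Z : TwMod (trivialCocycle k H)) (x) :
    valR X Y Z (untwist F X (tensObj Y Z)
      (klin (tensHom (𝟙 (twistObj F X)) (twistTensor F Y Z).hom) x)) =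
      actR X Y Z ((comul (R := k) (A := H)).lTensor H F.F * ((1 : H) ⊗ₜ F.F))
        (twistValR F X Y Z x) := by
  have e2 : twistVal F X (tensObj Y Z)
      (klin (tensHom (𝟙 (twistObj F X)) (twistTensor F Y Z).hom) x) =
      TensorProduct.map LinearMap.id (untwist F Y Z)
        (val (twistObj F X) (tensObj (twistObj F Y) (twistObj F Z)) x) :=
    val_tensHom (𝟙 (twistObj F X)) (twistTensor F Y Z).hom x
  rw [valR, LinearMap.comp_apply, val_untwist, lTensor_val_act, twistedComul_trivialCocycle,
    actR_mul, e2, lTensor_val_map_untwist]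
  rfl

/-- After inclusion in the triple tensor product over `k`, this is the cocycle equation for `F`. -/
lemma untwist_associativity (X Y Z : TwMod (trivialCocycle k H)) (x) :
    assocHom X Y Z (untwist F (tensObj X Y) Z
      (klin (tensHom (twistTensor F X Y).hom (𝟙 (twistObj F Z))) x)) =
    untwist F X (tensObj Y Z) (klin (tensHom (𝟙 (twistObj F X)) (twistTensor F Y Z).hom)
      (assocHom (twistObj F X) (twistObj F Y) (twistObj F Z) x)) := by
  apply valR_injective
  have h1 : twistValR F X Y Z (assocHom (twistObj F X) (twistObj F Y) (twistObj F Z) x) =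
      TensorProduct.assoc k X.carrier Y.carrier Z.carrier (twistValL F X Y Z x) :=
    valR_assocHom (twistObj F X) (twistObj F Y) (twistObj F Z) x
  rw [valR_assocHom, valL_twistTensor, valR_twistTensor, h1, assoc_actL, F.cocycle]

lemma twistTensor_associativity (X Y Z : TwMod (trivialCocycle k H)) :
    tensHom (twistTensor F X Y).hom (𝟙 (twistObj F Z)) ≫ (twistTensor F (tensObj X Y) Z).hom ≫
        (twist F).map (assocIso X Y Z).hom =
      (assocIso (twistObj F X) (twistObj F Y) (twistObj F Z)).hom ≫
        tensHom (𝟙 (twistObj F X)) (twistTensor F Y Z).hom ≫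
          (twistTensor F X (tensObj Y Z)).hom :=
  hom_ext (LinearMap.ext fun x => untwist_associativity F X Y Z x)

/-- From `(ε ⊗ id)F = 1` it follows that `(ε_t ⊗ id)F = Δ(1)`, and the legs of `Δ(1)` multiply to
`1`. -/
lemma unitL_F : WeakUnitCocycle.unitL F.F = 1 := by
  have h1 : ∀ x : H ⊗[k] H, WeakUnitCocycle.unitL x =
      LinearMap.mul' k H ((targetMap k H).rTensor H x) := fun _ => rfl
  rw [h1, WeakUnitCocycle.rTensor_targetMap_eq F.one_mul_F, F.counitL_F, mul'_mul_right,
    mul'_comul_one, one_mul]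

lemma unitR_F : WeakUnitCocycle.unitR F.F = 1 := by
  have h1 : ∀ x : H ⊗[k] H, WeakUnitCocycle.unitR x =
      LinearMap.mul' k H ((targetMap k H).rTensor H (flip k H x)) := fun _ => rfl
  rw [h1, WeakUnitCocycle.rTensor_targetMap_flip_F, mul'_comul_one]

lemma unitR_mul_right (x : H ⊗[k] H) (h : H) :
    WeakUnitCocycle.unitR (x * (h ⊗ₜ[k] (1 : H))) = WeakUnitCocycle.unitR x * h := by
  induction x with
  | zero => simp
  | tmul a b => simp [mul_assoc]
  | add x y hx hy => simp only [map_add, add_mul, hx, hy]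

/-- `S⁻¹` is the identity on the base, so the last cocycle condition on `F` reads without it. -/
lemma F_mul_base {z : H} (hz : InBase k z) :
    F.F * (z ⊗ₜ[k] (1 : H)) = F.F * ((1 : H) ⊗ₜ[k] z) := by
  rw [F.F_target z (mem_targetSpace.2 hz), hz.antipode_symm]

/-- An element `z` of the base moves across the legs on the right of `F`, so that `F` applied to `z
⊗ m` acts as `ε_t(F⁽¹⁾)F⁽²⁾z = z` on `m`. Hence the comparison is compatible with the left unit
constraint. -/
lemma mulL_act_F (X : TwMod (trivialCocycle k H))
    (w : (unitObj (trivialCocycle k H)).carrier ⊗[k] X.carrier) :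
    mulL X (act (unitObj (trivialCocycle k H)) X F.F w) = mulL X w := by
  have h1 : ∀ (x : H ⊗[k] H) (z : (unitObj (trivialCocycle k H)).carrier) (m : X.carrier),
      mulL X (act (unitObj (trivialCocycle k H)) X x (z ⊗ₜ m)) =
        WeakUnitCocycle.unitL (x * (unitVal _ z ⊗ₜ (1 : H))) • m := by
    intro x z m
    induction x with
    | zero => simp
    | add x y hx hy => simp only [map_add, add_mul, add_smul, LinearMap.add_apply, hx, hy]
    | tmul a b => simp [mul_smul]
  induction w with
  | zero => simp
  | add x y hx hy => simp only [map_add, hx, hy]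
  | tmul z m => rw [h1, F_mul_base F (inBase_unitVal z), WeakUnitCocycle.unitL_mul_right, unitL_F,
      one_mul, mulL_tmul]

lemma mulR_act_F (X : TwMod (trivialCocycle k H))
    (w : X.carrier ⊗[k] (unitObj (trivialCocycle k H)).carrier) :
    mulR X (act X (unitObj (trivialCocycle k H)) F.F w) = mulR X w := by
  have h1 : ∀ (x : H ⊗[k] H) (z : (unitObj (trivialCocycle k H)).carrier) (m : X.carrier),
      mulR X (act X (unitObj (trivialCocycle k H)) x (m ⊗ₜ z)) =
        WeakUnitCocycle.unitR (x * ((1 : H) ⊗ₜ unitVal _ z)) • m := by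
    intro x z m
    induction x with
    | zero => simp
    | add x y hx hy => simp only [map_add, add_mul, add_smul, LinearMap.add_apply, hx, hy]
    | tmul a b => simp [mul_smul]
  induction w with
  | zero => simp
  | add x y hx hy => simp only [map_add, hx, hy]
  | tmul m z => rw [h1, ← F_mul_base F (inBase_unitVal z), unitR_mul_right, unitR_F,
      one_mul, mulR_tmul]

lemma mulL_untwist (X : TwMod (trivialCocycle k H)) (x) :
    mulL X (val _ X (untwist F (unitObj (trivialCocycle k H)) X x)) =
      mulL X (twistVal F (unitObj (trivialCocycle k H)) X x) := by
  rw [val_untwist, mulL_act_F]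

lemma mulR_untwist (X : TwMod (trivialCocycle k H)) (x) :
    mulR X (val X _ (untwist F X (unitObj (trivialCocycle k H)) x)) =
      mulR X (twistVal F X (unitObj (trivialCocycle k H)) x) := by
  rw [val_untwist, mulR_act_F]

lemma twistTensor_left_unitality (X : TwMod (trivialCocycle k H)) :
    (leftIso (twistObj F X)).hom =
      (twistTensor F (unitObj (trivialCocycle k H)) X).hom ≫ (twist F).map (leftIso X).hom :=
  hom_ext (LinearMap.ext fun x => (mulL_untwist F X x).symm)

lemma twistTensor_right_unitality (X : TwMod (trivialCocycle k H)) :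
    (rightIso (twistObj F X)).hom =
      (twistTensor F X (unitObj (trivialCocycle k H))).hom ≫ (twist F).map (rightIso X).hom :=
  hom_ext (LinearMap.ext fun x => (mulR_untwist F X x).symm)

/-- The unit isomorphism and the tensor isomorphisms of the twisting functor. -/
def twistCore : (twist F).CoreMonoidal where
  -- The unit object is `H_t` with the same action for every cocycle.
  εIso := Iso.refl (unitObj F)
  μIso M N := twistTensor F M N
  μIso_hom_natural_left f N := twistTensor_naturality F f (𝟙 N)
  μIso_hom_natural_right N f := twistTensor_naturality F (𝟙 N) f
  associativity X Y Z := twistTensor_associativity F X Y Z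
  left_unitality X := by
    refine (twistTensor_left_unitality F X).trans ?_
    -- The unit comparison is the identity, so the coherence law contains only an additional factor
    -- `id ⊗ id`.
    exact (Category.id_comp _).symm.trans (congrArg (· ≫ _) (tensHom_id _ _).symm)
  right_unitality X := by
    refine (twistTensor_right_unitality F X).trans ?_
    exact (Category.id_comp _).symm.trans (congrArg (· ≫ _) (tensHom_id _ _).symm)

/-- The braiding of `_H M_F` is flip conjugated by `F`. Its last factor `F⁻¹` cancels against the
comparison up to `Δ(1)`, which the untwisted braiding contains as well. -/
lemma untwist_braid (X Y : TwMod (trivialCocycle k H)) (x) :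
    klin (braidHom X Y) (untwist F X Y x) =
      untwist F Y X (klin (braidHom (twistObj F X) (twistObj F Y)) x) := by
  apply val_injective
  have h1 : twistVal F Y X (klin (braidHom (twistObj F X) (twistObj F Y)) x) =
      act Y X F.Finv (TensorProduct.comm k X.carrier Y.carrier
        (act X Y F.F (twistVal F X Y x))) := val_braidHom (twistObj F X) (twistObj F Y) x
  have h2 := tprod_comm X.rep Y.rep (comul 1) (act X Y F.F (twistVal F X Y x))
  have h3 : Algebra.TensorProduct.comm k H H (comul 1) = comul (R := k) (1 : H) := flip_comul 1
  rw [h3] at h2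
  change _ = act Y X (comul 1) _ at h2
  rw [val_braidHom, val_untwist, val_untwist, h1, ← act_mul Y X, F.F_mul_Finv,
    trivialCocycle_F, trivialCocycle_Finv, ← act_mul X Y, F.one_mul_F]

/-- The twisting functor is braided monoidal. -/
instance twistBraided : (twist F).Braided where
  toMonoidal := (twistCore F).toMonoidal
  braided X Y := hom_ext (LinearMap.ext fun x => untwist_braid F X Y x)

end TwMod
end Untwisted

/-! ### The braiding and the middle exchange in the untwisted category -/

section UntwistedBraiding

open CategoryTheory MonoidalCategory

variable {k : Type v} {H : Type u} [Field k] [Ring H] [Algebra k H] [Coalgebra k H]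
  [QuantumGroupoid k H] [IsCocomm k H]

namespace TwMod

/-- `Δ(1)` is symmetric, so it commutes with the flip, and it acts as the identity on `X ⊗_t Y`.
What remains of the braiding is the flip. -/
lemma val_braidHom_trivialCocycle (X Y : TwMod (trivialCocycle k H)) (x) :
    val Y X (klin (braidHom X Y) x) = TensorProduct.comm k X.carrier Y.carrier (val X Y x) := by
  have h2 := tprod_comm X.rep Y.rep (comul 1) (val X Y x)
  have h3 : Algebra.TensorProduct.comm k H H (comul 1) = comul (R := k) (1 : H) := flip_comul 1
  rw [h3] at h2
  change _ = act Y X (comul 1) _ at h2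
  rw [val_braidHom, trivialCocycle_F, trivialCocycle_Finv, act_one_val, ← h2]
  exact congrArg _ (act_one_val X Y x)

/-- The exchange of the first two factors of a triple tensor product bracketed to the right. -/
def leftCommHom (X Y Z : TwMod (trivialCocycle k H)) :
    tensObj X (tensObj Y Z) ⟶ tensObj Y (tensObj X Z) :=
  (assocIso X Y Z).inv ≫ tensHom (braidHom X Y) (𝟙 Z) ≫ (assocIso Y X Z).hom

lemma valR_leftCommHom (X Y Z : TwMod (trivialCocycle k H)) (x) :
    valR Y X Z (klin (leftCommHom X Y Z) x) =
      TensorProduct.leftComm k X.carrier Y.carrier Z.carrier (valR X Y Z x) := by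
  have h1 : ∀ w : (tensObj X Y).carrier ⊗[k] Z.carrier,
      (val Y X).rTensor Z.carrier (TensorProduct.map (klin (braidHom X Y)) (klin (𝟙 Z)) w) =
      (TensorProduct.comm k X.carrier Y.carrier).toLinearMap.rTensor Z.carrier
        ((val X Y).rTensor Z.carrier w) := by
    intro w
    induction w with
    | zero => simp
    | add x y hx hy => simp only [map_add, hx, hy]
    | tmul a b => simp [val_braidHom_trivialCocycle]
  have h2 : ∀ w : X.carrier ⊗[k] (Y.carrier ⊗[k] Z.carrier),
      TensorProduct.assoc k Y.carrier X.carrier Z.carrier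
        ((TensorProduct.comm k X.carrier Y.carrier).toLinearMap.rTensor Z.carrier
          ((TensorProduct.assoc k X.carrier Y.carrier Z.carrier).symm w)) =
      TensorProduct.leftComm k X.carrier Y.carrier Z.carrier w := by
    intro w
    induction w with
    | zero => simp
    | add x y hx hy => simp only [map_add, hx, hy]
    | tmul a b =>
      induction b with
      | zero => simp
      | add x y hx hy => simp only [map_add, TensorProduct.tmul_add, hx, hy]
      | tmul c d => simp
  have h3 := valL_assocInv X Y Z x
  rw [leftCommHom, klin_comp, klin_comp, LinearMap.comp_apply, LinearMap.comp_apply,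
    klin_assocIso, klin_assocIso_inv, valR_assocHom]
  rw [valL, LinearMap.comp_apply] at h3 ⊢
  rw [val_tensHom, h1, h3, h2]

/-- The inclusion of `(X ⊗_t Y) ⊗_t (Z ⊗_t W)` in `(X ⊗ Y) ⊗ (Z ⊗ W)`. -/
def valLR (X Y Z W : TwMod (trivialCocycle k H)) :
    (tensObj (tensObj X Y) (tensObj Z W)).carrier →ₗ[k]
      (X.carrier ⊗[k] Y.carrier) ⊗[k] (Z.carrier ⊗[k] W.carrier) :=
  TensorProduct.map (val X Y) (val Z W) ∘ₗ val (tensObj X Y) (tensObj Z W)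

/-- The inclusion of `X ⊗_t (Y ⊗_t (Z ⊗_t W))` in `X ⊗ (Y ⊗ (Z ⊗ W))`. -/
def valRR (X Y Z W : TwMod (trivialCocycle k H)) :
    (tensObj X (tensObj Y (tensObj Z W))).carrier →ₗ[k]
      X.carrier ⊗[k] (Y.carrier ⊗[k] (Z.carrier ⊗[k] W.carrier)) :=
  (valR Y Z W).lTensor X.carrier ∘ₗ val X (tensObj Y (tensObj Z W))

lemma valRR_assocHom (X Y Z W : TwMod (trivialCocycle k H)) (x) :
    valRR X Y Z W (assocHom X Y (tensObj Z W) x) =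
      TensorProduct.assoc k X.carrier Y.carrier (Z.carrier ⊗[k] W.carrier) (valLR X Y Z W x) := by
  have h1 := valR_assocHom X Y (tensObj Z W) x
  have h2 : ∀ w : X.carrier ⊗[k] (tensObj Y (tensObj Z W)).carrier,
      (valR Y Z W).lTensor X.carrier w = ((val Z W).lTensor Y.carrier).lTensor X.carrier
        ((val Y (tensObj Z W)).lTensor X.carrier w) := fun w => by
    rw [← LinearMap.lTensor_comp_apply]
    rfl
  have h3 : ∀ w : (tensObj X Y).carrier ⊗[k] (tensObj Z W).carrier,
      ((val Z W).lTensor Y.carrier).lTensor X.carrier (TensorProduct.assoc k _ _ _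
        ((val X Y).rTensor _ w)) =
      TensorProduct.assoc k _ _ _ (TensorProduct.map (val X Y) (val Z W) w) := by
    intro w
    induction w with
    | zero => simp
    | add x y hx hy => simp only [map_add, hx, hy]
    | tmul a b =>
      simp only [LinearMap.rTensor_tmul, TensorProduct.map_tmul]
      generalize val X Y a = c
      induction c with
      | zero => simp
      | add x y hx hy => simp only [map_add, TensorProduct.add_tmul, hx, hy]
      | tmul c d => simp
  rw [valR, LinearMap.comp_apply] at h1
  rw [valRR, LinearMap.comp_apply, h2, h1, valL, LinearMap.comp_apply, h3]
  rfl

lemma valRR_tensHom_leftCommHom (X Y Z W : TwMod (trivialCocycle k H)) (x) :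
    valRR X Z Y W (klin (tensHom (𝟙 X) (leftCommHom Y Z W)) x) =
      (TensorProduct.leftComm k Y.carrier Z.carrier W.carrier).toLinearMap.lTensor X.carrier
        (valRR X Y Z W x) := by
  rw [valRR, valRR, LinearMap.comp_apply, LinearMap.comp_apply, val_tensHom]
  generalize val X _ x = w
  induction w with
  | zero => simp
  | add x y hx hy => simp only [map_add, hx, hy]
  | tmul a b => simp [valR_leftCommHom]

/-- Only the middle part of `tensorμ` involves the braiding. Collecting it into one exchange of
neighbours leaves two associators, all of which are restrictions of maps of vector spaces. -/
lemma tensorμ_eq (X Y Z W : TwMod (trivialCocycle k H)) :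
    tensorμ X Y Z W = (assocIso X Y (tensObj Z W)).hom ≫ tensHom (𝟙 X) (leftCommHom Y Z W) ≫
      (assocIso X Z (tensObj Y W)).inv := by
  change _ = (α_ X Y (Z ⊗ W)).hom ≫
    X ◁ ((α_ Y Z W).inv ≫ (β_ Y Z).hom ▷ W ≫ (α_ Z Y W).hom) ≫ (α_ X Z (Y ⊗ W)).inv
  simp only [tensorμ, MonoidalCategory.whiskerLeft_comp, Category.assoc]

/-- The tensor product of algebras in the untwisted category thereby has the usual componentwise
product, which is what the comparison with `Δ(ab) = Δ(a)Δ(b)` requires. -/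
lemma valLR_tensorμ (X Y Z W : TwMod (trivialCocycle k H))
    (x : (tensObj (tensObj X Y) (tensObj Z W)).carrier) :
    valLR X Z Y W (klin (tensorμ X Y Z W) x) =
      TensorProduct.tensorTensorTensorComm k X.carrier Y.carrier Z.carrier W.carrier
        (valLR X Y Z W x) := by
  have h1 : ∀ w : (X.carrier ⊗[k] Y.carrier) ⊗[k] (Z.carrier ⊗[k] W.carrier),
      (TensorProduct.leftComm k Y.carrier Z.carrier W.carrier).toLinearMap.lTensor X.carrier
        (TensorProduct.assoc k _ _ _ w) = TensorProduct.assoc k _ _ _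
          (TensorProduct.tensorTensorTensorComm k X.carrier Y.carrier Z.carrier W.carrier w) := by
    intro w
    induction w with
    | zero => simp
    | add x y hx hy => simp only [map_add, hx, hy]
    | tmul a b =>
      induction a with
      | zero => simp
      | add x y hx hy => simp only [map_add, TensorProduct.add_tmul, hx, hy]
      | tmul p q =>
        induction b with
        | zero => simp
        | add x y hx hy => simp only [map_add, TensorProduct.tmul_add, hx, hy]
        | tmul r s => simp
  have h2 : ∀ y, assocHom X Z (tensObj Y W) (klin (assocIso X Z (tensObj Y W)).inv y) = y :=
    fun y => congrArg (fun f => klin f y) (assocIso X Z (tensObj Y W)).inv_hom_id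
  rw [tensorμ_eq]
  -- Applying the associator to both sides cancels the inverse associator at the end of `tensorμ`.
  apply (TensorProduct.assoc k X.carrier Z.carrier (Y.carrier ⊗[k] W.carrier)).injective
  rw [← valRR_assocHom, ← h1, ← valRR_assocHom, ← valRR_tensHom_leftCommHom]
  exact congrArg _ (h2 _)

end TwMod
end UntwistedBraiding

/-! ### Hopf objects under a braided monoidal functor -/

section HopfTransport

open CategoryTheory MonoidalCategory MonObj ComonObj

variable {C D : Type*} [Category C] [Category D] [MonoidalCategory C] [MonoidalCategory D]
  [BraidedCategory C] [BraidedCategory D] (Φ : C ⥤ D) [Φ.Braided] (X : C)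

/-- The comparison `μ` is invertible with inverse `δ`, so it may be composed to both sides. Its
compatibility with the braiding then carries `tensorμ` inside `Φ`, where the identity is the image
of the bimonoid law of `X`. -/
lemma map_mul_comul [BimonObj X] :
    (Functor.LaxMonoidal.μ Φ X X ≫ Φ.map μ[X]) ≫ Φ.map Δ[X] ≫ Functor.OplaxMonoidal.δ Φ X X =
      ((Φ.map Δ[X] ≫ Functor.OplaxMonoidal.δ Φ X X) ⊗ₘ
        (Φ.map Δ[X] ≫ Functor.OplaxMonoidal.δ Φ X X)) ≫
      tensorμ (Φ.obj X) (Φ.obj X) (Φ.obj X) (Φ.obj X) ≫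
      ((Functor.LaxMonoidal.μ Φ X X ≫ Φ.map μ[X]) ⊗ₘ
        (Functor.LaxMonoidal.μ Φ X X ≫ Φ.map μ[X])) := by
  rw [← cancel_mono (Functor.LaxMonoidal.μ Φ X X)]
  simp only [Category.assoc, Functor.Monoidal.δ_μ, Category.comp_id]
  rw [← Φ.map_comp, BimonObj.mul_comul, ← tensorHom_comp_tensorHom, Category.assoc,
    ← tensorHom_comp_tensorHom, Category.assoc, Functor.LaxMonoidal.μ_natural,
    tensorμ_comp_μ_tensorHom_μ_comp_μ_assoc, tensorHom_comp_tensorHom_assoc (Functor.OplaxMonoidal.δ Φ X X),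
    Functor.Monoidal.δ_μ, id_tensorHom_id, Category.id_comp,
    Functor.LaxMonoidal.μ_natural_assoc, ← Φ.map_comp, ← Φ.map_comp]

lemma map_one_comul [BimonObj X] :
    (Functor.LaxMonoidal.ε Φ ≫ Φ.map η[X]) ≫ Φ.map Δ[X] ≫ Functor.OplaxMonoidal.δ Φ X X =
      (λ_ (𝟙_ D)).inv ≫ ((Functor.LaxMonoidal.ε Φ ≫ Φ.map η[X]) ⊗ₘ
        (Functor.LaxMonoidal.ε Φ ≫ Φ.map η[X])) := by
  rw [← cancel_mono (Functor.LaxMonoidal.μ Φ X X)]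
  simp only [Category.assoc, Functor.Monoidal.δ_μ, Category.comp_id]
  rw [← Φ.map_comp, Bimon.one_comul, ← tensorHom_comp_tensorHom, Category.assoc,
    Functor.LaxMonoidal.μ_natural, Φ.map_comp, Functor.LaxMonoidal.ε_tensorHom_comp_μ_assoc,
    leftUnitor_naturality_assoc, Iso.inv_hom_id_assoc]

lemma map_mul_counit [BimonObj X] :
    (Functor.LaxMonoidal.μ Φ X X ≫ Φ.map μ[X]) ≫ Φ.map ε[X] ≫ Functor.OplaxMonoidal.η Φ =
      ((Φ.map ε[X] ≫ Functor.OplaxMonoidal.η Φ) ⊗ₘ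
        (Φ.map ε[X] ≫ Functor.OplaxMonoidal.η Φ)) ≫ (λ_ (𝟙_ D)).hom := by
  -- Here the comparison stands at the source, so it is cancelled on that side by its inverse `δ`.
  rw [← cancel_epi (Functor.OplaxMonoidal.δ Φ X X)]
  simp only [Category.assoc, Functor.Monoidal.δ_μ_assoc]
  rw [← Φ.map_comp_assoc, Bimon.mul_counit, ← tensorHom_comp_tensorHom, Category.assoc,
    Functor.OplaxMonoidal.δ_natural_assoc, Φ.map_comp, Category.assoc,
    Functor.OplaxMonoidal.δ_comp_η_tensorHom_assoc, ← leftUnitor_inv_naturality_assoc,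
    Iso.inv_hom_id, Category.comp_id]

lemma map_one_counit [BimonObj X] :
    (Functor.LaxMonoidal.ε Φ ≫ Φ.map η[X]) ≫ Φ.map ε[X] ≫ Functor.OplaxMonoidal.η Φ =
      𝟙 (𝟙_ D) := by
  rw [Category.assoc, ← Φ.map_comp_assoc, BimonObj.one_counit, Φ.map_id, Category.id_comp,
    Functor.Monoidal.ε_η]

/-- Naturality of `μ` moves the antipode inside `Φ`, `δ` and `μ` cancel, and the antipode law of `X`
remains. -/
lemma map_antipode_left [HopfObj X] :
    (Φ.map Δ[X] ≫ Functor.OplaxMonoidal.δ Φ X X) ≫ Φ.map (HopfObj.antipode (X := X)) ▷ Φ.obj X ≫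
        Functor.LaxMonoidal.μ Φ X X ≫ Φ.map μ[X] =
      (Φ.map ε[X] ≫ Functor.OplaxMonoidal.η Φ) ≫ Functor.LaxMonoidal.ε Φ ≫ Φ.map η[X] := by
  rw [Functor.LaxMonoidal.μ_natural_left_assoc, Category.assoc, Functor.Monoidal.δ_μ_assoc,
    ← Φ.map_comp, ← Φ.map_comp, HopfObj.antipode_left, Category.assoc,
    Functor.Monoidal.η_ε_assoc, Φ.map_comp]

lemma map_antipode_right [HopfObj X] :
    (Φ.map Δ[X] ≫ Functor.OplaxMonoidal.δ Φ X X) ≫ Φ.obj X ◁ Φ.map (HopfObj.antipode (X := X)) ≫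
        Functor.LaxMonoidal.μ Φ X X ≫ Φ.map μ[X] =
      (Φ.map ε[X] ≫ Functor.OplaxMonoidal.η Φ) ≫ Functor.LaxMonoidal.ε Φ ≫ Φ.map η[X] := by
  rw [Functor.LaxMonoidal.μ_natural_right_assoc, Category.assoc, Functor.Monoidal.δ_μ_assoc,
    ← Φ.map_comp, ← Φ.map_comp, HopfObj.antipode_right, Category.assoc,
    Functor.Monoidal.η_ε_assoc, Φ.map_comp]

/-- The image of a Hopf object under a braided monoidal functor. -/
abbrev hopfObjObj [HopfObj X] : HopfObj (Φ.obj X) where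
  toMonObj := Functor.monObjObj (F := Φ) X
  toComonObj := Functor.obj.instComonObj X Φ
  mul_comul := map_mul_comul Φ X
  one_comul := map_one_comul Φ X
  mul_counit := map_mul_counit Φ X
  one_counit := map_one_counit Φ X
  antipode := Φ.map HopfObj.antipode
  antipode_left := map_antipode_left Φ X
  antipode_right := map_antipode_right Φ X

end HopfTransport

/-! ### The Hopf algebra `C_H(H_s)` in the untwisted category -/

section Centralizer

open CategoryTheory MonoidalCategory

variable {k : Type v} {H : Type u} [Field k] [Ring H] [Algebra k H] [Coalgebra k H]
  [QuantumGroupoid k H] [IsCocomm k H]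

namespace TwMod

section General

variable (F : WeakUnitCocycle k H)

lemma centralizerVal_injective : Function.Injective (centralizerVal F) := Subtype.val_injective

lemma centralizerVal_mem (a : (centralizerObj F).carrier) :
    centralizerVal F a ∈ sourceCentralizer k H := a.2

@[simp] lemma centralizerVal_smul (h : H) (a : (centralizerObj F).carrier) :
    centralizerVal F (h • a) = Ad (k := k) h (centralizerVal F a) := rfl

/-- A linear map with values in the centralizer, as a map to the object `C_H(H_s)`. -/
def toCentralizer {M : Type u} [AddCommGroup M] [Module k M] (f : M →ₗ[k] H)
    (hf : ∀ m, f m ∈ sourceCentralizer k H) : M →ₗ[k] (centralizerObj F).carrier :=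
  f.codRestrict (Subalgebra.toSubmodule (sourceCentralizer k H)) hf

@[simp] lemma centralizerVal_toCentralizer {M : Type u} [AddCommGroup M] [Module k M]
    (f : M →ₗ[k] H) (hf : ∀ m, f m ∈ sourceCentralizer k H) (m : M) :
    centralizerVal F (toCentralizer F f hf m) = f m := rfl

/-- The inclusion of the tensor square of `C_H(H_s)` in `H ⊗ H`. -/
def centralizerVal₂ : (centralizerObj F).carrier ⊗[k] (centralizerObj F).carrier →ₗ[k] H ⊗[k] H :=
  TensorProduct.map (centralizerVal F) (centralizerVal F)

@[simp] lemma centralizerVal₂_tmul (a b : (centralizerObj F).carrier) :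
    centralizerVal₂ F (a ⊗ₜ b) = centralizerVal F a ⊗ₜ centralizerVal F b := rfl

/-- Modules over a field are flat. Identities in tensor powers of the centralizer can therefore be
checked in those of `H`. -/
lemma map_injective_of_injective {M N M' N' : Type u} [AddCommGroup M] [Module k M]
    [AddCommGroup N] [Module k N] [AddCommGroup M'] [Module k M'] [AddCommGroup N'] [Module k N']
    {f : M →ₗ[k] M'} {g : N →ₗ[k] N'} (hf : Function.Injective f) (hg : Function.Injective g) :
    Function.Injective (TensorProduct.map f g) := by
  rw [← LinearMap.rTensor_comp_lTensor]
  exact (Module.Flat.rTensor_preserves_injective_linearMap _ hf).comp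
    (Module.Flat.lTensor_preserves_injective_linearMap _ hg)

lemma centralizerVal₂_injective : Function.Injective (centralizerVal₂ F) :=
  map_injective_of_injective (centralizerVal_injective F) (centralizerVal_injective F)

lemma centralizerVal₂_act (u : H ⊗[k] H) (w) :
    centralizerVal₂ F (act (centralizerObj F) (centralizerObj F) u w) =
      Ad₂ u (centralizerVal₂ F w) := by
  induction u with
  | zero => simp
  | add x y hx hy => simp only [map_add, LinearMap.add_apply, hx, hy]
  | tmul a b =>
    induction w with
    | zero => simp
    | add x y hx hy => simp only [map_add, hx, hy]
    | tmul m n => simp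

lemma mul'_centralizerVal₂_mem (w) :
    LinearMap.mul' k H (centralizerVal₂ F w) ∈ sourceCentralizer k H := by
  induction w with
  | zero => simp
  | add x y hx hy => simpa only [map_add] using add_mem hx hy
  | tmul a b => exact mul_mem (centralizerVal_mem F a) (centralizerVal_mem F b)

lemma mul'_Ad₂_comul_centralizerVal₂ (h : H) (w) :
    LinearMap.mul' k H (Ad₂ (comul (R := k) h) (centralizerVal₂ F w)) =
      Ad (k := k) h (LinearMap.mul' k H (centralizerVal₂ F w)) := by
  induction w with
  | zero => simp
  | add x y hx hy => simp only [map_add, hx, hy]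
  | tmul a b => simpa using mul'_Ad₂_comul h (centralizerVal_mem F a) (centralizerVal F b)

/-- The map `h ⊗ h' ↦ Ad_1(h) ⊗ Ad_1(h')`, with values in the tensor square of `C_H(H_s)`. -/
def toCentralizer₂ : H ⊗[k] H →ₗ[k] (centralizerObj F).carrier ⊗[k] (centralizerObj F).carrier :=
  TensorProduct.map (toCentralizer F (Ad (k := k) 1) (Ad_mem 1))
    (toCentralizer F (Ad (k := k) 1) (Ad_mem 1))

lemma centralizerVal₂_toCentralizer₂ (w : H ⊗[k] H) :
    centralizerVal₂ F (toCentralizer₂ F w) = Ad₂ ((1 : H) ⊗ₜ[k] (1 : H)) w := by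
  induction w with
  | zero => simp
  | add x y hx hy => simp only [map_add, hx, hy]
  | tmul a b => simp [toCentralizer₂]

end General

variable (k H)

/-- The object `C_H(H_s)` of the untwisted category. -/
abbrev centObj : TwMod (trivialCocycle k H) := centralizerObj (trivialCocycle k H)

/-- The inclusion of `C_H(H_s)` in `H`. -/
abbrev centVal : (centObj k H).carrier →ₗ[k] H := centralizerVal (trivialCocycle k H)

/-- The inclusion of the tensor square of `C_H(H_s)` in `H ⊗ H`. -/
abbrev centVal₂ : (centObj k H).carrier ⊗[k] (centObj k H).carrier →ₗ[k] H ⊗[k] H :=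
  centralizerVal₂ (trivialCocycle k H)

/-- The product of `C_H(H_s)`. -/
def centMul : tensObj (centObj k H) (centObj k H) ⟶ centObj k H :=
  homMk (toCentralizer _ (LinearMap.mul' k H ∘ₗ centVal₂ k H ∘ₗ val _ _)
    (fun x => mul'_centralizerVal₂_mem _ (val _ _ x)))
    (fun h x => centralizerVal_injective _ (by
      simp only [centralizerVal_toCentralizer, centralizerVal_smul, LinearMap.comp_apply, val_smul,
        centralizerVal₂_act, twistedComul_trivialCocycle, mul'_Ad₂_comul_centralizerVal₂]))

lemma centVal_centMul (x) : centVal k H (klin (centMul k H) x) =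
    LinearMap.mul' k H (centVal₂ k H (val _ _ x)) := rfl

/-- The unit of `C_H(H_s)`. -/
def centOne : unitObj (trivialCocycle k H) ⟶ centObj k H :=
  homMk (toCentralizer _ (unitVal _) (fun z => (inBase_unitVal z).mem_sourceCentralizer))
    (fun h z => centralizerVal_injective _ (by
      simp only [centralizerVal_toCentralizer, centralizerVal_smul, unitVal_smul]
      exact (Ad_base h (inBase_unitVal z)).symm))

@[simp] lemma centVal_centOne (z) : centVal k H (klin (centOne k H) z) = unitVal _ z := rfl

/-- The projection `Ad_1 ⊗ Ad_1` to the tensor square of the centralizer and the projection `Δ(1)`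
to `⊗_t` both fix `Δ(a)`. The coproduct built with them is thus the restriction of `Δ`. -/
lemma centVal₂_proj_toCentralizer₂_comul (a : (centObj k H).carrier) :
    centVal₂ k H (val _ _ (proj _ _ (toCentralizer₂ _ (comul (R := k) (centVal k H a))))) =
      comul (R := k) (centVal k H a) := by
  rw [val_proj, centralizerVal₂_act, centralizerVal₂_toCentralizer₂,
    Ad₂_one_one_comul (centralizerVal_mem _ a), Ad₂_comul_one_comul (centralizerVal_mem _ a)]

/-- The coproduct of `C_H(H_s)`. -/
def centComul : centObj k H ⟶ tensObj (centObj k H) (centObj k H) :=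
  homMk (proj _ _ ∘ₗ toCentralizer₂ _ ∘ₗ comul ∘ₗ centVal k H)
    (fun h a => val_injective _ _ (centralizerVal₂_injective _ (by
      have h1 := centVal₂_proj_toCentralizer₂_comul k H (h • a)
      have h2 := centVal₂_proj_toCentralizer₂_comul k H a
      simp only [LinearMap.comp_apply] at h1 h2 ⊢
      rw [h1, val_smul, centralizerVal₂_act, h2, twistedComul_trivialCocycle,
        centralizerVal_smul, comul_Ad])))

lemma centVal₂_centComul (a) : centVal₂ k H (val _ _ (klin (centComul k H) a)) =
    comul (R := k) (centVal k H a) := centVal₂_proj_toCentralizer₂_comul k H a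

/-- The counit of `C_H(H_s)`. -/
def centCounit : centObj k H ⟶ unitObj (trivialCocycle k H) :=
  homMk (unitProj _ ∘ₗ centVal k H)
    (fun h a => unitVal_injective (by
      simp only [LinearMap.comp_apply, unitVal_proj, unitVal_smul, centralizerVal_smul]
      rw [targetMap_mul_targetMap, targetMap_Ad _ (centralizerVal_mem _ a)]))

@[simp] lemma unitVal_centCounit (a) : unitVal _ (klin (centCounit k H) a) =
    targetMap k H (centVal k H a) := rfl

/-- The antipode of `C_H(H_s)`. -/
def centAntipode : centObj k H ⟶ centObj k H :=
  homMk (toCentralizer _ (S k ∘ₗ centVal k H) (fun a => antipode_mem (centralizerVal_mem _ a)))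
    (fun h a => centralizerVal_injective _ (by
      simp only [LinearMap.comp_apply, centralizerVal_toCentralizer, centralizerVal_smul]
      exact antipode_Ad _ _))

lemma centVal_centAntipode (a) : centVal k H (klin (centAntipode k H) a) =
    S k (centVal k H a) := rfl

variable {k H}

/-- `Ad_z(a) = za` for `z` in the base, so the unit constraint is multiplication in `H`. On the
right, in the next lemma, `za = az` is needed in addition. -/
lemma centVal_mulL (w : (unitObj (trivialCocycle k H)).carrier ⊗[k] (centObj k H).carrier) :
    centVal k H (mulL (centObj k H) w) =
      LinearMap.mul' k H (TensorProduct.map (unitVal _) (centVal k H) w) := by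
  induction w with
  | zero => simp
  | add x y hx hy => simp only [map_add, hx, hy]
  | tmul z a => simp [base_Ad (inBase_unitVal z) (centralizerVal_mem _ a)]

lemma centVal_mulR (w : (centObj k H).carrier ⊗[k] (unitObj (trivialCocycle k H)).carrier) :
    centVal k H (mulR (centObj k H) w) =
      LinearMap.mul' k H (TensorProduct.map (centVal k H) (unitVal _) w) := by
  induction w with
  | zero => simp
  | add x y hx hy => simp only [map_add, hx, hy]
  | tmul a z =>
    have := mem_sourceCentralizer.1 (centralizerVal_mem _ a) _ (inBase_unitVal z)
    simp [base_Ad (inBase_unitVal z) (centralizerVal_mem _ a), this]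

lemma centOne_centMul : tensHom (centOne k H) (𝟙 (centObj k H)) ≫ centMul k H =
    (leftIso (centObj k H)).hom :=
  hom_ext (LinearMap.ext fun x => centralizerVal_injective _ (by
    rw [klin_comp, LinearMap.comp_apply, centVal_centMul, val_tensHom, klin_leftIso,
      LinearMap.comp_apply, centVal_mulL]
    generalize val _ _ x = w
    induction w with
    | zero => simp
    | add x y hx hy => simp only [map_add, hx, hy]
    | tmul a b => simp))

lemma centMul_centOne : tensHom (𝟙 (centObj k H)) (centOne k H) ≫ centMul k H =
    (rightIso (centObj k H)).hom :=
  hom_ext (LinearMap.ext fun x => centralizerVal_injective _ (by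
    rw [klin_comp, LinearMap.comp_apply, centVal_centMul, val_tensHom, klin_rightIso,
      LinearMap.comp_apply, centVal_mulR]
    generalize val _ _ x = w
    induction w with
    | zero => simp
    | add x y hx hy => simp only [map_add, hx, hy]
    | tmul a b => simp))

lemma centMul_assoc : tensHom (centMul k H) (𝟙 (centObj k H)) ≫ centMul k H =
    (assocIso (centObj k H) (centObj k H) (centObj k H)).hom ≫
      tensHom (𝟙 (centObj k H)) (centMul k H) ≫ centMul k H :=
  hom_ext (LinearMap.ext fun x => centralizerVal_injective _ (by
    -- Both iterated products are expressed through multiplication in `H` on triple tensors over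
    -- `k`, where the associator is that of vector spaces and associativity of `H` applies.
    have h1 : ∀ w : (tensObj (centObj k H) (centObj k H)).carrier ⊗[k] (centObj k H).carrier,
        LinearMap.mul' k H (centVal₂ k H (TensorProduct.map (klin (centMul k H))
          (klin (𝟙 (centObj k H))) w)) =
        LinearMap.mul' k H (TensorProduct.map (LinearMap.mul' k H ∘ₗ centVal₂ k H) (centVal k H)
          ((val _ _).rTensor _ w)) := by
      intro w
      induction w with
      | zero => simp
      | add x y hx hy => simp only [map_add, hx, hy]
      | tmul a b => simp [centVal_centMul]
    have h2 : ∀ w : (centObj k H).carrier ⊗[k] (tensObj (centObj k H) (centObj k H)).carrier,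
        LinearMap.mul' k H (centVal₂ k H (TensorProduct.map (klin (𝟙 (centObj k H)))
          (klin (centMul k H)) w)) =
        LinearMap.mul' k H (TensorProduct.map (centVal k H) (LinearMap.mul' k H ∘ₗ centVal₂ k H)
          ((val _ _).lTensor _ w)) := by
      intro w
      induction w with
      | zero => simp
      | add x y hx hy => simp only [map_add, hx, hy]
      | tmul a b => simp [centVal_centMul]
    have h3 : ∀ w : ((centObj k H).carrier ⊗[k] (centObj k H).carrier) ⊗[k] (centObj k H).carrier,
        LinearMap.mul' k H (TensorProduct.map (LinearMap.mul' k H ∘ₗ centVal₂ k H) (centVal k H)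
          w) =
        LinearMap.mul' k H (TensorProduct.map (centVal k H) (LinearMap.mul' k H ∘ₗ centVal₂ k H)
          (TensorProduct.assoc k _ _ _ w)) := by
      intro w
      induction w with
      | zero => simp
      | add x y hx hy => simp only [map_add, hx, hy]
      | tmul a b =>
        induction a with
        | zero => simp
        | add x y hx hy => simp only [map_add, TensorProduct.add_tmul, hx, hy]
        | tmul c d => simp [mul_assoc]
    have h4 := valR_assocHom _ _ _ x
    rw [valL, valR, LinearMap.comp_apply, LinearMap.comp_apply] at h4
    simp only [klin_comp, LinearMap.comp_apply]
    rw [centVal_centMul, centVal_centMul, val_tensHom, val_tensHom, h1, h2, h3, klin_assocIso, h4]))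

/-- In `H` this says `ε_t(a₁)a₂ = a`. -/
lemma centComul_centCounit_left : centComul k H ≫ tensHom (centCounit k H) (𝟙 (centObj k H)) ≫
    (leftIso (centObj k H)).hom = 𝟙 (centObj k H) :=
  hom_ext (LinearMap.ext fun x => centralizerVal_injective _ (by
    have h1 : ∀ w : (centObj k H).carrier ⊗[k] (centObj k H).carrier,
        LinearMap.mul' k H (TensorProduct.map (unitVal _) (centVal k H)
          (TensorProduct.map (klin (centCounit k H)) (klin (𝟙 (centObj k H))) w)) =
        LinearMap.mul' k H ((targetMap k H).rTensor H (centVal₂ k H w)) := by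
      intro w
      induction w with
      | zero => simp
      | add x y hx hy => simp only [map_add, hx, hy]
      | tmul a b => simp
    simp only [klin_comp, LinearMap.comp_apply, klin_leftIso]
    rw [centVal_mulL, val_tensHom, h1, centVal₂_centComul, rTensor_targetMap_comul,
      mul'_mul_right, mul'_comul_one, one_mul]
    rfl))

/-- `a₁ε_t(a₂) = ε_t(a₂)a₁` because `a₁` centralizes the base, and cocommutativity reduces this to
the left counit law. -/
lemma centComul_centCounit_right : centComul k H ≫ tensHom (𝟙 (centObj k H)) (centCounit k H) ≫
    (rightIso (centObj k H)).hom = 𝟙 (centObj k H) :=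
  hom_ext (LinearMap.ext fun x => centralizerVal_injective _ (by
    have h1 : ∀ w : (centObj k H).carrier ⊗[k] (centObj k H).carrier,
        LinearMap.mul' k H (TensorProduct.map (centVal k H) (unitVal _)
          (TensorProduct.map (klin (𝟙 (centObj k H))) (klin (centCounit k H)) w)) =
        LinearMap.mul' k H ((targetMap k H).rTensor H (flip k H (centVal₂ k H w))) := by
      intro w
      induction w with
      | zero => simp
      | add x y hx hy => simp only [map_add, hx, hy]
      | tmul a b =>
        have := mem_sourceCentralizer.1 (centralizerVal_mem _ a) _
          (inBase_targetMap (k := k) (centVal k H b))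
        simp [this]
    simp only [klin_comp, LinearMap.comp_apply, klin_rightIso]
    rw [centVal_mulR, val_tensHom, h1, centVal₂_centComul, flip_comul, rTensor_targetMap_comul,
      mul'_mul_right, mul'_comul_one, one_mul]
    rfl))

lemma centComul_coassoc : centComul k H ≫ tensHom (𝟙 (centObj k H)) (centComul k H) =
    centComul k H ≫ tensHom (centComul k H) (𝟙 (centObj k H)) ≫
      (assocIso (centObj k H) (centObj k H) (centObj k H)).hom :=
  hom_ext (LinearMap.ext fun x => valR_injective _ _ _ (map_injective_of_injective
    (centralizerVal_injective _) (centralizerVal₂_injective _) (by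
    have h1 : ∀ w : (centObj k H).carrier ⊗[k] (centObj k H).carrier,
        TensorProduct.map (centVal k H) (centVal₂ k H) ((val _ _).lTensor _
          (TensorProduct.map (klin (𝟙 (centObj k H))) (klin (centComul k H)) w)) =
        (comul (R := k) (A := H)).lTensor H (centVal₂ k H w) := by
      intro w
      induction w with
      | zero => simp
      | add x y hx hy => simp only [map_add, hx, hy]
      | tmul a b => simp [centVal₂_centComul]
    have h2 : ∀ w : (centObj k H).carrier ⊗[k] (centObj k H).carrier,
        TensorProduct.map (centVal₂ k H) (centVal k H) ((val _ _).rTensor _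
          (TensorProduct.map (klin (centComul k H)) (klin (𝟙 (centObj k H))) w)) =
        (comul (R := k) (A := H)).rTensor H (centVal₂ k H w) := by
      intro w
      induction w with
      | zero => simp
      | add x y hx hy => simp only [map_add, hx, hy]
      | tmul a b => simp [centVal₂_centComul]
    have h3 : ∀ w : ((centObj k H).carrier ⊗[k] (centObj k H).carrier) ⊗[k] (centObj k H).carrier,
        TensorProduct.map (centVal k H) (centVal₂ k H) (TensorProduct.assoc k _ _ _ w) =
        TensorProduct.assoc k H H H (TensorProduct.map (centVal₂ k H) (centVal k H) w) := by
      intro w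
      induction w with
      | zero => simp
      | add x y hx hy => simp only [map_add, hx, hy]
      | tmul a b =>
        induction a with
        | zero => simp
        | add x y hx hy => simp only [map_add, TensorProduct.add_tmul, hx, hy]
        | tmul c d => simp
    simp only [klin_comp, LinearMap.comp_apply, klin_assocIso]
    rw [valR_assocHom, h3, valL, valR, LinearMap.comp_apply, LinearMap.comp_apply, val_tensHom,
      val_tensHom, h1, h2, centVal₂_centComul]
    exact (Coalgebra.coassoc_apply _).symm)))

lemma centMul_centComul : centMul k H ≫ centComul k H =
    tensHom (centComul k H) (centComul k H) ≫
      tensorμ (centObj k H) (centObj k H) (centObj k H) (centObj k H) ≫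
        tensHom (centMul k H) (centMul k H) :=
  hom_ext (LinearMap.ext fun x => val_injective _ _ (centralizerVal₂_injective _ (by
    have h1 : ∀ w : (tensObj (centObj k H) (centObj k H)).carrier ⊗[k]
          (tensObj (centObj k H) (centObj k H)).carrier,
        centVal₂ k H (TensorProduct.map (klin (centMul k H)) (klin (centMul k H)) w) =
        TensorProduct.map (LinearMap.mul' k H ∘ₗ centVal₂ k H) (LinearMap.mul' k H ∘ₗ centVal₂ k H)
          (TensorProduct.map (val _ _) (val _ _) w) := by
      intro w
      induction w with
      | zero => simp
      | add x y hx hy => simp only [map_add, hx, hy]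
      | tmul a b => simp [centVal_centMul]
    have h2 : ∀ w : ((centObj k H).carrier ⊗[k] (centObj k H).carrier) ⊗[k]
          ((centObj k H).carrier ⊗[k] (centObj k H).carrier),
        -- Exchanging the middle factors and multiplying in each half is the multiplication of the
        -- algebra `H ⊗ H`.
        TensorProduct.map (LinearMap.mul' k H ∘ₗ centVal₂ k H) (LinearMap.mul' k H ∘ₗ centVal₂ k H)
          (TensorProduct.tensorTensorTensorComm k _ _ _ _ w) =
        LinearMap.mul' k (H ⊗[k] H) (TensorProduct.map (centVal₂ k H) (centVal₂ k H) w) := by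
      intro w
      induction w with
      | zero => simp
      | add x y hx hy => simp only [map_add, hx, hy]
      | tmul a b =>
        induction a with
        | zero => simp
        | add x y hx hy => simp only [map_add, TensorProduct.add_tmul, hx, hy]
        | tmul p q =>
          induction b with
          | zero => simp
          | add x y hx hy => simp only [map_add, TensorProduct.tmul_add, hx, hy]
          | tmul r s => simp
    have h3 : ∀ w : (centObj k H).carrier ⊗[k] (centObj k H).carrier,
        LinearMap.mul' k (H ⊗[k] H) (TensorProduct.map (centVal₂ k H) (centVal₂ k H)
          (TensorProduct.map (val _ _) (val _ _)
            (TensorProduct.map (klin (centComul k H)) (klin (centComul k H)) w))) =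
        comul (R := k) (LinearMap.mul' k H (centVal₂ k H w)) := by
      intro w
      induction w with
      | zero => simp
      | add x y hx hy => simp only [map_add, hx, hy]
      | tmul a b => simp [centVal₂_centComul, comul_mul]
    have h4 := valLR_tensorμ (centObj k H) (centObj k H) (centObj k H) (centObj k H)
      (klin (tensHom (centComul k H) (centComul k H)) x)
    simp only [valLR, LinearMap.comp_apply] at h4
    have h5 : val _ _ (klin (tensHom (centMul k H) (centMul k H)) (klin (tensorμ (centObj k H)
        (centObj k H) (centObj k H) (centObj k H))
        (klin (tensHom (centComul k H) (centComul k H)) x))) = _ := val_tensHom _ _ _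
    refine Eq.trans ?_ (congrArg (centVal₂ k H) h5).symm
    rw [h1]
    refine Eq.trans ?_ (congrArg _ h4).symm
    rw [h2, val_tensHom, h3, klin_comp, LinearMap.comp_apply, centVal₂_centComul,
      centVal_centMul])))

/-- The inverse unit constraint sends `z` to `Δ(1) · (1 ⊗ z)`. With the action of `H` on `H_t` this
is `(ε_t ⊗ ε_t)Δ(z) = Δ(ε_t(z)) = Δ(z)`. -/
lemma centOne_centComul : centOne k H ≫ centComul k H =
    (leftIso (unitObj (trivialCocycle k H))).inv ≫ tensHom (centOne k H) (centOne k H) :=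
  hom_ext (LinearMap.ext fun z => val_injective _ _ (centralizerVal₂_injective _ (by
    have h1 : val _ _ (klin (leftIso (unitObj (trivialCocycle k H))).inv z) =
      act _ _ (comul 1) (unitOne ⊗ₜ z) := rfl
    have h2 : ∀ x : H ⊗[k] H, centVal₂ k H (TensorProduct.map (klin (centOne k H))
        (klin (centOne k H)) (act (unitObj (trivialCocycle k H)) (unitObj (trivialCocycle k H)) x
          (unitOne ⊗ₜ z))) =
        TensorProduct.map (targetMap k H) (targetMap k H)
          (x * ((1 : H) ⊗ₜ unitVal _ z)) := by
      intro x
      induction x with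
      | zero => simp
      | add x y hx hy => simp only [map_add, add_mul, LinearMap.add_apply, hx, hy]
      | tmul a b => simp
    rw [klin_comp, klin_comp, LinearMap.comp_apply, LinearMap.comp_apply, centVal₂_centComul,
      val_tensHom, h1, h2, centVal_centOne, ← (inBase_unitVal z).comul_right',
      map_targetMap_comul, inBase_unitVal z])))

/-- `ε_t(ab) = ε_t(aε_t(b)) = ε_t(ε_t(b)a) = ε_t(b)ε_t(a)`, and the base is commutative. This makes
the counit multiplicative on the centralizer. -/
lemma targetMap_mul_of_mem {a : H} (ha : a ∈ sourceCentralizer k H) (b : H) :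
    targetMap k H (a * b) = targetMap k H a * targetMap k H b := by
  have hb := inBase_targetMap (k := k) b
  rw [← targetMap_mul_targetMap, ← mem_sourceCentralizer.1 ha _ hb, targetMap_base_mul hb,
    (inBase_targetMap a).commute hb]

lemma centMul_centCounit : centMul k H ≫ centCounit k H =
    tensHom (centCounit k H) (centCounit k H) ≫
      (leftIso (unitObj (trivialCocycle k H))).hom :=
  hom_ext (LinearMap.ext fun x => unitVal_injective (by
    rw [klin_comp, klin_comp, LinearMap.comp_apply, LinearMap.comp_apply, unitVal_centCounit,
      centVal_centMul, klin_leftIso, LinearMap.comp_apply, val_tensHom]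
    generalize val _ _ x = w
    induction w with
    | zero => simp
    | add x y hx hy => simp only [map_add, hx, hy]
    | tmul a b =>
      simp only [centralizerVal₂_tmul, LinearMap.mul'_apply, TensorProduct.map_tmul, mulL_tmul,
        unitVal_smul, unitVal_centCounit]
      rw [targetMap_mul_of_mem (centralizerVal_mem _ a),
        ((inBase_targetMap _).mul (inBase_targetMap _))]))

lemma centOne_centCounit : centOne k H ≫ centCounit k H = 𝟙 (unitObj (trivialCocycle k H)) :=
  hom_ext (LinearMap.ext fun z => unitVal_injective (inBase_unitVal z))

/-- The antipode axiom of `H` yields `S(a₁)a₂ = ε_s(a)`, whereas the counit is `ε_t`; the two agree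
because `a` centralizes the base. -/
lemma centAntipode_left : centComul k H ≫ tensHom (centAntipode k H) (𝟙 (centObj k H)) ≫
    centMul k H = centCounit k H ≫ centOne k H :=
  hom_ext (LinearMap.ext fun a => centralizerVal_injective _ (by
    have h1 : ∀ w : (centObj k H).carrier ⊗[k] (centObj k H).carrier,
        centVal₂ k H (TensorProduct.map (klin (centAntipode k H)) (klin (𝟙 (centObj k H))) w) =
        TensorProduct.map (S k) LinearMap.id (centVal₂ k H w) := by
      intro w
      induction w with
      | zero => simp
      | add x y hx hy => simp only [map_add, hx, hy]
      | tmul a b => simp [centVal_centAntipode]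
    simp only [klin_comp, LinearMap.comp_apply]
    rw [centVal_centMul, val_tensHom, h1, centVal₂_centComul, antipode_conv_id,
      sourceMap_eq_targetMap (centralizerVal_mem _ a)]
    rfl))

lemma centAntipode_right : centComul k H ≫ tensHom (𝟙 (centObj k H)) (centAntipode k H) ≫
    centMul k H = centCounit k H ≫ centOne k H :=
  hom_ext (LinearMap.ext fun a => centralizerVal_injective _ (by
    have h1 : ∀ w : (centObj k H).carrier ⊗[k] (centObj k H).carrier,
        centVal₂ k H (TensorProduct.map (klin (𝟙 (centObj k H))) (klin (centAntipode k H)) w) =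
        TensorProduct.map LinearMap.id (S k) (centVal₂ k H w) := by
      intro w
      induction w with
      | zero => simp
      | add x y hx hy => simp only [map_add, hx, hy]
      | tmul a b => simp [centVal_centAntipode]
    simp only [klin_comp, LinearMap.comp_apply]
    rw [centVal_centMul, val_tensHom, h1, centVal₂_centComul, id_conv_antipode]
    rfl))

/-- The untwisted Hopf algebra structure of the centralizer `C_H(H_s)`. -/
abbrev centHopfObj : HopfObj (centObj k H) where
  one := centOne k H
  mul := centMul k H
  counit := centCounit k H
  comul := centComul k H
  antipode := centAntipode k H
  one_mul := centOne_centMul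
  mul_one := centMul_centOne
  mul_assoc := centMul_assoc
  counit_comul := by
    -- The counit axioms are stated with the inverse unit constraint; composing with the constraint
    -- itself leads to the form proved above.
    rw [← cancel_mono (λ_ (centObj k H)).hom, Category.assoc, Iso.inv_hom_id]
    exact centComul_centCounit_left
  comul_counit := by
    rw [← cancel_mono (ρ_ (centObj k H)).hom, Category.assoc, Iso.inv_hom_id]
    exact centComul_centCounit_right
  comul_assoc := centComul_coassoc
  mul_comul := centMul_centComul
  one_comul := centOne_centComul
  mul_counit := centMul_centCounit
  one_counit := centOne_centCounit
  antipode_left := centAntipode_left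
  antipode_right := centAntipode_right

end TwMod
end Centralizer

/-! ### Transport to `_H M_F` and the explicit formulas -/

section TwistedCentralizer

open CategoryTheory MonoidalCategory

variable {k : Type v} {H : Type u} [Field k] [Ring H] [Algebra k H] [Coalgebra k H]
  [QuantumGroupoid k H] [IsCocomm k H]

namespace TwMod

/-- The Hopf algebra structure of the centralizer `C_H(H_s)` in `_H M_F`. -/
abbrev twistedCentHopfObj (F : WeakUnitCocycle k H) : HopfObj (centralizerObj F) :=
  letI := centHopfObj (k := k) (H := H)
  hopfObjObj (twist F) (centObj k H)

/-- The transported product is the product of `H` after the action of `F`. The projection in `a ⊗_t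
b` disappears because `FΔ(1) = F`. -/
lemma centVal_centMul_untwist (F : WeakUnitCocycle k H) (a b : (centObj k H).carrier) :
    centVal k H (klin (centMul k H) (untwist F _ _ (twistProj F _ _ (a ⊗ₜ b)))) =
      LinearMap.mul' k H (Ad₂ F.F (centVal k H a ⊗ₜ centVal k H b)) := by
  rw [centVal_centMul, val_untwist, twistVal_twistProj, ← act_mul, F.F_mul_one,
    centralizerVal₂_act, centralizerVal₂_tmul]

/-- The inverse comparison follows the coproduct, which is where `F⁻¹` comes from. -/
lemma centVal₂_retwist_centComul (F : WeakUnitCocycle k H) (a : (centObj k H).carrier) :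
    centVal₂ k H (twistVal F _ _ (retwist F _ _ (klin (centComul k H) a))) =
      Ad₂ F.Finv (comul (R := k) (centVal k H a)) := by
  rw [twistVal_retwist, centralizerVal₂_act, centVal₂_centComul]

end TwMod
end TwistedCentralizer

end WeakHopf

end

open WeakHopf WeakHopf.TwMod CategoryTheory MonoidalCategory TensorProduct MonObj ComonObj in
theorem theorem3p3 {k : Type v} {H : Type u} [Field k] [Ring H] [Algebra k H] [Coalgebra k H]
    [QuantumGroupoid k H] [Coalgebra.IsCocomm k H] (F : WeakUnitCocycle k H) :
    ∃ _ : HopfObj (centralizerObj F),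
      (∀ a b : (centralizerObj F).carrier,
        centralizerVal F (klin μ[centralizerObj F] (tmul a b)) =
          LinearMap.mul' k H (Ad₂ F.F (centralizerVal F a ⊗ₜ[k] centralizerVal F b))) ∧
      (∀ z : (unitObj F).carrier, centralizerVal F (klin η[centralizerObj F] z) = unitVal F z) ∧
      (∀ a : (centralizerObj F).carrier,
        TensorProduct.map (centralizerVal F) (centralizerVal F)
            (val (centralizerObj F) (centralizerObj F) (klin Δ[centralizerObj F] a)) =
          Ad₂ F.Finv (Coalgebra.comul (R := k) (centralizerVal F a))) ∧
      (∀ a : (centralizerObj F).carrier,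
        unitVal F (klin ε[centralizerObj F] a) = targetMap k H (centralizerVal F a)) ∧
      (∀ a : (centralizerObj F).carrier,
        centralizerVal F (klin (HopfObj.antipode (X := centralizerObj F)) a) =
          S k (centralizerVal F a)) := by
  -- Twisting alters neither underlying spaces nor underlying maps, and its unit comparison is the
  -- identity. The formulas for unit, counit and antipode therefore hold by definition; only product
  -- and coproduct involve `F`.
  refine ⟨twistedCentHopfObj F, fun a b => ?_, fun z => ?_, fun a => ?_, fun a => ?_, fun a => ?_⟩
  · exact centVal_centMul_untwist F a b
  · rfl
  · exact centVal₂_retwist_centComul F a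
  · rfl
  · rfl
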